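/- Let $R\in\mathbb{C}[x,y]$ be a nonzero polynomial and let $A=\mathbb{C}[x,y]/(R)$. Write $x_1=x$, $x_2=y$, and let $\partial_iR\in A$ denote the class of $\partial R/\partial x_i$. Let $C^n$ be the space of $\mathbb{C}$-multilinear maps $A^n\to A$, with the Hochschild differential $$(\delta C)(a_1,\dots,a_{n+1})=a_1C(a_2,\dots,a_{n+1})+\sum_{i=1}^{n}(-1)^iC(a_1,\dots,a_ia_{i+1},\dots,a_{n+1})+(-1)^{n+1}C(a_1,\dots,a_n)a_{n+1},$$ and let $H^n$ be its $n$-th cohomology. For each $k$ let $H^{n,k}$ be the Barr–Gerstenhaber–Schack (Hodge) component of $H^n$, that is, the degree-$n$ cohomology of the subcomplex $C^{\bullet,k}$ with $C^{n,k}=\{C\circ e_n(k): C\in C^n\}$. Here the idempotents $e_n(k)\in\mathbb{C}[S_n]$ are given by $$\sum_k t^k e_n(k)=\frac1{n!}\sum_{\sigma\in S_n}(t-d_\sigma)(t-d_\sigma+1)\cdots(t-d_\sigma+n-1)\,\mathrm{sgn}(\sigma)\,\sigma ,$$ where $d_\sigma$ is the number of $i$ with $\sigma(i)>\sigma(i+1)$,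 and $\sigma$ acts on $A^{\otimes n}$ by $\sigma(a_1\otimes\cdots\otimes a_n)=a_{\sigma^{-1}(1)}\otimes\cdots\otimes a_{\sigma^{-1}(n)}$. Let $DR=(\partial_1R,\partial_2R)\subset A$ be the gradient ideal, and let $A_+\subset A$ be the image of the polynomials without constant term. Let $V_R$ be the space of vector fields $v=v_1\partial_1+v_2\partial_2$ with $v_i\in A$ that annihilate $R$, i.e. $v_1\partial_1R+v_2\partial_2R=0$ in $A$. Let $dR^*=\partial_2R\,\partial_1-\partial_1R\,\partial_2\in V_R$. Then, as complex vector spaces, $$H^1\cong V_R,$$ and for every $k>0$ $$H^{2k,k}\cong A/DR,\qquad H^{2k,k+1}\cong\{a\in A_+ : a\,\partial_1R=a\,\partial_2R=0\},\qquad H^{2k+1,k+1}\cong V_R/(A\cdot dR^*).$$ All other components in positive degree vanish: $H^{n,j}=0$ whenever $n>0$ and $2j\notin\{n,n+1,n+2\}$. -/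

import Mathlib

open scoped BigOperators

noncomputable section

/-- The quotient space `Z / (Z ∩ B)` of two subspaces of a vector space; it is `Z / B` when
`B ⊆ Z`. -/
abbrev Subquotient {V : Type*} [AddCommGroup V] [Module ℂ V] (Z B : Submodule ℂ V) : Type _ :=
  Z ⧸ B.submoduleOf Z

/-! ## The Hochschild complex of a commutative algebra and its Hodge decomposition -/

namespace Hochschild

variable (A : Type*) [CommRing A] [Algebra ℂ A]

/-- Hochschild `n`-cochains of `A` with values in `A`: multilinear maps `A × ⋯ × A → A`,
that is, linear maps `A^{⊗ n} → A`. -/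
abbrev Cochain (n : ℕ) : Type _ := MultilinearMap ℂ (fun _ : Fin n => A) A

variable {A}

/-- Changing one entry of a tuple changes exactly one entry of the contracted tuple
`(a₀, …, aⱼaⱼ₊₁, …, aₙ)`, and does so linearly. -/
theorem contractNth_update {n : ℕ} (j : Fin n) (a : Fin (n + 1) → A) (m : Fin (n + 1)) :
    ∃ (m' : Fin n) (l : A →ₗ[ℂ] A), ∀ x : A,
      Fin.contractNth j.castSucc (· * ·) (Function.update a m x) =
        Function.update (Fin.contractNth j.castSucc (· * ·) a) m' (l x) := by
  rcases lt_trichotomy (m : ℕ) (j : ℕ) with h | h | h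
  · refine ⟨⟨m, by omega⟩, LinearMap.id, fun x => ?_⟩
    funext i
    simp only [Fin.contractNth, Function.update_apply, Fin.ext_iff, Fin.val_castSucc,
      Fin.val_succ, LinearMap.id_apply]
    split_ifs <;> first | rfl | omega
  · refine ⟨j, LinearMap.mulRight ℂ (a j.succ), fun x => ?_⟩
    funext i
    simp only [Fin.contractNth, Function.update_apply, Fin.ext_iff, Fin.val_castSucc,
      Fin.val_succ, LinearMap.mulRight_apply]
    split_ifs with h1 h2 h3 <;> first | rfl | omega | skip
    all_goals
      have : i = j := by ext; omega
      rw [this]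
  · by_cases h' : (m : ℕ) = j + 1
    · refine ⟨j, LinearMap.mulLeft ℂ (a j.castSucc), fun x => ?_⟩
      funext i
      simp only [Fin.contractNth, Function.update_apply, Fin.ext_iff, Fin.val_castSucc,
        Fin.val_succ, LinearMap.mulLeft_apply]
      split_ifs with h1 h2 h3 <;> first | rfl | omega | skip
      all_goals
        have : i = j := by ext; omega
        rw [this]
    · refine ⟨⟨m - 1, by omega⟩, LinearMap.id, fun x => ?_⟩
      funext i
      simp only [Fin.contractNth, Function.update_apply, Fin.ext_iff, Fin.val_castSucc,
        Fin.val_succ, LinearMap.id_apply]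
      split_ifs <;> first | rfl | omega

/-- The cochain `(a₀, …, aₙ) ↦ C(a₀, …, aⱼaⱼ₊₁, …, aₙ)`. -/
def face {n : ℕ} (j : Fin n) (C : Cochain A n) : Cochain A (n + 1) where
  toFun a := C (Fin.contractNth j.castSucc (· * ·) a)
  map_update_add' a m x y := by
    rename_i inst
    obtain rfl : inst = instDecidableEqFin (n + 1) := Subsingleton.elim _ _
    obtain ⟨m', l, h⟩ := contractNth_update j a m
    simp only [h, map_add, MultilinearMap.map_update_add]
  map_update_smul' a m c x := by
    rename_i inst
    obtain rfl : inst = instDecidableEqFin (n + 1) := Subsingleton.elim _ _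
    obtain ⟨m', l, h⟩ := contractNth_update j a m
    simp only [h, map_smul, MultilinearMap.map_update_smul]

/-- The cochain `(a₀, …, aₙ) ↦ a₀ C(a₁, …, aₙ)`. -/
def firstFace {n : ℕ} (C : Cochain A n) : Cochain A (n + 1) :=
  LinearMap.uncurryLeft (M := fun _ : Fin (n + 1) => A)
    { toFun := fun a => a • C
      map_add' := fun a b => add_smul a b C
      map_smul' := fun c a => MultilinearMap.ext fun v => smul_assoc c a (C v) }

/-- The cochain `(a₀, …, aₙ) ↦ C(a₀, …, aₙ₋₁) aₙ`. -/
def lastFace {n : ℕ} (C : Cochain A n) : Cochain A (n + 1) :=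
  MultilinearMap.uncurryRight ((LinearMap.mul ℂ A).compMultilinearMap C)

variable (A)

/-- The Hochschild coboundary
`(δC)(a₀, …, aₙ) = a₀ C(a₁, …, aₙ) + ∑ⱼ (-1)^(j+1) C(a₀, …, aⱼaⱼ₊₁, …, aₙ)
  + (-1)^(n+1) C(a₀, …, aₙ₋₁) aₙ`. -/
def coboundary (n : ℕ) : Cochain A n →ₗ[ℂ] Cochain A (n + 1) where
  toFun C := firstFace C + ∑ j : Fin n, (-1 : ℂ) ^ ((j : ℕ) + 1) • face j C
    + (-1 : ℂ) ^ (n + 1) • lastFace C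
  map_add' C D := by
    ext a
    simp only [firstFace, lastFace, face, _root_.add_apply, _root_.sum_apply,
      _root_.smul_apply, LinearMap.uncurryLeft_apply, MultilinearMap.uncurryRight_apply,
      LinearMap.coe_mk, AddHom.coe_mk, MultilinearMap.coe_mk,
      LinearMap.compMultilinearMap_apply, LinearMap.mul_apply', smul_add, add_mul,
      Finset.sum_add_distrib]
    abel
  map_smul' c C := by
    ext a
    simp only [firstFace, lastFace, face, _root_.add_apply, _root_.sum_apply,
      _root_.smul_apply, LinearMap.uncurryLeft_apply, MultilinearMap.uncurryRight_apply,
      LinearMap.coe_mk, AddHom.coe_mk, MultilinearMap.coe_mk,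
      LinearMap.compMultilinearMap_apply, LinearMap.mul_apply', smul_add, smul_mul_assoc,
      Finset.smul_sum, RingHom.id_apply, smul_comm _ c]

theorem coboundary_apply (n : ℕ) (C : Cochain A n) (a : Fin (n + 1) → A) :
    coboundary A n C a = a 0 * C (Fin.tail a)
      + ∑ j : Fin n, (-1 : ℂ) ^ ((j : ℕ) + 1) • C (Fin.contractNth j.castSucc (· * ·) a)
      + (-1 : ℂ) ^ (n + 1) • (C (Fin.init a) * a (Fin.last n)) := by
  simp only [coboundary, LinearMap.coe_mk, AddHom.coe_mk, firstFace, lastFace, face,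
    _root_.add_apply, _root_.sum_apply,
    _root_.smul_apply, LinearMap.uncurryLeft_apply, MultilinearMap.uncurryRight_apply,
    LinearMap.coe_mk, AddHom.coe_mk, MultilinearMap.coe_mk,
    LinearMap.compMultilinearMap_apply, LinearMap.mul_apply', smul_eq_mul]

/-- Hochschild `n`-cocycles. -/
def cocycles (n : ℕ) : Submodule ℂ (Cochain A n) :=
  LinearMap.ker (coboundary A n)

/-- Hochschild `n`-coboundaries. -/
def coboundaries : (n : ℕ) → Submodule ℂ (Cochain A n)
  | 0 => ⊥
  | n + 1 => LinearMap.range (coboundary A n)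

/-- The Hochschild cohomology `Hochⁿ(A, A)`. -/
abbrev Cohomology (n : ℕ) : Type _ :=
  Subquotient (cocycles A n) (coboundaries A n)

end Hochschild

namespace Hochschild

/-- The number of descents of a permutation: the `i` with `σ(i) > σ(i+1)`. -/
def descents {n : ℕ} (σ : Equiv.Perm (Fin n)) : ℕ :=
  Nat.card {i : Fin n // ∃ h : (i : ℕ) + 1 < n, σ ⟨(i : ℕ) + 1, h⟩ < σ i}

/-- The coefficient at `σ` of the Barr–Gerstenhaber–Schack idempotent `eₙ(k) ∈ ℂ[Sₙ]`, given by
Garsia's generating function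
`∑ₖ xᵏ eₙ(k) = (1/n!) ∑_σ (x - d_σ)(x - d_σ + 1)⋯(x - d_σ + n - 1) sgn(σ) σ`. -/
def idempotentCoeff (n k : ℕ) (σ : Equiv.Perm (Fin n)) : ℂ :=
  ((n.factorial : ℂ)⁻¹ * ((Equiv.Perm.sign σ : ℤ) : ℂ)) *
    (∏ i ∈ Finset.range n,
      (Polynomial.X - Polynomial.C (descents σ : ℂ) + Polynomial.C (i : ℂ))).coeff k

variable (A : Type*) [CommRing A] [Algebra ℂ A]

/-- The action `C ↦ C ∘ eₙ(k)` on cochains, where `σ` acts on chains by moving the factor in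
position `i` to position `σ(i)`: `σ(a₁ ⊗ ⋯ ⊗ aₙ) = a_{σ⁻¹(1)} ⊗ ⋯ ⊗ a_{σ⁻¹(n)}`. -/
def hodgeProjector (n k : ℕ) : Cochain A n →ₗ[ℂ] Cochain A n :=
  ∑ σ : Equiv.Perm (Fin n), idempotentCoeff n k σ •
    (MultilinearMap.domDomCongrLinearEquiv ℂ ℂ A A σ⁻¹).toLinearMap

theorem hodgeProjector_apply (n k : ℕ) (C : Cochain A n) (a : Fin n → A) :
    hodgeProjector A n k C a =
      ∑ σ : Equiv.Perm (Fin n), idempotentCoeff n k σ • C (fun i => a (σ⁻¹ i)) := by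
  simp [hodgeProjector]

/-- The component `C^{n,k}` of the Hochschild cochains: the image of `eₙ(k)`. -/
def hodgeCochains (n k : ℕ) : Submodule ℂ (Cochain A n) :=
  LinearMap.range (hodgeProjector A n k)

/-- The cocycles in `C^{n,k}`. -/
def hodgeCocycles (n k : ℕ) : Submodule ℂ (Cochain A n) :=
  cocycles A n ⊓ hodgeCochains A n k

/-- The coboundaries of the complex `C^{•,k}` in degree `n`: the image of `C^{n-1,k}`. -/
def hodgeCoboundaries : (n k : ℕ) → Submodule ℂ (Cochain A n)
  | 0, _ => ⊥
  | n + 1, k => (hodgeCochains A n k).map (coboundary A n)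

/-- The Barr–Gerstenhaber–Schack (Hodge) component `H^{n,k}` of `Hochⁿ(A, A)`: the `n`-th
cohomology of the direct summand `C^{•,k}` of the Hochschild complex. -/
abbrev HodgeCohomology (n k : ℕ) : Type _ :=
  Subquotient (hodgeCocycles A n k) (hodgeCoboundaries A n k)

end Hochschild

/-! ## Plane curves -/

namespace PlaneCurve

open MvPolynomial

/-- The coordinate algebra `A = ℂ[x, y]/(R)`. -/
abbrev CoordRing (R : MvPolynomial (Fin 2) ℂ) : Type :=
  MvPolynomial (Fin 2) ℂ ⧸ Ideal.span {R}

variable (R : MvPolynomial (Fin 2) ℂ)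

/-- The class in `A` of the partial derivative `∂ᵢR`. -/
def partialR (i : Fin 2) : CoordRing R :=
  Ideal.Quotient.mk (Ideal.span {R}) (pderiv i R)

/-- The gradient ideal `DR` of `A`, generated by the partial derivatives of `R`. -/
def gradientIdeal : Ideal (CoordRing R) :=
  Ideal.span (Set.range (partialR R))

/-- The part `A₊` of positive degree: the image in `A` of the polynomials without
constant term. -/
def positivePart : Ideal (CoordRing R) :=
  (RingHom.ker (constantCoeff (R := ℂ) (σ := Fin 2))).map (Ideal.Quotient.mk (Ideal.span {R}))

/-- The space `{a ∈ A₊ : a ∂₁R = a ∂₂R = 0}`. -/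
def gradientAnnihilator : Submodule ℂ (CoordRing R) where
  carrier := {a | a ∈ positivePart R ∧ ∀ i, a * partialR R i = 0}
  add_mem' := fun {a b} ha hb =>
    ⟨Ideal.add_mem _ ha.1 hb.1, fun i => by rw [add_mul, ha.2 i, hb.2 i, add_zero]⟩
  zero_mem' := ⟨Ideal.zero_mem _, fun i => zero_mul _⟩
  smul_mem' := fun c a ha =>
    ⟨Submodule.smul_of_tower_mem _ c ha.1,
      fun i => by rw [smul_mul_assoc, ha.2 i, smul_zero]⟩

/-- Vector fields on the plane with values in `A`: derivations `v₁∂₁ + v₂∂₂` from `ℂ[x, y]`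
to `A`. -/
abbrev VectorField : Type :=
  Derivation ℂ (MvPolynomial (Fin 2) ℂ) (CoordRing R)

/-- The space `V_R` of the vector fields with values in `A` that annihilate `R`. -/
def tangentFields : Submodule ℂ (VectorField R) where
  carrier := {v | v R = 0}
  add_mem' := fun {v w} hv hw => by
    simp only [Set.mem_ofPred_eq] at hv hw ⊢
    rw [Derivation.add_apply, hv, hw, add_zero]
  zero_mem' := rfl
  smul_mem' := fun a v hv => by
    simp only [Set.mem_ofPred_eq] at hv ⊢
    rw [Derivation.smul_apply, hv, smul_zero]

/-- The vector field `dR* = ∂₂R ∂₁ - ∂₁R ∂₂`. -/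
def dualGradient : VectorField R :=
  mkDerivation ℂ ![partialR R 1, -partialR R 0]

/-- The space `A·dR*` of the `A`-multiples of `dR*`. -/
def dualGradientMultiples : Submodule ℂ (VectorField R) :=
  (Submodule.span (CoordRing R) {dualGradient R}).restrictScalars ℂ

/-- The value of `dR*` on a polynomial `f` is `∂₂R ∂₁f - ∂₁R ∂₂f`. -/
theorem dualGradient_apply (f : MvPolynomial (Fin 2) ℂ) :
    dualGradient R f =
      partialR R 1 * Ideal.Quotient.mk (Ideal.span {R}) (pderiv 0 f) -
        partialR R 0 * Ideal.Quotient.mk (Ideal.span {R}) (pderiv 1 f) := by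
  have key : dualGradient R =
      partialR R 1 • (Algebra.linearMap (MvPolynomial (Fin 2) ℂ) (CoordRing R)).compDer
          (pderiv (R := ℂ) (0 : Fin 2)) -
        partialR R 0 • (Algebra.linearMap (MvPolynomial (Fin 2) ℂ) (CoordRing R)).compDer
          (pderiv (R := ℂ) (1 : Fin 2)) := by
    refine MvPolynomial.derivation_ext fun i => ?_
    fin_cases i <;> simp [dualGradient, pderiv_X]
  rw [key]
  rfl

/-- The multiples of `dR*` annihilate `R`. -/
theorem dualGradientMultiples_le : dualGradientMultiples R ≤ tangentFields R := by
  intro v hv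
  obtain ⟨a, rfl⟩ := Submodule.mem_span_singleton.1 hv
  change (a • dualGradient R) R = 0
  rw [Derivation.smul_apply, dualGradient_apply]
  simp only [partialR]
  rw [mul_comm, sub_self, smul_zero]

end PlaneCurve

end

open scoped BigOperators

noncomputable section

set_option linter.unusedSectionVars false
set_option linter.unusedSimpArgs false

/-! ## Cochains as functions on words

A cochain with values in a module `M` is encoded as a function on the words in `A`; the bimodule
structure of `M` is given by two ring homomorphisms `l`, `r` from `A` to a commutative ring `S`
acting on `M`. -/


/-! The bar complex of a commutative algebra carries a graded commutative shuffle product for which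
its differential is a derivation (`shuffle_cobd`, in dual form). Let S = A ⊗ A. The one-letter words
[x], [y] have boundaries x ⊗ 1 - 1 ⊗ x and y ⊗ 1 - 1 ⊗ y, and R ⊗ 1 - 1 ⊗ R is a combination of
these two with difference quotients of R as coefficients. As R = 0 in A, this combination of
boundaries vanishes, and there is a two-letter chain ω bounding the corresponding combination of [x]
and [y]; it can be chosen symmetric. Shuffle products of [x], [y] and the divided powers of ω map a
Tate resolution with two odd generators and one even generator into the bar complex. On cochains
these products become the contractions `ins` and `dpow`, and the resulting chain map `comp`
(`comp_hd`) goes to a small complex `smallD` with two copies of the coefficients in each positive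
degree.

That `comp` is an isomorphism in positive degrees (`isComparison`) is shown by dimension shifting:
every bimodule embeds into a coinduced one, and there both complexes have no cohomology in positive
degrees (`exists_hd_eq_coind`, `exists_smallD_eq_coind`). For the small complex this comes down to
exactness over S. Write S as the quotient of A ⊗ ℂ[x, y] by 1 ⊗ R. Upstairs, x ⊗ 1 - 1 ⊗ x and y ⊗ 1
- 1 ⊗ y satisfy Koszul exactness, 1 ⊗ R is regular because R ≠ 0, and the differentials form a
matrix factorization of -(1 ⊗ R) (`exists_isResolving`).

With coefficients in A the elements x ⊗ 1 - 1 ⊗ x and y ⊗ 1 - 1 ⊗ y act by zero and the symmetrized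
difference quotients act by the partial derivatives of R. The cohomology can then be read off: the
kernel of (∂₁R, ∂₂R) in odd degrees, modulo the multiples of dR* from degree three on, and A/DR plus
the annihilator of DR in positive even degrees.

For the Hodge decomposition, the polynomial defining the coefficients of the idempotents, at an
integer m, counts the maps to `Fin m` that a permutation sorts (`genPoly_eval`). Lexicographic
sorting makes these counts multiplicative in m, so C^{n,k} is the 2^k-eigenspace of the second Adams
operation (`mem_hodgeCochains`). On words this operation is deconcatenation followed by shuffling
(`adams_ofFn`); it commutes with the coboundary, and each of [x], [y], ω contributes a factor 2.
Hence every coordinate of `comp` sees a single Hodge component. Finally, membership in A₊ is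
automatic for elements annihilating DR (`mem_positivePart_of_mul_partialR_eq_zero`). -/

namespace WordCochain

section Calculus

variable {A M S : Type*} [CommRing A] [CommRing S] [AddCommGroup M] [Module S M]

variable (S M) in
/-- The cochain `w ↦ F (a w)`. -/
def slice (a : A) : (List A → M) →ₗ[S] (List A → M) :=
  LinearMap.funLeft S M (List.cons a)

@[simp] theorem slice_apply (a : A) (F : List A → M) (t : List A) :
    slice M S a F t = F (a :: t) := rfl

variable (M) in
/-- The part of the coboundary that involves the product of the letter `a` with its successor. -/
def mergeAt (l r : A →+* S) (a : A) : List A → ((List A → M) →ₗ[S] M)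
  | [] => -(r a • LinearMap.proj [])
  | b :: t => l b • LinearMap.proj (a :: t) - LinearMap.proj (a * b :: t)

variable (M) in
/-- See `mergeAt`. -/
def merge (l r : A →+* S) (a : A) : (List A → M) →ₗ[S] (List A → M) :=
  LinearMap.pi (mergeAt M l r a)

@[simp] theorem merge_nil (l r : A →+* S) (a : A) (F : List A → M) :
    merge M l r a F [] = -(r a • F []) := rfl

@[simp] theorem merge_cons (l r : A →+* S) (a b : A) (t : List A) (F : List A → M) :
    merge M l r a F (b :: t) = l b • F (a :: t) - F (a * b :: t) := rfl

variable (M) in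
/-- The Hochschild coboundary evaluated at a word. -/
def cobdAt (l r : A →+* S) : List A → ((List A → M) →ₗ[S] M)
  | [] => 0
  | a :: t => l a • LinearMap.proj t - (cobdAt l r t).comp (slice M S a) + mergeAt M l r a t

variable (M) in
/-- The Hochschild coboundary. -/
def cobd (l r : A →+* S) : (List A → M) →ₗ[S] (List A → M) :=
  LinearMap.pi (cobdAt M l r)

@[simp] theorem cobd_nil (l r : A →+* S) (F : List A → M) : cobd M l r F [] = 0 := rfl

@[simp] theorem cobd_cons (l r : A →+* S) (a : A) (t : List A) (F : List A → M) :
    cobd M l r F (a :: t) =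
      l a • F t - cobd M l r (slice M S a F) t + merge M l r a F t := rfl

theorem slice_cobd (l r : A →+* S) (a : A) (F : List A → M) :
    slice M S a (cobd M l r F) = l a • F - cobd M l r (slice M S a F) + merge M l r a F := rfl

theorem slice_merge (l r : A →+* S) (a b : A) (F : List A → M) :
    slice M S b (merge M l r a F) = l b • slice M S a F - slice M S (a * b) F := rfl

theorem merge_merge (l r : A →+* S) (a b : A) (F : List A → M) :
    merge M l r b (merge M l r a F) = -merge M l r (a * b) F := by
  funext t
  cases t with
  | nil => simp [smul_smul, mul_comm]
  | cons c t =>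
    simp only [merge_cons, Pi.neg_apply, map_mul]
    rw [show a * (b * c) = a * b * c by ring]
    module

theorem cobd_merge (l r : A →+* S) (a : A) (F : List A → M) :
    cobd M l r (merge M l r a F) = merge M l r a (cobd M l r F) := by
  funext t
  cases t with
  | nil => simp
  | cons b t =>
    simp only [merge_cons, cobd_cons, slice_merge, merge_merge, map_sub, map_smul, Pi.sub_apply,
      Pi.smul_apply, Pi.neg_apply, map_mul]
    module

/-- Unfolding the first letter of `slice_cobd`, all terms cancel in pairs once `merge` is known to
commute with the coboundary; what is left is the statement for the sliced cochain on a shorter word.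
-/
theorem cobd_cobd (l r : A →+* S) (F : List A → M) : cobd M l r (cobd M l r F) = 0 := by
  funext t
  induction t generalizing F with
  | nil => simp
  | cons a t ih =>
    have := ih (slice M S a F)
    rw [cobd_cons, slice_cobd]
    simp only [map_add, map_sub, map_smul, cobd_merge, Pi.add_apply, Pi.sub_apply, Pi.smul_apply,
      this, Pi.zero_apply]
    module

/-! ### Shuffles -/

variable (M S) in
/-- The value of a cochain on the signed shuffle product of two words. -/
def shuffle : List A → List A → ((List A → M) →ₗ[S] M)
  | [], v => LinearMap.proj v
  | a :: u, [] => LinearMap.proj (a :: u)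
  | a :: u, b :: v => (shuffle u (b :: v)).comp (slice M S a) +
      (-1 : S) ^ (u.length + 1) • (shuffle (a :: u) v).comp (slice M S b)
termination_by u v => u.length + v.length

@[simp] theorem shuffle_nil_left (v : List A) (F : List A → M) : shuffle M S [] v F = F v := by
  simp [shuffle]

@[simp] theorem shuffle_nil_right (u : List A) (F : List A → M) : shuffle M S u [] F = F u := by
  cases u <;> simp [shuffle]

theorem shuffle_cons_cons (a b : A) (u v : List A) (F : List A → M) :
    shuffle M S (a :: u) (b :: v) F = shuffle M S u (b :: v) (slice M S a F) +
      (-1 : S) ^ (u.length + 1) • shuffle M S (a :: u) v (slice M S b F) := by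
  simp [shuffle]

theorem shuffle_comm (u v : List A) (F : List A → M) :
    shuffle M S u v F = (-1 : S) ^ (u.length * v.length) • shuffle M S v u F := by
  induction u generalizing v F with
  | nil => simp
  | cons a u ihu =>
    induction v generalizing F with
    | nil => simp
    | cons b v ihv =>
      rw [shuffle_cons_cons, shuffle_cons_cons, ihu, ihv]
      simp only [List.length_cons, add_mul, mul_add, pow_add, one_mul, mul_one, pow_one]
      rcases neg_one_pow_eq_or S u.length with h | h <;>
      rcases neg_one_pow_eq_or S v.length with h' | h' <;>
      rcases neg_one_pow_eq_or S (u.length * v.length) with h'' | h'' <;>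
      simp only [h, h', h''] <;> module

/-- A letter taken from the second word costs a sign depending on the length of the first. When the
first word is itself a variable of a cochain, slicing produces this parity twist, which must then be
pulled out. -/
theorem shuffle_sign (u v : List A) (F : List A → M) :
    shuffle M S u v (fun t => (-1 : S) ^ t.length • F t) =
      (-1 : S) ^ (u.length + v.length) • shuffle M S u v F := by
  induction u generalizing v F with
  | nil => simp
  | cons a u ihu =>
    induction v generalizing F with
    | nil => simp
    | cons b v ihv =>
      have key : ∀ c : A, slice M S c (fun t => (-1 : S) ^ t.length • F t) =
          (-1 : S) • fun t => (-1 : S) ^ t.length • slice M S c F t := by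
        intro c; funext t; simp [pow_succ]
      rw [shuffle_cons_cons, shuffle_cons_cons, key, key, map_smul, map_smul, ihu, ihv]
      simp only [List.length_cons, pow_succ, pow_add]
      module

/-- Both sides split into three terms according to which word supplies the first letter; each term
is an instance with one word shortened. -/
theorem shuffle_assoc (u w v : List A) (F : List A → M) :
    shuffle M S w v (fun t => shuffle M S u t F) =
      shuffle M S u w (fun t => shuffle M S t v F) := by
  induction u generalizing w v F with
  | nil => simp
  | cons a u ihu =>
    induction w generalizing v F with
    | nil => simp
    | cons b w ihw =>
      induction v generalizing F with
      | nil => simp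
      | cons c v ihv =>
        have e1 : ∀ d : A, slice M S d (fun t => shuffle M S (a :: u) t F) =
            slice M S d (fun t => shuffle M S u t (slice M S a F)) +
            (-1 : S) ^ (u.length + 1) • fun t => shuffle M S (a :: u) t (slice M S d F) := by
          intro d; funext t; simp [shuffle_cons_cons]
        have e2 : ∀ d : A, slice M S d (fun t => shuffle M S t (c :: v) F) =
            (fun t => shuffle M S t (c :: v) (slice M S d F)) + (-1 : S) •
            fun t => (-1 : S) ^ t.length •
              (slice M S d fun t => shuffle M S t v (slice M S c F)) t := by
          intro d; funext t; simp [shuffle_cons_cons, pow_succ]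
        rw [shuffle_cons_cons, shuffle_cons_cons, e1, e1, e2, e2]
        simp only [map_add, map_smul, shuffle_sign]
        have h1 := ihu (b :: w) (c :: v) (slice M S a F)
        have h2 := ihw (c :: v) (slice M S b F)
        have h3 := ihv (slice M S c F)
        rw [shuffle_cons_cons] at h1
        rw [shuffle_cons_cons a b] at h3
        rw [h2, h3, ← h1]
        simp only [List.length_cons, pow_succ, pow_add]
        rcases neg_one_pow_eq_or S u.length with h | h <;>
        rcases neg_one_pow_eq_or S w.length with h' | h' <;> simp only [h, h'] <;> module

theorem cobd_sign (l r : A →+* S) (t : List A) (F : List A → M) :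
    cobd M l r (fun t => (-1 : S) ^ t.length • F t) t =
      -((-1 : S) ^ t.length • cobd M l r F t) := by
  induction t generalizing F with
  | nil => simp
  | cons a t ih =>
    have key : slice M S a (fun t => (-1 : S) ^ t.length • F t) =
        (-1 : S) • fun t => (-1 : S) ^ t.length • slice M S a F t := by
      funext t; simp [pow_succ]
    rw [cobd_cons, key, map_smul, Pi.smul_apply, ih, cobd_cons]
    cases t with
    | nil => simp; module
    | cons b t => simp only [merge_cons, List.length_cons, pow_succ]; module

/-- The bookkeeping at the front of two words in the derivation rule. Products of two letters from
different words occur as ab and as ba with opposite signs, and cancel by commutativity of `A`. -/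
theorem shuffle_merge (l r : A →+* S) (a b : A) (u v : List A) (F : List A → M) :
    shuffle M S u (b :: v) (merge M l r a F) +
        (-1 : S) ^ (u.length + 1) • shuffle M S (a :: u) v (merge M l r b F) =
      merge M l r a (fun t => shuffle M S t (b :: v) F) u
      - (-1 : S) ^ u.length • (l a • shuffle M S u v (slice M S b F) +
          merge M l r a (fun t => shuffle M S t v (slice M S b F)) u)
      + (-1 : S) ^ (u.length + 1) • merge M l r b (fun t => shuffle M S (a :: u) t F) v
      + (-1 : S) ^ u.length • (l b • shuffle M S u v (slice M S a F) +
          merge M l r b (fun t => shuffle M S u t (slice M S a F)) v) := by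
  cases u with
  | nil =>
    cases v with
    | nil =>
      simp only [shuffle_nil_left, shuffle_nil_right, merge_nil, merge_cons, slice_apply,
        List.length_nil, shuffle_cons_cons]
      rw [mul_comm b a]; simp; module
    | cons d v =>
      simp only [shuffle_nil_left, merge_nil, merge_cons, slice_apply,
        List.length_nil, shuffle_cons_cons, slice_merge, Pi.sub_apply, Pi.smul_apply, map_sub,
        map_smul]
      rw [mul_comm b a]; module
  | cons c u =>
    cases v with
    | nil =>
      simp only [shuffle_nil_right, merge_nil, merge_cons, slice_apply,
        List.length_nil, List.length_cons, shuffle_cons_cons, slice_merge, Pi.sub_apply,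
        Pi.smul_apply, map_sub, map_smul, pow_succ]
      rw [mul_comm b a]
      rcases neg_one_pow_eq_or S u.length with h | h <;> simp only [h] <;> module
    | cons d v =>
      simp only [merge_cons, slice_apply,
        List.length_cons, shuffle_cons_cons, slice_merge, Pi.sub_apply,
        Pi.smul_apply, map_sub, map_smul, pow_succ]
      rw [mul_comm b a]
      rcases neg_one_pow_eq_or S u.length with h | h <;> simp only [h] <;> module

/-- Dual form of the fact that the bar differential is a graded derivation of the shuffle product.
-/
theorem shuffle_cobd (l r : A →+* S) (u v : List A) (F : List A → M) :
    shuffle M S u v (cobd M l r F) =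
      cobd M l r (fun t => shuffle M S t v F) u +
        (-1 : S) ^ u.length • cobd M l r (fun t => shuffle M S u t F) v := by
  induction u generalizing v F with
  | nil => simp
  | cons a u ihu =>
    induction v generalizing F with
    | nil => simp
    | cons b v ihv =>
      have e1 : slice M S a (fun t => shuffle M S t (b :: v) F) =
          (fun t => shuffle M S t (b :: v) (slice M S a F)) + (-1 : S) •
          fun t => (-1 : S) ^ t.length •
            (slice M S a fun t => shuffle M S t v (slice M S b F)) t := by
        funext t; simp [shuffle_cons_cons, pow_succ]
      have e2 : slice M S b (fun t => shuffle M S (a :: u) t F) =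
          slice M S b (fun t => shuffle M S u t (slice M S a F)) +
          (-1 : S) ^ (u.length + 1) • fun t => shuffle M S (a :: u) t (slice M S b F) := by
        funext t; simp [shuffle_cons_cons]
      have h1 := ihu (b :: v) (slice M S a F)
      have h2 := ihv (slice M S b F)
      have h3 := shuffle_merge l r a b u v F
      rw [cobd_cons] at h1 h2
      rw [shuffle_cons_cons, slice_cobd, slice_cobd, cobd_cons, cobd_cons, e1, e2]
      simp only [map_add, map_sub, map_smul, Pi.add_apply, Pi.smul_apply, cobd_sign, h1, h2]
      rw [← sub_eq_zero] at h3 ⊢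
      rw [← h3]
      simp only [List.length_cons, pow_succ]
      rcases neg_one_pow_eq_or S u.length with h | h <;> simp only [h] <;> module

end Calculus

end WordCochain

/-! ### Contractions with words, deconcatenation and their commutation rules. -/

namespace WordCochain

section Insertion

variable {A M S : Type*} [CommRing A] [CommRing S] [AddCommGroup M] [Module S M]

variable (M S) in
/-- Contraction of a cochain with a word, the adjoint of the shuffle product by this word. -/
def ins (w : List A) : (List A → M) →ₗ[S] (List A → M) :=
  LinearMap.pi (shuffle M S w)

theorem ins_apply (w v : List A) (F : List A → M) : ins M S w F v = shuffle M S w v F := rfl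

@[simp] theorem ins_nil (w : List A) (F : List A → M) : ins M S w F [] = F w := by
  simp [ins_apply]

theorem ins_singleton_cons (p a : A) (t : List A) (F : List A → M) :
    ins M S [p] F (a :: t) = F (p :: a :: t) - ins M S [p] (slice M S a F) t := by
  simp [ins_apply, shuffle_cons_cons, sub_eq_add_neg]

theorem ins_pair_cons (p q a : A) (t : List A) (F : List A → M) :
    ins M S [p, q] F (a :: t) =
      ins M S [q] (slice M S p F) (a :: t) + ins M S [p, q] (slice M S a F) t := by
  simp [ins_apply, shuffle_cons_cons]

theorem ins_comm (u w : List A) (F : List A → M) :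
    ins M S u (ins M S w F) = (-1 : S) ^ (u.length * w.length) • ins M S w (ins M S u F) := by
  funext v
  change shuffle M S u v (fun t => shuffle M S w t F) =
    (-1 : S) ^ (u.length * w.length) • shuffle M S w v (fun t => shuffle M S u t F)
  rw [shuffle_assoc, shuffle_assoc, shuffle_comm, mul_comm]

/-- The signed shuffle square of a one-letter word vanishes: its two terms have opposite signs. -/
theorem ins_singleton_self (p : A) (F : List A → M) : ins M S [p] (ins M S [p] F) = 0 := by
  funext v
  change shuffle M S [p] v (fun t => shuffle M S [p] t F) = 0
  rw [shuffle_assoc]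
  simp [shuffle_cons_cons]

theorem ins_singleton_anticomm (p q : A) (F : List A → M) :
    ins M S [p] (ins M S [q] F) = -ins M S [q] (ins M S [p] F) := by
  rw [ins_comm]; simp

theorem ins_singleton_cobd (l r : A →+* S) (p : A) (F : List A → M) :
    ins M S [p] (cobd M l r F) = (l p - r p) • F - cobd M l r (ins M S [p] F) := by
  funext v
  rw [ins_apply, shuffle_cobd]
  simp only [cobd_cons, shuffle_nil_left, cobd_nil, merge_nil, List.length_singleton, pow_one,
    Pi.sub_apply, Pi.smul_apply]
  change _ + (-1 : S) • cobd M l r (ins M S [p] F) v = _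
  module

/-- The derivation rule for the word [p, q], whose bar boundary is p[q] - [pq] + [p]q. -/
theorem ins_pair_cobd (l r : A →+* S) (p q : A) (F : List A → M) :
    ins M S [p, q] (cobd M l r F) = l p • ins M S [q] F - ins M S [p * q] F + r q • ins M S [p] F
      + cobd M l r (ins M S [p, q] F) := by
  funext v
  rw [ins_apply, shuffle_cobd]
  simp only [cobd_cons, shuffle_nil_left, cobd_nil, merge_nil, merge_cons, slice_apply,
    Pi.sub_apply, Pi.add_apply, Pi.smul_apply, List.length_cons, List.length_nil, ins_apply]
  change _ + (-1 : S) ^ 2 • cobd M l r (ins M S [p, q] F) v = _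
  module

/-! ### The Adams operation -/

variable (M S) in
/-- The sum of the values of a function of two words over all factorizations of a word. -/
def cutAt : List A → ((List A → List A → M) →ₗ[S] M)
  | [] => (LinearMap.proj (φ := fun _ : List A => M) []).comp
      (LinearMap.proj (φ := fun _ : List A => List A → M) [])
  | a :: t => (LinearMap.proj (φ := fun _ : List A => M) (a :: t)).comp
      (LinearMap.proj (φ := fun _ : List A => List A → M) []) +
      (cutAt t).comp (LinearMap.funLeft S _ (List.cons a))

variable (M S) in
/-- See `cutAt`. -/
def cut : (List A → List A → M) →ₗ[S] (List A → M) := LinearMap.pi (cutAt M S)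

@[simp] theorem cut_nil (G : List A → List A → M) : cut M S G [] = G [] [] := rfl

theorem cut_cons (a : A) (t : List A) (G : List A → List A → M) :
    cut M S G (a :: t) = G [] (a :: t) + cut M S (fun u => G (a :: u)) t := rfl

theorem slice_cut (a : A) (G : List A → List A → M) :
    slice M S a (cut M S G) = slice M S a (G []) + cut M S (fun u => G (a :: u)) := rfl

theorem ins_singleton_cut (p : A) (G : List A → List A → M) :
    ins M S [p] (cut M S G) = cut M S ((fun u v => ins M S [p] (fun s => G s v) u) +
      fun u v => (-1 : S) ^ u.length • ins M S [p] (G u) v) := by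
  funext l
  induction l generalizing G with
  | nil => simp [cut_cons, add_comm]
  | cons a t ih =>
    have key : (fun u => ((fun u v => ins M S [p] (fun s => G s v) u) +
          fun u v => (-1 : S) ^ u.length • ins M S [p] (G u) v) (a :: u)) =
        (fun u v => G (p :: a :: u) v) -
        ((fun u v => ins M S [p] (fun s => G (a :: s) v) u) +
          fun u v => (-1 : S) ^ u.length • ins M S [p] (G (a :: u)) v) := by
      funext u v
      simp only [Pi.add_apply, Pi.sub_apply, ins_singleton_cons, List.length_cons, pow_succ]
      change _ - ins M S [p] (fun s => G (a :: s) v) u + _ = _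
      module
    rw [cut_cons, key, map_sub, Pi.sub_apply, ← ih, ins_singleton_cons, slice_cut, map_add]
    simp only [Pi.add_apply, cut_cons, ins_nil, ins_singleton_cons, List.length_nil]
    module

/-- Deconcatenation is multiplicative for shuffles: the inserted letters fall both to the left of
the cut, both to its right, or one on each side; then p, which comes first, is on the left. -/
theorem ins_pair_cut (p q : A) (G : List A → List A → M) :
    ins M S [p, q] (cut M S G) = cut M S ((fun u v => ins M S [p, q] (fun s => G s v) u) +
      (fun u v => ins M S [p, q] (G u) v) +
      fun u v => (-1 : S) ^ u.length • ins M S [p] (fun s => ins M S [q] (G s) v) u) := by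
  funext l
  induction l generalizing G with
  | nil => simp [cut_cons]; abel
  | cons a t ih =>
    have key : (fun u => ((fun u v => ins M S [p, q] (fun s => G s v) u) +
          (fun u v => ins M S [p, q] (G u) v) +
          fun u v => (-1 : S) ^ u.length •
            ins M S [p] (fun s => ins M S [q] (G s) v) u) (a :: u)) =
        (fun u => ((fun u v => ins M S [q] (fun s => G (p :: s) v) u) +
          fun u v => (-1 : S) ^ u.length • ins M S [q] (G (p :: u)) v) (a :: u)) +
        ((fun u v => ins M S [p, q] (fun s => G (a :: s) v) u) +
          (fun u v => ins M S [p, q] (G (a :: u)) v) +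
          fun u v => (-1 : S) ^ u.length •
            ins M S [p] (fun s => ins M S [q] (G (a :: s)) v) u) := by
      funext u v
      simp only [Pi.add_apply, ins_pair_cons, List.length_cons, pow_succ]
      rw [ins_singleton_cons p]
      change ins M S [q] (fun s => G (p :: s) v) (a :: u) +
        ins M S [p, q] (fun s => G (a :: s) v) u + _ +
        _ • (_ - ins M S [p] (fun s => ins M S [q] (G (a :: s)) v) u) = _
      module
    have h1 := congr_fun (ins_singleton_cut (S := S) q (fun u => G (p :: u))) (a :: t)
    rw [cut_cons] at h1
    have h2 := ih (fun u => G (a :: u))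
    rw [cut_cons, key, map_add, ins_pair_cons, slice_cut, slice_cut, map_add, map_add]
    simp only [Pi.add_apply (cut M S _), Pi.add_apply (ins M S _ _), h1, h2]
    simp only [Pi.add_apply, ins_nil, ins_pair_cons, List.length_nil]
    module

theorem merge_cut (l r : A →+* S) (hsym : ∀ a (m : M), l a • m = r a • m) (a : A)
    (t : List A) (G : List A → List A → M) :
    merge M l r a (cut M S G) t = l a • G [] t + merge M l r a (G []) t +
      cut M S (fun u v => merge M l r a (fun s => G s v) u) t := by
  cases t with
  | nil => simp [hsym]
  | cons b t =>
    have key : (fun u v => l b • G (a :: u) v - G (a * b :: u) v) =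
        l b • (fun u => G (a :: u)) - fun u => G (a * b :: u) := rfl
    simp only [merge_cons, cut_cons, merge_nil, hsym a]
    rw [key, map_sub, map_smul, Pi.sub_apply, Pi.smul_apply]
    module

/-- Deconcatenation respects the coboundary. The only terms on the right without a counterpart are
the last face of the left factor and the first face of the right factor at a cut; they have opposite
signs and cancel because both actions agree on `M`. -/
theorem cobd_cut (l r : A →+* S) (hsym : ∀ a (m : M), l a • m = r a • m)
    (G : List A → List A → M) :
    cobd M l r (cut M S G) = cut M S ((fun u v => cobd M l r (fun s => G s v) u) +
      fun u v => (-1 : S) ^ u.length • cobd M l r (G u) v) := by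
  funext t
  induction t generalizing G with
  | nil => simp
  | cons a t ih =>
    have key : (fun u => ((fun u v => cobd M l r (fun s => G s v) u) +
          fun u v => (-1 : S) ^ u.length • cobd M l r (G u) v) (a :: u)) =
        l a • G + (fun u v => merge M l r a (fun s => G s v) u) -
        ((fun u v => cobd M l r (fun s => G (a :: s) v) u) +
          fun u v => (-1 : S) ^ u.length • cobd M l r (G (a :: u)) v) := by
      funext u v
      simp only [Pi.add_apply, Pi.sub_apply, Pi.smul_apply, cobd_cons, List.length_cons, pow_succ]
      change _ - cobd M l r (fun s => G (a :: s) v) u + _ + _ = _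
      module
    rw [cut_cons, key, map_sub, map_add, map_smul, Pi.sub_apply, ← ih, cobd_cons, slice_cut,
      merge_cut l r hsym]
    simp only [Pi.add_apply, Pi.smul_apply, map_add, cobd_nil, cobd_cons, List.length_nil]
    module

variable (M S) in
/-- The second Adams operation: the sum of the shuffles of all factorizations of a word. -/
def adams : (List A → M) →ₗ[S] (List A → M) :=
  (cut M S).comp (LinearMap.pi fun u => LinearMap.pi fun v => shuffle M S u v)

theorem adams_eq (F : List A → M) : adams M S F = cut M S (fun u v => shuffle M S u v F) := rfl

theorem cobd_adams (l r : A →+* S) (hsym : ∀ a (m : M), l a • m = r a • m) (F : List A → M) :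
    cobd M l r (adams M S F) = adams M S (cobd M l r F) := by
  rw [adams_eq, cobd_cut l r hsym, adams_eq]
  congr 1
  funext u v
  exact (shuffle_cobd l r u v F).symm

theorem ins_shuffle_left (w u v : List A) (F : List A → M) :
    ins M S w (fun s => shuffle M S s v F) u = shuffle M S u v (ins M S w F) :=
  (shuffle_assoc w u v F).symm

theorem ins_shuffle_right (w u v : List A) (F : List A → M) :
    ins M S w (fun s => shuffle M S u s F) v =
      (-1 : S) ^ (u.length * w.length) • shuffle M S u v (ins M S w F) := by
  rw [ins_apply, shuffle_assoc, shuffle_comm, ← ins_shuffle_left]; rfl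

/-- A letter is primitive for deconcatenation: it goes into the left or the right factor, and after
shuffling both cases give the same term. -/
theorem ins_singleton_adams (p : A) (F : List A → M) :
    ins M S [p] (adams M S F) = (2 : S) • adams M S (ins M S [p] F) := by
  rw [adams_eq, ins_singleton_cut, adams_eq, ← map_smul]
  congr 1
  funext u v
  simp only [Pi.add_apply, Pi.smul_apply]
  rw [ins_shuffle_left]
  change _ + _ • ins M S [p] (fun s => shuffle M S u s F) v = _
  rw [ins_shuffle_right, List.length_singleton, mul_one]
  rcases neg_one_pow_eq_or S u.length with h | h <;> simp only [h] <;> module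

/-- The correction comes from cuts between the two letters. It is antisymmetric in them, so the
symmetrized pair behaves like a primitive element. -/
theorem ins_pair_adams (p q : A) (F : List A → M) :
    ins M S [p, q] (adams M S F) =
      (2 : S) • adams M S (ins M S [p, q] F) - adams M S (ins M S [p] (ins M S [q] F)) := by
  rw [adams_eq, ins_pair_cut, adams_eq, adams_eq, ← map_smul, ← map_sub]
  congr 1
  funext u v
  simp only [Pi.add_apply, Pi.smul_apply, Pi.sub_apply]
  rw [ins_shuffle_left]
  change _ + ins M S [p, q] (fun s => shuffle M S u s F) v +
    _ • ins M S [p] (fun s' => ins M S [q] (fun s => shuffle M S s' s F) v) u = _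
  simp only [ins_shuffle_right, List.length_cons, List.length_nil, mul_one, zero_add]
  have key := ins_shuffle_left (S := S) [p] u v (ins M S [q] F)
  rw [ins_apply] at key
  rw [ins_apply, shuffle_sign, key]
  simp only [List.length_singleton, pow_add, pow_mul, pow_one]
  rcases neg_one_pow_eq_or S u.length with h | h <;> simp only [h] <;> module

/-- Contraction with the symmetrized pair `p ⊗ q + q ⊗ p` has weight one. -/
theorem ins_symm_pair_adams (p q : A) (F : List A → M) :
    ins M S [p, q] (adams M S F) + ins M S [q, p] (adams M S F) =
      (2 : S) • adams M S (ins M S [p, q] F + ins M S [q, p] F) := by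
  rw [ins_pair_adams, ins_pair_adams, ins_singleton_anticomm p q, map_neg, map_add]
  module

end Insertion

end WordCochain

/-! ### Multilinear cochains among the functions on words. -/

namespace WordCochain

section Multilinear

variable {A M N S : Type*} [CommRing A] [Algebra ℂ A] [CommRing S] [Algebra ℂ S]
  [AddCommGroup M] [Module ℂ M] [Module S M] [IsScalarTower ℂ S M]
  [AddCommGroup N] [Module ℂ N] [Module S N] [IsScalarTower ℂ S N]

variable (A M) in
/-- The functions on words that vanish outside length `n` and are multilinear on the words of
length `n`. -/
def coch : ℕ → Submodule ℂ (List A → M)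
  | 0 =>
    { carrier := {F | ∀ a t, F (a :: t) = 0}
      add_mem' := fun hF hG a t => by simp [hF a t, hG a t]
      zero_mem' := fun _ _ => rfl
      smul_mem' := fun c F hF a t => by simp [hF a t] }
  | n + 1 =>
    { carrier := {F | F [] = 0 ∧ (∀ a b t, F ((a + b) :: t) = F (a :: t) + F (b :: t)) ∧
        (∀ (c : ℂ) a t, F ((c • a) :: t) = c • F (a :: t)) ∧
        ∀ a, (fun t => F (a :: t)) ∈ coch n}
      add_mem' := fun {F G} hF hG => by
        refine ⟨by simp [hF.1, hG.1], fun a b t => ?_, fun c a t => ?_, fun a => ?_⟩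
        · simp only [Pi.add_apply, hF.2.1, hG.2.1]; abel
        · simp only [Pi.add_apply, hF.2.2.1, hG.2.2.1, smul_add]
        · exact (coch n).add_mem (hF.2.2.2 a) (hG.2.2.2 a)
      zero_mem' := ⟨rfl, by simp, by simp, fun a => (coch n).zero_mem⟩
      smul_mem' := fun c F hF => by
        refine ⟨by simp [hF.1], fun a b t => ?_, fun c' a t => ?_, fun a => ?_⟩
        · simp only [Pi.smul_apply, hF.2.1, smul_add]
        · simp only [Pi.smul_apply, hF.2.2.1, smul_comm c]
        · exact (coch n).smul_mem c (hF.2.2.2 a) }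

theorem mem_coch_zero {F : List A → M} : F ∈ coch A M 0 ↔ ∀ a t, F (a :: t) = 0 := Iff.rfl

theorem mem_coch_succ {n : ℕ} {F : List A → M} : F ∈ coch A M (n + 1) ↔
    F [] = 0 ∧ (∀ a b t, F ((a + b) :: t) = F (a :: t) + F (b :: t)) ∧
      (∀ (c : ℂ) a t, F ((c • a) :: t) = c • F (a :: t)) ∧
      ∀ a, (fun t => F (a :: t)) ∈ coch A M n := Iff.rfl

theorem coch_apply_of_length_ne {n : ℕ} {F : List A → M} (hF : F ∈ coch A M n) {t : List A}
    (ht : t.length ≠ n) : F t = 0 := by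
  induction n generalizing F t with
  | zero =>
    cases t with
    | nil => simp at ht
    | cons a t => exact hF a t
  | succ n ih =>
    cases t with
    | nil => exact hF.1
    | cons a t => exact ih (hF.2.2.2 a) (by simpa using ht)

theorem coch_add_cons {n : ℕ} {F : List A → M} (hF : F ∈ coch A M n) (a b : A) (t : List A) :
    F ((a + b) :: t) = F (a :: t) + F (b :: t) := by
  cases n with
  | zero => simp [hF _ _]
  | succ n => exact hF.2.1 a b t

theorem coch_smul_cons {n : ℕ} {F : List A → M} (hF : F ∈ coch A M n) (c : ℂ) (a : A)
    (t : List A) : F ((c • a) :: t) = c • F (a :: t) := by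
  cases n with
  | zero => simp [hF _ _]
  | succ n => exact hF.2.2.1 c a t

theorem slice_mem_coch {n : ℕ} {F : List A → M} (hF : F ∈ coch A M n) (a : A) :
    slice M S a F ∈ coch A M (n - 1) := by
  cases n with
  | zero =>
    rw [show slice M S a F = 0 from funext fun t => hF a t]
    exact Submodule.zero_mem _
  | succ n => exact hF.2.2.2 a

theorem smul_mem_coch {n : ℕ} (s : S) {F : List A → M} (hF : F ∈ coch A M n) :
    s • F ∈ coch A M n := by
  induction n generalizing F with
  | zero => intro a t; simp [hF a t]
  | succ n ih =>
    refine ⟨by simp [hF.1], fun a b t => ?_, fun c' a t => ?_, fun a => ih (hF.2.2.2 a)⟩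
    · simp only [Pi.smul_apply, hF.2.1, smul_add]
    · simp only [Pi.smul_apply, hF.2.2.1, smul_comm s c']

theorem comp_mem_coch {n : ℕ} (g : M →ₗ[ℂ] N) {F : List A → M} (hF : F ∈ coch A M n) :
    (fun t => g (F t)) ∈ coch A N n := by
  induction n generalizing F with
  | zero => intro a t; simp [hF a t]
  | succ n ih =>
    refine ⟨by simp [hF.1], fun a b t => ?_, fun c' a t => ?_, fun a => ih (hF.2.2.2 a)⟩
    · simp only [hF.2.1, map_add]
    · simp only [hF.2.2.1, map_smul]

variable (l r : A →ₐ[ℂ] S)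

theorem merge_mem_coch {n : ℕ} (a : A) {F : List A → M} (hF : F ∈ coch A M n) :
    merge M (l : A →+* S) (r : A →+* S) a F ∈ coch A M n := by
  cases n with
  | zero => intro b t; simp [hF _ _]
  | succ n =>
    refine ⟨by simp [hF.1], fun b c t => ?_, fun c b t => ?_, fun b => ?_⟩
    · simp only [merge_cons, map_add, mul_add, hF.2.1]; module
    · simp only [merge_cons, mul_smul_comm, hF.2.2.1, RingHom.coe_coe, map_smul, smul_assoc,
        smul_sub]
    · exact (coch A M n).sub_mem (smul_mem_coch (l b) (hF.2.2.2 a)) (hF.2.2.2 (a * b))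

theorem merge_add {n : ℕ} (a b : A) {F : List A → M} (hF : F ∈ coch A M n) :
    merge M (l : A →+* S) (r : A →+* S) (a + b) F =
      merge M (l : A →+* S) (r : A →+* S) a F + merge M (l : A →+* S) (r : A →+* S) b F := by
  funext t
  cases t with
  | nil => simp; module
  | cons c t =>
    simp only [merge_cons, add_mul, coch_add_cons hF, Pi.add_apply]; module

theorem merge_smul {n : ℕ} (c : ℂ) (a : A) {F : List A → M} (hF : F ∈ coch A M n) :
    merge M (l : A →+* S) (r : A →+* S) (c • a) F =
      c • merge M (l : A →+* S) (r : A →+* S) a F := by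
  funext t
  cases t with
  | nil => simp [smul_assoc]
  | cons b t =>
    simp only [merge_cons, smul_mul_assoc, coch_smul_cons hF, Pi.smul_apply, smul_sub,
      smul_comm c]

theorem cobd_mem_coch {n : ℕ} {F : List A → M} (hF : F ∈ coch A M n) :
    cobd M (l : A →+* S) (r : A →+* S) F ∈ coch A M (n + 1) := by
  induction n generalizing F with
  | zero =>
    have h0 : ∀ a, slice M S a F = 0 := fun a => funext fun t => hF a t
    refine ⟨rfl, fun a b t => ?_, fun c a t => ?_, fun a => ?_⟩
    · simp only [cobd_cons, h0, map_zero, merge_add l r a b hF, Pi.add_apply, map_add,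
        Pi.zero_apply]; module
    · simp only [cobd_cons, h0, map_zero, merge_smul l r c a hF, Pi.smul_apply, RingHom.coe_coe,
        map_smul, Pi.zero_apply, smul_assoc, sub_zero, smul_add]
    · change slice M S a (cobd M (l : A →+* S) (r : A →+* S) F) ∈ _
      rw [slice_cobd, h0, map_zero, sub_zero]
      exact Submodule.add_mem _ (smul_mem_coch _ hF) (merge_mem_coch l r a hF)
  | succ n ih =>
    refine ⟨rfl, fun a b t => ?_, fun c a t => ?_, fun a => ?_⟩
    · have : slice M S (a + b) F = slice M S a F + slice M S b F := funext fun t => hF.2.1 a b t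
      simp only [cobd_cons, this, merge_add l r a b hF, Pi.add_apply, map_add]; module
    · have : slice M S (c • a) F = algebraMap ℂ S c • slice M S a F :=
        funext fun t => by simp [hF.2.2.1 c a t]
      simp only [cobd_cons, this, merge_smul l r c a hF, Pi.smul_apply, RingHom.coe_coe,
        map_smul, smul_assoc, smul_sub, smul_add, algebraMap_smul, LinearMap.map_smul_of_tower]
    · change slice M S a (cobd M (l : A →+* S) (r : A →+* S) F) ∈ _
      rw [slice_cobd]
      exact Submodule.add_mem _ (Submodule.sub_mem _ (smul_mem_coch _ hF) (ih (hF.2.2.2 a)))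
        (merge_mem_coch l r a hF)

theorem slice_add {n : ℕ} (a b : A) {F : List A → M} (hF : F ∈ coch A M n) :
    slice M S (a + b) F = slice M S a F + slice M S b F :=
  funext fun t => coch_add_cons hF a b t

theorem slice_smul {n : ℕ} (c : ℂ) (a : A) {F : List A → M} (hF : F ∈ coch A M n) :
    slice M S (c • a) F = algebraMap ℂ S c • slice M S a F :=
  funext fun t => by simp [coch_smul_cons hF c a t]

theorem slice_ins_singleton (p a : A) (F : List A → M) :
    slice M S a (ins M S [p] F) = slice M S a (slice M S p F) - ins M S [p] (slice M S a F) :=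
  funext fun t => ins_singleton_cons p a t F

theorem slice_ins_pair (p q a : A) (F : List A → M) :
    slice M S a (ins M S [p, q] F) =
      slice M S a (ins M S [q] (slice M S p F)) + ins M S [p, q] (slice M S a F) :=
  funext fun t => ins_pair_cons p q a t F

theorem ins_singleton_mem_coch {n : ℕ} (p : A) {F : List A → M} (hF : F ∈ coch A M n) :
    ins M S [p] F ∈ coch A M (n - 1) := by
  induction n generalizing F with
  | zero =>
    intro a t
    have h0 : ∀ a, slice M S a F = 0 := fun a => funext fun t => hF a t
    rw [ins_singleton_cons, h0, map_zero, hF]; simp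
  | succ n ih =>
    cases n with
    | zero =>
      intro a t
      rw [ins_singleton_cons]
      have h0 : slice M S a F ∈ coch A M 0 := hF.2.2.2 a
      have h1 := ins_singleton_cons (S := S) p a t F
      have h2 : ins M S [p] (slice M S a F) = 0 := by
        funext t
        cases t with
        | nil => simpa using h0 p []
        | cons b t => exact ih h0 b t
      rw [h2, show F (p :: a :: t) = 0 from hF.2.2.2 p a t]; simp
    | succ n =>
      refine ⟨by simpa using (hF.2.2.2 p).1, fun a b t => ?_, fun c a t => ?_, fun a => ?_⟩
      · rw [ins_singleton_cons, ins_singleton_cons, ins_singleton_cons, slice_add a b hF,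
          show F (p :: (a + b) :: t) = _ from (hF.2.2.2 p).2.1 a b t, map_add, Pi.add_apply]; module
      · rw [ins_singleton_cons, ins_singleton_cons, slice_smul c a hF,
          show F (p :: (c • a) :: t) = _ from (hF.2.2.2 p).2.2.1 c a t, map_smul,
          Pi.smul_apply, algebraMap_smul, smul_sub]
      · change slice M S a (ins M S [p] F) ∈ coch A M n
        rw [slice_ins_singleton]
        exact Submodule.sub_mem _ ((hF.2.2.2 p).2.2.2 a) (ih (hF.2.2.2 a))

theorem ins_eq_zero_of_length_lt {n : ℕ} {w : List A} (hw : n < w.length) {F : List A → M}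
    (hF : F ∈ coch A M n) : ins M S w F = 0 := by
  have key : ∀ (u v : List A) (n : ℕ) (F : List A → M), n < u.length + v.length →
      F ∈ coch A M n → shuffle M S u v F = 0 := by
    intro u v
    induction u generalizing v with
    | nil =>
      intro n F hn hF
      rw [shuffle_nil_left]
      exact coch_apply_of_length_ne hF (by simpa using hn.ne')
    | cons a u ihu =>
      induction v with
      | nil =>
        intro n F hn hF
        rw [shuffle_nil_right]
        exact coch_apply_of_length_ne hF (by simpa using hn.ne')
      | cons b v ihv =>
        intro n F hn hF
        simp only [List.length_cons] at hn
        rw [shuffle_cons_cons, ihu _ (n - 1) _ (by simp; omega) (slice_mem_coch hF a),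
          ihv (n - 1) _ (by simp; omega) (slice_mem_coch hF b)]
        simp
  funext v
  exact key w v n F (by omega) hF

theorem ins_pair_mem_coch {n : ℕ} (p q : A) {F : List A → M} (hF : F ∈ coch A M n) :
    ins M S [p, q] F ∈ coch A M (n - 2) := by
  induction n generalizing F with
  | zero => rw [ins_eq_zero_of_length_lt (by simp) hF]; exact Submodule.zero_mem _
  | succ n ih =>
    match n with
    | 0 => rw [ins_eq_zero_of_length_lt (by simp) hF]; exact Submodule.zero_mem _
    | 1 =>
      intro a t
      have h0 : slice M S a F ∈ coch A M 1 := hF.2.2.2 a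
      rw [ins_pair_cons, ins_eq_zero_of_length_lt (w := [p, q]) (by simp) h0]
      have := ins_singleton_mem_coch (S := S) q (hF.2.2.2 p) a t
      rw [Pi.zero_apply, add_zero]
      exact this
    | n + 2 =>
      have h1 := ins_singleton_mem_coch (S := S) q (hF.2.2.2 p)
      refine ⟨by simpa using ((hF.2.2.2 p).2.2.2 q).1, fun a b t => ?_, fun c a t => ?_,
        fun a => ?_⟩
      · rw [ins_pair_cons, ins_pair_cons, ins_pair_cons, slice_add a b hF, map_add, Pi.add_apply]
        have := h1.2.1 a b t
        change ins M S [q] (slice M S p F) _ = ins M S [q] (slice M S p F) _ +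
          ins M S [q] (slice M S p F) _ at this
        rw [this]; abel
      · rw [ins_pair_cons, ins_pair_cons, slice_smul c a hF, map_smul, Pi.smul_apply,
          algebraMap_smul, smul_add]
        congr 1
        exact h1.2.2.1 c a t
      · change slice M S a (ins M S [p, q] F) ∈ coch A M n
        rw [slice_ins_pair]
        exact Submodule.add_mem _ (h1.2.2.2 a) (ih (hF.2.2.2 a))

theorem ins_singleton_add {n : ℕ} (p q : A) {F : List A → M} (hF : F ∈ coch A M n) :
    ins M S [p + q] F = ins M S [p] F + ins M S [q] F := by
  funext t
  induction t generalizing n F with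
  | nil => simp [coch_add_cons hF]
  | cons a t ih =>
    simp only [Pi.add_apply, ins_singleton_cons, coch_add_cons hF,
      ih (slice_mem_coch (S := S) hF a)]
    abel

theorem ins_singleton_smul {n : ℕ} (c : ℂ) (p : A) {F : List A → M} (hF : F ∈ coch A M n) :
    ins M S [c • p] F = c • ins M S [p] F := by
  funext t
  induction t generalizing n F with
  | nil => simp [coch_smul_cons hF]
  | cons a t ih =>
    simp only [Pi.smul_apply, ins_singleton_cons, coch_smul_cons hF,
      ih (slice_mem_coch (S := S) hF a), smul_sub]

theorem shuffle_comp (g : M →ₗ[S] N) (u v : List A) (F : List A → M) :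
    shuffle N S u v (fun t => g (F t)) = g (shuffle M S u v F) := by
  induction u generalizing v F with
  | nil => simp
  | cons a u ihu =>
    induction v generalizing F with
    | nil => simp
    | cons b v ihv =>
      rw [shuffle_cons_cons, shuffle_cons_cons, map_add, map_smul, ← ihu, ← ihv]; rfl

theorem ins_comp (g : M →ₗ[S] N) (w : List A) (F : List A → M) :
    ins N S w (fun t => g (F t)) = fun t => g (ins M S w F t) :=
  funext fun v => shuffle_comp g w v F

theorem cobd_comp (l r : A →+* S) (g : M →ₗ[S] N) (F : List A → M) :
    cobd N l r (fun t => g (F t)) = fun t => g (cobd M l r F t) := by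
  funext t
  induction t generalizing F with
  | nil => simp
  | cons a t ih =>
    have := ih (slice M S a F)
    rw [cobd_cons, cobd_cons, map_add, map_sub, map_smul, ← this]
    congr 1
    cases t <;> simp

end Multilinear

end WordCochain

/-! ### The enveloping algebra and the contraction attached to a relation. -/

namespace WordCochain

open TensorProduct

section Enveloping

variable {A : Type*} [CommRing A] [Algebra ℂ A]

variable (A) in
/-- The enveloping algebra of a commutative algebra. -/
def Env : Type _ := A ⊗[ℂ] A

instance : CommRing (Env A) := inferInstanceAs (CommRing (A ⊗[ℂ] A))

instance : Algebra ℂ (Env A) := inferInstanceAs (Algebra ℂ (A ⊗[ℂ] A))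

variable (A) in
/-- The left action of `A`, as a homomorphism to the enveloping algebra. -/
def lft : A →ₐ[ℂ] Env A := Algebra.TensorProduct.includeLeft (R := ℂ) (S := ℂ) (A := A) (B := A)

variable (A) in
/-- The right action of `A`, as a homomorphism to the enveloping algebra. -/
def rgt : A →ₐ[ℂ] Env A := Algebra.TensorProduct.includeRight (R := ℂ) (A := A) (B := A)

theorem lft_mul_rgt (a b : A) : lft A a * rgt A b = (a ⊗ₜ[ℂ] b : A ⊗[ℂ] A) := by
  change (a ⊗ₜ[ℂ] (1 : A)) * ((1 : A) ⊗ₜ[ℂ] b) = _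
  rw [Algebra.TensorProduct.tmul_mul_tmul, mul_one, one_mul]

variable {M N : Type*} [AddCommGroup M] [Module ℂ M] [Module (Env A) M]
  [IsScalarTower ℂ (Env A) M]
  [AddCommGroup N] [Module ℂ N] [Module (Env A) N] [IsScalarTower ℂ (Env A) N]

variable (M) in
/-- The Hochschild coboundary with coefficients in a bimodule. -/
abbrev hd : (List A → M) →ₗ[Env A] (List A → M) :=
  cobd M (lft A : A →+* Env A) (rgt A : A →+* Env A)

/-- The difference of the left and the right action of an element. -/
def diff (x : A) : Env A := lft A x - rgt A x

/-- The tensor presented by a finite set of pairs. -/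
def presented (T : Finset (A × A)) : Env A := ∑ p ∈ T, lft A p.1 * rgt A p.2

/-- The tensor presented by a finite set of pairs, with the factors exchanged. -/
def presentedSwap (T : Finset (A × A)) : Env A := ∑ p ∈ T, lft A p.2 * rgt A p.1

/-- For a multilinear cochain, the linear extension of `a ⊗ b ↦ φ b • ins a F`. -/
def insTensor (φ : A →ₐ[ℂ] Env A) {n : ℕ} {F : List A → M} (hF : F ∈ coch A M n) :
    Env A →ₗ[ℂ] (List A → M) :=
  TensorProduct.lift (LinearMap.mk₂ ℂ (fun a b => φ b • ins M (Env A) [a] F)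
    (fun a a' b => by rw [ins_singleton_add a a' hF, smul_add])
    (fun c a b => by rw [ins_singleton_smul c a hF, smul_comm])
    (fun a b b' => by rw [map_add, add_smul])
    (fun c a b => by rw [map_smul, smul_assoc]))

theorem insTensor_mul (φ : A →ₐ[ℂ] Env A) {n : ℕ} {F : List A → M} (hF : F ∈ coch A M n)
    (a b : A) : insTensor φ hF (lft A a * rgt A b) = φ b • ins M (Env A) [a] F := by
  rw [lft_mul_rgt]; rfl

variable (M) in
/-- Contraction with the bar chain `∑ a[p|x]b`-type lift of a presented tensor. -/
def pairIns (x : A) (T : Finset (A × A)) : (List A → M) →ₗ[Env A] (List A → M) :=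
  ∑ p ∈ T, (rgt A p.2 • ins M (Env A) [p.1, x] + lft A p.2 • ins M (Env A) [x, p.1])

theorem pairIns_apply (x : A) (T : Finset (A × A)) (F : List A → M) :
    pairIns M x T F = ∑ p ∈ T, (rgt A p.2 • ins M (Env A) [p.1, x] F +
      lft A p.2 • ins M (Env A) [x, p.1] F) := by
  simp [pairIns]

/-- In the boundary of [p, x] weighted by q, the terms -[px]q + [p]xq assemble into the tensor p ⊗ q
multiplied by x ⊗ 1 - 1 ⊗ x; the mirrored pair [x, p] gives the same tensor with the other action.
What remains is a multiple of [x]. Keeping the product inside `insTensor` makes it possible to use a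
relation between tensors that are known only through presentations. -/
theorem pairIns_cobd (x : A) (T : Finset (A × A)) {n : ℕ} {F : List A → M}
    (hF : F ∈ coch A M n) :
    pairIns M x T (hd M F) = hd M (pairIns M x T F) +
      (presented T + presentedSwap T) • ins M (Env A) [x] F
      - insTensor (rgt A) hF (presented T * diff x)
      - insTensor (lft A) hF (presented T * diff x) := by
  have h1 : ∀ p : A × A, lft A p.1 * rgt A p.2 * diff x =
      lft A (p.1 * x) * rgt A p.2 - lft A p.1 * rgt A (p.2 * x) := by
    intro p
    rw [diff, map_mul, map_mul]; ring
  simp only [pairIns_apply, presented, presentedSwap, Finset.sum_mul, map_sum, Finset.sum_smul,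
    add_smul]
  rw [← Finset.sum_add_distrib, ← Finset.sum_add_distrib, ← Finset.sum_sub_distrib,
    ← Finset.sum_sub_distrib]
  refine Finset.sum_congr rfl fun p _ => ?_
  rw [h1, map_sub, map_sub, insTensor_mul, insTensor_mul, insTensor_mul, insTensor_mul,
    ins_pair_cobd, ins_pair_cobd, map_mul, map_mul, map_add, map_smul, map_smul,
    mul_comm x p.1]
  simp only [RingHom.coe_coe]
  module

/-- Words of length two have even degree, so no sign appears. -/
theorem ins_pairIns_comm (w : A) (x : A) (T : Finset (A × A)) (F : List A → M) :
    ins M (Env A) [w] (pairIns M x T F) = pairIns M x T (ins M (Env A) [w] F) := by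
  simp only [pairIns_apply, map_sum, map_add, map_smul]
  refine Finset.sum_congr rfl fun p _ => ?_
  rw [ins_comm, ins_comm [w] [x, p.1]]
  simp

theorem pairIns_mem_coch (x : A) (T : Finset (A × A)) {n : ℕ} {F : List A → M}
    (hF : F ∈ coch A M n) : pairIns M x T F ∈ coch A M (n - 2) := by
  rw [pairIns_apply]
  exact Submodule.sum_mem _ fun p _ => Submodule.add_mem _
    (smul_mem_coch _ (ins_pair_mem_coch _ _ hF)) (smul_mem_coch _ (ins_pair_mem_coch _ _ hF))

theorem pairIns_comp (g : M →ₗ[Env A] N) (x : A) (T : Finset (A × A)) (F : List A → M) :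
    pairIns N x T (fun t => g (F t)) = fun t => g (pairIns M x T F t) := by
  funext t
  simp [pairIns_apply, ins_comp, Finset.sum_apply]

variable (x y : A) (T U : Finset (A × A))

variable (M) in
/-- The contraction of weight one and degree two attached to presentations of the two
difference quotients of a relation. -/
def omega : (List A → M) →ₗ[Env A] (List A → M) :=
  algebraMap ℂ (Env A) (1 / 2) • (pairIns M x T + pairIns M y U)

/-- The symmetrized tensor presented by a finite set of pairs. -/
def symPresented (T : Finset (A × A)) : Env A :=
  algebraMap ℂ (Env A) (1 / 2) * (presented T + presentedSwap T)

theorem omega_apply (F : List A → M) : omega M x y T U F =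
    algebraMap ℂ (Env A) (1 / 2) • (pairIns M x T F + pairIns M y U F) := rfl

/-- The relation cancels the `insTensor` terms for x against those for y. Hence ω bounds the
combination of [x] and [y] whose coefficients are the symmetrized difference quotients. -/
theorem omega_cobd (h : presented T * diff x + presented U * diff y = 0) {n : ℕ}
    {F : List A → M} (hF : F ∈ coch A M n) :
    omega M x y T U (hd M F) = hd M (omega M x y T U F) +
      (symPresented T • ins M (Env A) [x] F + symPresented U • ins M (Env A) [y] F) := by
  have h1 : insTensor (rgt A) hF (presented T * diff x) =
      -insTensor (rgt A) hF (presented U * diff y) := by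
    rw [← add_eq_zero_iff_eq_neg, ← map_add, h, map_zero]
  have h2 : insTensor (lft A) hF (presented T * diff x) =
      -insTensor (lft A) hF (presented U * diff y) := by
    rw [← add_eq_zero_iff_eq_neg, ← map_add, h, map_zero]
  rw [omega_apply, pairIns_cobd x T hF, pairIns_cobd y U hF, h1, h2, omega_apply, map_smul,
    map_add, symPresented, symPresented]
  module

theorem ins_omega_comm (w : A) (F : List A → M) :
    ins M (Env A) [w] (omega M x y T U F) = omega M x y T U (ins M (Env A) [w] F) := by
  rw [omega_apply, map_smul, map_add, ins_pairIns_comm, ins_pairIns_comm, omega_apply]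

theorem omega_mem_coch {n : ℕ} {F : List A → M} (hF : F ∈ coch A M n) :
    omega M x y T U F ∈ coch A M (n - 2) :=
  smul_mem_coch _ (Submodule.add_mem _ (pairIns_mem_coch _ _ hF) (pairIns_mem_coch _ _ hF))

theorem omega_comp (g : M →ₗ[Env A] N) (F : List A → M) :
    omega N x y T U (fun t => g (F t)) = fun t => g (omega M x y T U F t) := by
  rw [omega_apply, pairIns_comp, pairIns_comp]
  funext t
  simp [omega_apply]

variable (M) in
/-- The divided powers of `omega`. -/
def dpow (k : ℕ) : (List A → M) →ₗ[Env A] (List A → M) :=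
  algebraMap ℂ (Env A) ((k.factorial : ℂ)⁻¹) • omega M x y T U ^ k

theorem dpow_apply (k : ℕ) (F : List A → M) : dpow M x y T U k F =
    algebraMap ℂ (Env A) ((k.factorial : ℂ)⁻¹) • (omega M x y T U ^ k) F := rfl

@[simp] theorem dpow_zero (F : List A → M) : dpow M x y T U 0 F = F := by
  rw [dpow_apply, Nat.factorial_zero, Nat.cast_one, inv_one, map_one, one_smul, pow_zero]; rfl

theorem omega_pow_comp (g : M →ₗ[Env A] N) (k : ℕ) (F : List A → M) :
    (omega N x y T U ^ k) (fun t => g (F t)) = fun t => g ((omega M x y T U ^ k) F t) := by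
  induction k generalizing F with
  | zero => simp
  | succ k ih => rw [pow_succ, pow_succ, Module.End.mul_apply, omega_comp, ih]; rfl

theorem dpow_comp (g : M →ₗ[Env A] N) (k : ℕ) (F : List A → M) :
    dpow N x y T U k (fun t => g (F t)) = fun t => g (dpow M x y T U k F t) := by
  rw [dpow_apply, omega_pow_comp]
  funext t
  simp [dpow_apply]

theorem ins_omega_pow_comm (w : A) (k : ℕ) (F : List A → M) :
    ins M (Env A) [w] ((omega M x y T U ^ k) F) =
      (omega M x y T U ^ k) (ins M (Env A) [w] F) := by
  induction k generalizing F with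
  | zero => simp
  | succ k ih =>
    rw [pow_succ, Module.End.mul_apply, ih, ins_omega_comm]; rfl

theorem ins_dpow_comm (w : A) (k : ℕ) (F : List A → M) :
    ins M (Env A) [w] (dpow M x y T U k F) =
      dpow M x y T U k (ins M (Env A) [w] F) := by
  rw [dpow_apply, map_smul, ins_omega_pow_comm]; rfl

theorem omega_pow_cobd (h : presented T * diff x + presented U * diff y = 0) (k : ℕ) {n : ℕ}
    {F : List A → M} (hF : F ∈ coch A M n) :
    (omega M x y T U ^ (k + 1)) (hd M F) = hd M ((omega M x y T U ^ (k + 1)) F) +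
      ((k + 1 : ℕ) : Env A) • (omega M x y T U ^ k) (symPresented T • ins M (Env A) [x] F +
        symPresented U • ins M (Env A) [y] F) := by
  induction k generalizing n F with
  | zero => simpa using omega_cobd x y T U h hF
  | succ k ih =>
    have ih' := ih (omega_mem_coch x y T U hF)
    rw [pow_succ, Module.End.mul_apply, omega_cobd x y T U h hF, map_add, ih',
      Module.End.mul_apply]
    have : (omega M x y T U ^ k) (symPresented T • ins M (Env A) [x] (omega M x y T U F) +
        symPresented U • ins M (Env A) [y] (omega M x y T U F)) =
        (omega M x y T U ^ (k + 1)) (symPresented T • ins M (Env A) [x] F +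
        symPresented U • ins M (Env A) [y] F) := by
      rw [ins_omega_comm, ins_omega_comm, ← (omega M x y T U).map_smul,
        ← (omega M x y T U).map_smul, ← map_add, pow_succ]; rfl
    rw [this]
    push_cast
    module

/-- The commutator of the coboundary with ω commutes with ω, so a power behaves as under a
derivation; dividing by the factorial removes the integer factor, as for Tate's divided power
variables. -/
theorem dpow_cobd (h : presented T * diff x + presented U * diff y = 0) (k : ℕ) {n : ℕ}
    {F : List A → M} (hF : F ∈ coch A M n) :
    dpow M x y T U (k + 1) (hd M F) = hd M (dpow M x y T U (k + 1) F) +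
      dpow M x y T U k (symPresented T • ins M (Env A) [x] F +
        symPresented U • ins M (Env A) [y] F) := by
  have hk : algebraMap ℂ (Env A) (((k + 1).factorial : ℂ)⁻¹) * ((k + 1 : ℕ) : Env A) =
      algebraMap ℂ (Env A) ((k.factorial : ℂ)⁻¹) := by
    rw [← map_natCast (algebraMap ℂ (Env A)), ← map_mul]
    congr 1
    rw [Nat.factorial_succ]
    have h1 : ((k + 1 : ℕ) : ℂ) ≠ 0 := by exact_mod_cast Nat.succ_ne_zero k
    have h2 : (k.factorial : ℂ) ≠ 0 := by exact_mod_cast Nat.factorial_ne_zero k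
    push_cast at h1 ⊢
    field_simp
  rw [dpow_apply, omega_pow_cobd x y T U h k hF, smul_add, smul_smul, hk, dpow_apply, map_smul,
    dpow_apply]

/-! ### The comparison map -/

variable (M) in
/-- The components of the comparison map on the small complex. -/
def compA (k : ℕ) : (List A → M) →ₗ[Env A] M :=
  LinearMap.proj [] ∘ₗ dpow M x y T U k

variable (M) in
/-- See `compA`. -/
def compX (k : ℕ) : (List A → M) →ₗ[Env A] M :=
  LinearMap.proj [] ∘ₗ ins M (Env A) [x] ∘ₗ dpow M x y T U k

variable (M) in
/-- See `compA`. -/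
def compY (k : ℕ) : (List A → M) →ₗ[Env A] M :=
  LinearMap.proj [] ∘ₗ ins M (Env A) [y] ∘ₗ dpow M x y T U k

variable (M) in
/-- See `compA`. -/
def compB (k : ℕ) : (List A → M) →ₗ[Env A] M :=
  LinearMap.proj [] ∘ₗ ins M (Env A) [y] ∘ₗ ins M (Env A) [x] ∘ₗ dpow M x y T U k

theorem compA_apply (k : ℕ) (F : List A → M) :
    compA M x y T U k F = dpow M x y T U k F [] := rfl
theorem compX_apply (k : ℕ) (F : List A → M) :
    compX M x y T U k F = ins M (Env A) [x] (dpow M x y T U k F) [] := rfl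
theorem compY_apply (k : ℕ) (F : List A → M) :
    compY M x y T U k F = ins M (Env A) [y] (dpow M x y T U k F) [] := rfl
theorem compB_apply (k : ℕ) (F : List A → M) : compB M x y T U k F =
    ins M (Env A) [y] (ins M (Env A) [x] (dpow M x y T U k F)) [] := rfl

variable {x y T U}

/-- Evaluating at the empty word kills every coboundary, so this formula and the next three contain
only the commutators of the coboundary with [x], [y] and ω. They are the differentials of the small
complex. -/
theorem compA_cobd (h : presented T * diff x + presented U * diff y = 0)
    (k : ℕ) {n : ℕ} {F : List A → M} (hF : F ∈ coch A M n) :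
    compA M x y T U (k + 1) (hd M F) =
      symPresented T • compX M x y T U k F + symPresented U • compY M x y T U k F := by
  rw [compA_apply, dpow_cobd x y T U h k hF, Pi.add_apply, cobd_nil, zero_add, map_add, map_smul,
    map_smul, ← ins_dpow_comm, ← ins_dpow_comm]
  rfl

theorem compX_cobd (h : presented T * diff x + presented U * diff y = 0)
    (k : ℕ) {n : ℕ} {F : List A → M} (hF : F ∈ coch A M n) :
    compX M x y T U (k + 1) (hd M F) =
      diff x • compA M x y T U (k + 1) F - symPresented U • compB M x y T U k F := by
  rw [compX_apply, dpow_cobd x y T U h k hF, map_add, ins_singleton_cobd]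
  simp only [map_add, map_smul, ← ins_dpow_comm, ins_singleton_self]
  rw [ins_singleton_anticomm x y]
  simp only [smul_zero, Pi.add_apply, Pi.sub_apply, Pi.smul_apply, Pi.neg_apply,
    cobd_nil, Pi.zero_apply, compA_apply, compB_apply, diff, RingHom.coe_coe]
  module

theorem compY_cobd (h : presented T * diff x + presented U * diff y = 0)
    (k : ℕ) {n : ℕ} {F : List A → M} (hF : F ∈ coch A M n) :
    compY M x y T U (k + 1) (hd M F) =
      diff y • compA M x y T U (k + 1) F + symPresented T • compB M x y T U k F := by
  rw [compY_apply, dpow_cobd x y T U h k hF, map_add, ins_singleton_cobd]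
  simp only [map_add, map_smul, ← ins_dpow_comm, ins_singleton_self]
  simp only [smul_zero, Pi.add_apply, Pi.sub_apply, Pi.smul_apply,
    cobd_nil, Pi.zero_apply, compA_apply, compB_apply, diff, RingHom.coe_coe]
  module

theorem compB_cobd (h : presented T * diff x + presented U * diff y = 0)
    (k : ℕ) {n : ℕ} {F : List A → M} (hF : F ∈ coch A M n) :
    compB M x y T U k (hd M F) =
      diff x • compY M x y T U k F - diff y • compX M x y T U k F := by
  have key : ∀ G : List A → M, ins M (Env A) [y] (ins M (Env A) [x] (hd M G)) [] =
      diff x • ins M (Env A) [y] G [] - diff y • ins M (Env A) [x] G [] := by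
    intro G
    rw [ins_singleton_cobd, map_sub, ins_singleton_cobd, map_smul]
    simp only [Pi.sub_apply, Pi.smul_apply, cobd_nil, diff, RingHom.coe_coe]
    module
  cases k with
  | zero => simp only [compB_apply, compX_apply, compY_apply, dpow_zero, key]
  | succ k =>
    rw [compB_apply, dpow_cobd x y T U h k hF, map_add, map_add, Pi.add_apply, key]
    simp only [map_add, map_smul, ← ins_dpow_comm, ins_singleton_self]
    rw [ins_singleton_anticomm x y, map_neg, ins_singleton_self]
    simp [compX_apply, compY_apply]

end Enveloping

end WordCochain

/-! ### Coinduced bimodules have no Hochschild cohomology in positive degrees. -/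

namespace WordCochain

open TensorProduct

section Coinduced

variable {A : Type*} [CommRing A] [Algebra ℂ A] {V : Type*} [AddCommGroup V] [Module ℂ V]

variable (A V) in
/-- The bimodule coinduced from a vector space. -/
def Coind : Type _ := Env A →ₗ[ℂ] V

instance : AddCommGroup (Coind A V) := inferInstanceAs (AddCommGroup (Env A →ₗ[ℂ] V))

instance : Module ℂ (Coind A V) := inferInstanceAs (Module ℂ (Env A →ₗ[ℂ] V))

/-- Evaluation of an element of the coinduced bimodule. -/
def evalAt (z : Env A) : Coind A V →ₗ[ℂ] V where
  toFun φ := (id φ : Env A →ₗ[ℂ] V) z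
  map_add' _ _ := rfl
  map_smul' _ _ := rfl

instance : Module (Env A) (Coind A V) where
  smul s φ := (id φ : Env A →ₗ[ℂ] V) ∘ₗ LinearMap.mulLeft ℂ s
  one_smul φ := LinearMap.ext fun z => congr_arg φ.toFun (one_mul z)
  mul_smul s s' φ := LinearMap.ext fun z => congr_arg φ.toFun (by
    change s * s' * z = s' * (s * z); ring)
  smul_zero s := rfl
  smul_add s φ ψ := rfl
  add_smul s s' φ := LinearMap.ext fun z => by
    change φ.toFun ((s + s') * z) = φ.toFun (s * z) + φ.toFun (s' * z)
    rw [add_mul]; exact LinearMap.map_add φ _ _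
  zero_smul φ := LinearMap.ext fun z => by
    change φ.toFun (0 * z) = 0
    rw [zero_mul]; exact LinearMap.map_zero φ

theorem evalAt_smul (s z : Env A) (φ : Coind A V) : evalAt z (s • φ) = evalAt (s * z) φ := rfl

theorem evalAt_add_left (z z' : Env A) (φ : Coind A V) :
    evalAt (z + z') φ = evalAt z φ + evalAt z' φ := LinearMap.map_add φ _ _

theorem evalAt_smul_left (c : ℂ) (z : Env A) (φ : Coind A V) :
    evalAt (c • z) φ = c • evalAt z φ := LinearMap.map_smul φ _ _

theorem coind_ext {φ ψ : Coind A V} (h : ∀ z : Env A, evalAt z φ = evalAt z ψ) : φ = ψ :=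
  LinearMap.ext h

theorem coind_ext_mul {φ ψ : Coind A V}
    (h : ∀ p q : A, evalAt (lft A p * rgt A q) φ = evalAt (lft A p * rgt A q) ψ) : φ = ψ := by
  refine TensorProduct.ext' (M := A) (N := A) (P₂ := V) fun p q => ?_
  have := h p q
  rw [lft_mul_rgt] at this
  exact this

instance : IsScalarTower ℂ (Env A) (Coind A V) where
  smul_assoc c s φ := coind_ext fun z => by
    rw [evalAt_smul, smul_mul_assoc, evalAt_smul_left, map_smul, evalAt_smul]

theorem mem_coch_coind {n : ℕ} {G : List A → Coind A V}
    (h : ∀ p q : A, (fun t => evalAt (lft A p * rgt A q) (G t)) ∈ coch A V n) :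
    G ∈ coch A (Coind A V) n := by
  induction n generalizing G with
  | zero =>
    intro a t
    refine coind_ext_mul fun p q => ?_
    rw [map_zero]
    exact h p q a t
  | succ n ih =>
    refine ⟨coind_ext_mul fun p q => ?_, fun a b t => coind_ext_mul fun p q => ?_,
      fun c a t => coind_ext_mul fun p q => ?_, fun a => ih fun p q => (h p q).2.2.2 a⟩
    · rw [map_zero]; exact (h p q).1
    · rw [map_add]; exact (h p q).2.1 a b t
    · rw [map_smul]; exact (h p q).2.2.1 c a t

/-- For a cochain `G` whose left tensor argument has been turned into the parameter of a family `H`,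
this compares its coboundary with that of the family; the corrections are the two faces touching the
new letter. -/
theorem hd_coind_eq {G : List A → Coind A V} {H : A → List A → Coind A V}
    (h : ∀ t p q, evalAt (lft A p * rgt A q) (G t) = evalAt (rgt A q) (H p t))
    (a : A) (t : List A) (p q : A) :
    evalAt (lft A p * rgt A q) (hd (Coind A V) G (a :: t)) =
      evalAt (rgt A q) (hd (Coind A V) (H p) (a :: t)) + evalAt (rgt A q) (H (p * a) t) -
        evalAt (lft A a * rgt A q) (H p t) := by
  have h1 : ∀ (b : A) (t : List A), evalAt (lft A b * (lft A p * rgt A q)) (G t) =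
      evalAt (rgt A q) (H (p * b) t) := by
    intro b t
    rw [← h, map_mul]; congr 2; ring
  have h2 : ∀ (b : A) (t : List A), evalAt (rgt A b * (lft A p * rgt A q)) (G t) =
      evalAt (rgt A b * rgt A q) (H p t) := by
    intro b t
    rw [← map_mul, ← h, map_mul]; congr 2; ring
  induction t generalizing G H a with
  | nil =>
    simp only [cobd_cons, cobd_nil, merge_nil, map_add, map_sub, map_neg, map_zero, evalAt_smul,
      RingHom.coe_coe, h1, h2]
    abel
  | cons b t ih =>
    have ih' := ih (G := slice (Coind A V) (Env A) a G)
      (H := fun p => slice (Coind A V) (Env A) a (H p)) (fun t p q => h _ p q) b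
      (fun b t => h1 b _) (fun b t => h2 b _)
    rw [cobd_cons, cobd_cons _ _ a]
    simp only [merge_cons, map_add, map_sub, evalAt_smul, RingHom.coe_coe, h1, h, ih']
    simp only [slice_apply]
    abel

/-- The contracting homotopy of the bar resolution: G(t)(p ⊗ q) = F(p t)(1 ⊗ q). The cocycle
condition on the word p a t, evaluated at 1 ⊗ q, says that the coboundary of G at a t takes the
value F(a t)(p ⊗ q) at p ⊗ q. -/
theorem exists_hd_eq_coind {n : ℕ} {F : List A → Coind A V} (hF : F ∈ coch A (Coind A V) (n + 1))
    (h0 : hd (Coind A V) F = 0) : ∃ G ∈ coch A (Coind A V) n, hd (Coind A V) G = F := by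
  let G : List A → Coind A V := fun t => TensorProduct.lift (LinearMap.mk₂ ℂ
    (fun p q => evalAt (rgt A q) (F (p :: t)))
    (fun p p' q => by rw [coch_add_cons hF, map_add])
    (fun c p q => by rw [coch_smul_cons hF, map_smul])
    (fun p q q' => by rw [map_add, evalAt_add_left])
    (fun c p q => by rw [map_smul, evalAt_smul_left]))
  have hG : ∀ t p q, evalAt (lft A p * rgt A q) (G t) =
      evalAt (rgt A q) (slice (Coind A V) (Env A) p F t) := by
    intro t p q
    rw [lft_mul_rgt]; rfl
  refine ⟨G, mem_coch_coind fun p q => ?_, funext fun t => coind_ext_mul fun p q => ?_⟩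
  · simp only [hG]
    exact comp_mem_coch _ (slice_mem_coch hF p)
  · cases t with
    | nil => rw [hF.1]; rfl
    | cons a t =>
      rw [hd_coind_eq (H := fun p => slice (Coind A V) (Env A) p F) hG]
      have h1 := congr_arg (evalAt (V := V) (rgt A q)) (congr_fun h0 (p :: a :: t))
      rw [cobd_cons] at h1
      simp only [merge_cons, map_add, map_sub, evalAt_smul, RingHom.coe_coe, Pi.zero_apply,
        map_zero] at h1
      simp only [slice_apply] at h1 ⊢
      rw [← sub_eq_zero, ← neg_eq_zero, ← h1]
      abel

end Coinduced

end WordCochain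

/-! ### The small complex of a matrix factorization and its exactness. -/

namespace WordCochain

/-- Elements of a coinduced bimodule are ℂ-linear maps on the enveloping algebra, so exactness over
that algebra dualizes by plain linear algebra over a field. -/
theorem exists_comp_eq_of_ker_le {K V W X : Type*} [Field K] [AddCommGroup V] [Module K V]
    [AddCommGroup W] [Module K W] [AddCommGroup X] [Module K X] (g : V →ₗ[K] W) (f : V →ₗ[K] X)
    (h : LinearMap.ker g ≤ LinearMap.ker f) : ∃ e : W →ₗ[K] X, e ∘ₗ g = f := by
  obtain ⟨e, he⟩ := LinearMap.exists_extend
    ((LinearMap.ker g).liftQ f h ∘ₗ g.quotKerEquivRange.symm.toLinearMap)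
  refine ⟨e, LinearMap.ext fun v => ?_⟩
  have := LinearMap.congr_fun he ⟨g v, LinearMap.mem_range_self g v⟩
  simp only [LinearMap.comp_apply, Submodule.subtype_apply, LinearEquiv.coe_coe] at this
  rw [LinearMap.comp_apply, this]
  have h2 : g.quotKerEquivRange.symm ⟨g v, LinearMap.mem_range_self g v⟩ =
      (LinearMap.ker g).mkQ v := by
    rw [LinearEquiv.symm_apply_eq]; rfl
  rw [h2]; rfl

section SmallComplex

variable {S : Type*} [CommRing S]

/-- The differential of the small complex, of period two from degree one on, given by a matrix
factorization with entries `u`, `v`, `d`, `e`. -/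
def smallD (M : Type*) [AddCommGroup M] [Module S M] (u v d e : S) (n : ℕ) :
    M × M →ₗ[S] M × M :=
  if n = 0 then (u • LinearMap.fst S M M).prod (v • LinearMap.fst S M M)
  else if n % 2 = 1 then (d • LinearMap.fst S M M + e • LinearMap.snd S M M).prod
    (u • LinearMap.snd S M M - v • LinearMap.fst S M M)
  else (u • LinearMap.fst S M M - e • LinearMap.snd S M M).prod
    (v • LinearMap.fst S M M + d • LinearMap.snd S M M)

variable {M N : Type*} [AddCommGroup M] [Module S M] [AddCommGroup N] [Module S N]
variable (u v d e : S)

/-- Only the first coordinate is meaningful in degree zero; the second is padding that keeps the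
type uniform. -/
theorem smallD_zero (c : M × M) : smallD M u v d e 0 c = (u • c.1, v • c.1) := by
  simp [smallD]

theorem smallD_odd {n : ℕ} (hn : n % 2 = 1) (c : M × M) :
    smallD M u v d e n c = (d • c.1 + e • c.2, u • c.2 - v • c.1) := by
  have : n ≠ 0 := by omega
  simp [smallD, hn, this]

theorem smallD_even {n : ℕ} (h0 : n ≠ 0) (hn : n % 2 = 0) (c : M × M) :
    smallD M u v d e n c = (u • c.1 - e • c.2, v • c.1 + d • c.2) := by
  simp [smallD, hn, h0]

theorem smallD_map (g : M →ₗ[S] N) (n : ℕ) (c : M × M) :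
    smallD N u v d e n (g c.1, g c.2) =
      (g (smallD M u v d e n c).1, g (smallD M u v d e n c).2) := by
  rcases eq_or_ne n 0 with rfl | h0
  · simp [smallD_zero]
  · rcases Nat.mod_two_eq_zero_or_one n with hn | hn
    · simp [smallD_even u v d e h0 hn]
    · simp [smallD_odd u v d e hn]

variable {u v d e}

/-- The two alternating matrices multiply, in either order, to d u + e v times the identity. -/
theorem smallD_smallD (h : d * u + e * v = 0) (n : ℕ) (c : M × M) :
    smallD M u v d e (n + 1) (smallD M u v d e n c) = 0 := by
  have hm : ∀ m : M, (d * u) • m + (e * v) • m = 0 := fun m => by rw [← add_smul, h, zero_smul]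
  rcases eq_or_ne n 0 with rfl | h0
  · rw [smallD_odd u v d e rfl, smallD_zero]
    refine Prod.ext ?_ ?_
    · simpa [smul_smul] using hm c.1
    · simp only [Prod.snd_zero]; module
  · rcases Nat.mod_two_eq_zero_or_one n with hn | hn
    · rw [smallD_odd u v d e (by omega), smallD_even u v d e h0 hn]
      refine Prod.ext ?_ ?_
      · rw [Prod.fst_zero, ← hm c.1]; module
      · rw [Prod.snd_zero, ← hm c.2]; module
    · rw [smallD_even u v d e (by omega) (by omega), smallD_odd u v d e hn]
      refine Prod.ext ?_ ?_
      · rw [Prod.fst_zero, ← hm c.1]; module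
      · rw [Prod.snd_zero, ← hm c.2]; module

end SmallComplex

section Exactness

variable {A : Type*} [CommRing A] [Algebra ℂ A] {V : Type*} [AddCommGroup V] [Module ℂ V]

/-- A pair in the coinduced bimodule is one linear map on pairs of elements of `Env A`. The cocycle
condition says that it vanishes on the image of one matrix; by exactness that image contains the
kernel of the other one, through which the map therefore factors. -/
theorem exists_smallD_eq_coind {u v d e : Env A}
    (hX : ∀ p q, u * p + v * q = 0 → ∃ s t, p = d * s - v * t ∧ q = e * s + u * t)
    (hM : ∀ p q, d * p - v * q = 0 → e * p + u * q = 0 →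
      ∃ s t, p = u * s + v * t ∧ q = d * t - e * s)
    (n : ℕ) (c : Coind A V × Coind A V) (hc : smallD (Coind A V) u v d e (n + 1) c = 0) :
    ∃ b, smallD (Coind A V) u v d e n b = c := by
  let f : Env A × Env A →ₗ[ℂ] V := LinearMap.coprod (id c.1) (id c.2)
  have hf : ∀ p q, f (p, q) = evalAt p c.1 + evalAt q c.2 := fun p q => rfl
  rcases Nat.mod_two_eq_zero_or_one n with hn | hn
  · rw [smallD_odd _ _ _ _ (by omega), Prod.mk_eq_zero] at hc
    have h1 : ∀ z, evalAt (d * z) c.1 + evalAt (e * z) c.2 = 0 := fun z => by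
      simpa [evalAt_smul] using congr_arg (evalAt z) hc.1
    have h2 : ∀ z, evalAt (u * z) c.2 - evalAt (v * z) c.1 = 0 := fun z => by
      simpa [evalAt_smul] using congr_arg (evalAt z) hc.2
    have key : ∀ p q, u * p + v * q = 0 → f (p, q) = 0 := by
      intro p q hpq
      obtain ⟨s, t, rfl, rfl⟩ := hX p q hpq
      rw [hf, sub_eq_add_neg, evalAt_add_left, evalAt_add_left,
        show -(v * t) = (-1 : ℂ) • (v * t) by simp, evalAt_smul_left, neg_one_smul]
      linear_combination (norm := module) h1 s + h2 t
    rcases eq_or_ne n 0 with rfl | h0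
    · obtain ⟨g, hg⟩ := exists_comp_eq_of_ker_le
        (LinearMap.coprod (LinearMap.mulLeft ℂ u) (LinearMap.mulLeft ℂ v)) f (by
          rintro ⟨p, q⟩ hpq
          exact key p q (by simpa using hpq))
      refine ⟨(id g, 0), ?_⟩
      rw [smallD_zero]
      refine Prod.ext (coind_ext fun z => ?_) (coind_ext fun z => ?_)
      · have := LinearMap.congr_fun hg (z, 0)
        simp only [LinearMap.comp_apply, LinearMap.coprod_apply, map_zero, add_zero, hf,
          LinearMap.mulLeft_apply] at this
        rw [evalAt_smul, show evalAt (0 : Env A) c.2 = 0 from LinearMap.map_zero _,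
          add_zero] at *
        exact this
      · have := LinearMap.congr_fun hg (0, z)
        simp only [LinearMap.comp_apply, LinearMap.coprod_apply, map_zero, zero_add, hf,
          LinearMap.mulLeft_apply] at this
        rw [evalAt_smul, show evalAt (0 : Env A) c.1 = 0 from LinearMap.map_zero _,
          zero_add] at *
        exact this
    · obtain ⟨g, hg⟩ := exists_comp_eq_of_ker_le
        ((LinearMap.coprod (LinearMap.mulLeft ℂ u) (LinearMap.mulLeft ℂ v)).prod
          (LinearMap.coprod (-LinearMap.mulLeft ℂ e) (LinearMap.mulLeft ℂ d))) f (by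
          rintro ⟨p, q⟩ hpq
          rw [LinearMap.mem_ker, LinearMap.prod_apply, Prod.mk_eq_zero] at hpq
          -- The first row alone suffices: `hX` describes the kernel of (u, v), which contains the
          -- kernel of the whole matrix.
          exact key p q (by simpa using hpq.1))
      refine ⟨(id (g ∘ₗ LinearMap.inl ℂ _ _), id (g ∘ₗ LinearMap.inr ℂ _ _)), ?_⟩
      rw [smallD_even _ _ _ _ h0 hn]
      refine Prod.ext (coind_ext fun z => ?_) (coind_ext fun z => ?_)
      · have := LinearMap.congr_fun hg (z, 0)
        rw [hf, show evalAt (0 : Env A) c.2 = 0 from LinearMap.map_zero _, add_zero] at this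
        rw [← this, map_sub, evalAt_smul, evalAt_smul]
        change g (u * z, 0) - g (0, e * z) = g (u * z + v * 0, -(e * z) + d * 0)
        rw [← map_sub]; simp
      · have := LinearMap.congr_fun hg (0, z)
        rw [hf, show evalAt (0 : Env A) c.1 = 0 from LinearMap.map_zero _, zero_add] at this
        rw [← this, map_add, evalAt_smul, evalAt_smul]
        change g (v * z, 0) + g (0, d * z) = g (u * 0 + v * z, -(e * 0) + d * z)
        rw [← map_add]; simp
  · rw [smallD_even _ _ _ _ (by omega) (by omega), Prod.mk_eq_zero] at hc
    have h1 : ∀ z, evalAt (u * z) c.1 - evalAt (e * z) c.2 = 0 := fun z => by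
      simpa [evalAt_smul] using congr_arg (evalAt z) hc.1
    have h2 : ∀ z, evalAt (v * z) c.1 + evalAt (d * z) c.2 = 0 := fun z => by
      simpa [evalAt_smul] using congr_arg (evalAt z) hc.2
    obtain ⟨g, hg⟩ := exists_comp_eq_of_ker_le
      ((LinearMap.coprod (LinearMap.mulLeft ℂ d) (-LinearMap.mulLeft ℂ v)).prod
        (LinearMap.coprod (LinearMap.mulLeft ℂ e) (LinearMap.mulLeft ℂ u))) f (by
        rintro ⟨p, q⟩ hpq
        rw [LinearMap.mem_ker, LinearMap.prod_apply, Prod.mk_eq_zero] at hpq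
        obtain ⟨s, t, rfl, rfl⟩ := hM p q (by simpa [sub_eq_add_neg] using hpq.1)
          (by simpa using hpq.2)
        rw [LinearMap.mem_ker, hf, sub_eq_add_neg, evalAt_add_left, evalAt_add_left,
          show -(e * s) = (-1 : ℂ) • (e * s) by simp, evalAt_smul_left, neg_one_smul]
        linear_combination (norm := module) h1 s + h2 t)
    refine ⟨(id (g ∘ₗ LinearMap.inl ℂ _ _), id (g ∘ₗ LinearMap.inr ℂ _ _)), ?_⟩
    rw [smallD_odd _ _ _ _ hn]
    refine Prod.ext (coind_ext fun z => ?_) (coind_ext fun z => ?_)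
    · have := LinearMap.congr_fun hg (z, 0)
      rw [hf, show evalAt (0 : Env A) c.2 = 0 from LinearMap.map_zero _, add_zero] at this
      rw [← this, map_add, evalAt_smul, evalAt_smul]
      change g (d * z, 0) + g (0, e * z) = g (d * z + -(v * 0), e * z + u * 0)
      rw [← map_add]; simp
    · have := LinearMap.congr_fun hg (0, z)
      rw [hf, show evalAt (0 : Env A) c.1 = 0 from LinearMap.map_zero _, zero_add] at this
      rw [← this, map_sub, evalAt_smul, evalAt_smul]
      change g (0, u * z) - g (v * z, 0) = g (d * 0 + -(v * z), e * 0 + u * z)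
      rw [← map_sub]; simp

end Exactness

end WordCochain

/-! ### The comparison theorem by dimension shifting. -/

namespace WordCochain

universe u

section Comparison

variable {A : Type u} [CommRing A] [Algebra ℂ A]

/-- The properties of the generators `x`, `y` and of the difference quotients presented by `T`
and `U` that make the small complex of free modules over the enveloping algebra a resolution. -/
structure IsResolving (x y : A) (T U : Finset (A × A)) : Prop where
  rel : presented T * diff x + presented U * diff y = 0
  gen : ∀ a : A, ∃ p q : Env A, diff a = p * diff x + q * diff y
  exactX : ∀ p q : Env A, diff x * p + diff y * q = 0 →
    ∃ s t, p = symPresented T * s - diff y * t ∧ q = symPresented U * s + diff x * t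
  exactM : ∀ p q : Env A, symPresented T * p - diff y * q = 0 →
    symPresented U * p + diff x * q = 0 →
      ∃ s t, p = diff x * s + diff y * t ∧ q = symPresented T * t - symPresented U * s

variable {M N : Type u} [AddCommGroup M] [Module ℂ M] [Module (Env A) M]
  [IsScalarTower ℂ (Env A) M]
  [AddCommGroup N] [Module ℂ N] [Module (Env A) N] [IsScalarTower ℂ (Env A) N]

variable (M) in
/-- The comparison map to the small complex in degree `n`. -/
def comp (x y : A) (T U : Finset (A × A)) (n : ℕ) : (List A → M) →ₗ[Env A] M × M :=
  if n % 2 = 1 then (compX M x y T U (n / 2)).prod (compY M x y T U (n / 2))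
  else (compA M x y T U (n / 2)).prod (if n = 0 then 0 else compB M x y T U (n / 2 - 1))

variable (M) in
/-- The differential of the small complex attached to `x`, `y`, `T`, `U`. -/
abbrev sd (x y : A) (T U : Finset (A × A)) (n : ℕ) : M × M →ₗ[Env A] M × M :=
  smallD M (diff x) (diff y) (symPresented T) (symPresented U) n

variable (x y : A) (T U : Finset (A × A))

theorem comp_zero (F : List A → M) : comp M x y T U 0 F = (F [], 0) := by
  simp [comp, compA_apply]

theorem comp_odd (k : ℕ) (F : List A → M) :
    comp M x y T U (2 * k + 1) F = (compX M x y T U k F, compY M x y T U k F) := by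
  have h1 : (2 * k + 1) % 2 = 1 := by omega
  have h2 : (2 * k + 1) / 2 = k := by omega
  simp [comp, h1, h2]

/-- The index of the second coordinate is one lower because the contractions with x and with y
already use up two degrees. -/
theorem comp_even (k : ℕ) (F : List A → M) :
    comp M x y T U (2 * (k + 1)) F = (compA M x y T U (k + 1) F, compB M x y T U k F) := by
  have h1 : (2 * (k + 1)) % 2 = 0 := by omega
  have h2 : (2 * (k + 1)) / 2 = k + 1 := by omega
  simp [comp, h1, h2]

theorem comp_comp (g : M →ₗ[Env A] N) (n : ℕ) (F : List A → M) :
    comp N x y T U n (fun t => g (F t)) =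
      (g (comp M x y T U n F).1, g (comp M x y T U n F).2) := by
  obtain ⟨k, rfl | rfl⟩ := Nat.even_or_odd' n
  · cases k with
    | zero => simp [comp_zero]
    | succ k => simp [comp_even, compA_apply, compB_apply, dpow_comp, ins_comp]
  · simp [comp_odd, compX_apply, compY_apply, dpow_comp, ins_comp]

variable {x y T U}

theorem comp_hd (h : presented T * diff x + presented U * diff y = 0) {n m : ℕ} {F : List A → M}
    (hF : F ∈ coch A M m) :
    comp M x y T U (n + 1) (hd M F) = sd M x y T U n (comp M x y T U n F) := by
  obtain ⟨k, rfl | rfl⟩ := Nat.even_or_odd' n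
  · rw [comp_odd]
    cases k with
    | zero =>
      rw [comp_zero, smallD_zero, compX_apply, compY_apply, dpow_zero, ins_singleton_cobd,
        ins_singleton_cobd]
      simp [diff]
    | succ k =>
      rw [comp_even, smallD_even _ _ _ _ (by omega) (by omega), compX_cobd h k hF,
        compY_cobd h k hF]
  · rw [show 2 * k + 1 + 1 = 2 * (k + 1) by ring, comp_even, comp_odd,
      smallD_odd _ _ _ _ (by omega), compA_cobd h k hF, compB_cobd h k hF]

/-- The function on words that is concentrated on the empty word. -/
def single (m : M) : List A → M
  | [] => m
  | _ :: _ => 0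

theorem single_mem_coch (m : M) : (single m : List A → M) ∈ coch A M 0 := fun _ _ => rfl

/-- Since every a ⊗ 1 - 1 ⊗ a lies in the ideal of those for x and y, the small and the Hochschild
complex have the same cocycles in degree zero. -/
theorem hd_single (hR : IsResolving x y T U) {m : M} (hx : diff x • m = 0) (hy : diff y • m = 0) :
    hd M (single m : List A → M) = 0 := by
  funext t
  match t with
  | [] => rfl
  | [a] =>
    obtain ⟨p, q, hpq⟩ := hR.gen a
    have : diff a • m = 0 := by rw [hpq, add_smul, mul_smul, mul_smul, hx, hy]; simp
    rw [diff, sub_smul] at this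
    simpa [single, sub_eq_add_neg] using this
  | a :: b :: t =>
    have : slice M (Env A) a (single m : List A → M) = 0 := rfl
    rw [cobd_cons, this]
    simp [single]

variable (A) in
/-- The exchange of the two factors of the enveloping algebra. -/
def envSwap : Env A →ₐ[ℂ] Env A :=
  (Algebra.TensorProduct.comm ℂ A A : TensorProduct ℂ A A ≃ₐ[ℂ] TensorProduct ℂ A A).toAlgHom

theorem envSwap_lft (a : A) : envSwap A (lft A a) = rgt A a :=
  Algebra.TensorProduct.comm_tmul (R := ℂ) (A := A) (B := A) a 1

theorem envSwap_rgt (a : A) : envSwap A (rgt A a) = lft A a :=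
  Algebra.TensorProduct.comm_tmul (R := ℂ) (A := A) (B := A) 1 a

theorem envSwap_diff (a : A) : envSwap A (diff a) = -diff a := by
  rw [diff, map_sub, envSwap_lft, envSwap_rgt, neg_sub]

theorem envSwap_presented (T : Finset (A × A)) : envSwap A (presented T) = presentedSwap T := by
  rw [presented, presentedSwap, map_sum]
  refine Finset.sum_congr rfl fun p _ => ?_
  rw [map_mul, envSwap_lft, envSwap_rgt, mul_comm]

/-- Exchanging the factors negates `diff`, so the relation also holds with the swapped coefficients;
average the two. -/
theorem symPresented_rel (h : presented T * diff x + presented U * diff y = 0) :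
    symPresented T * diff x + symPresented U * diff y = 0 := by
  have h5 := congr_arg (envSwap A) h
  rw [map_add, map_mul, map_mul, envSwap_presented, envSwap_presented, envSwap_diff, envSwap_diff,
    map_zero] at h5
  rw [symPresented, symPresented]
  linear_combination algebraMap ℂ (Env A) (1 / 2) * (h - h5)

variable (A M) in
/-- The embedding of a bimodule into a coinduced one. -/
def emb : M →ₗ[Env A] Coind A M where
  toFun m := (LinearMap.toSpanSingleton (Env A) M m).restrictScalars ℂ
  map_add' m m' := coind_ext fun z => smul_add z m m'
  map_smul' s m := coind_ext fun z => by
    change z • s • m = (s * z) • m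
    rw [smul_smul, mul_comm]

theorem evalAt_emb (z : Env A) (m : M) : evalAt z (emb A M m) = z • m := rfl

theorem emb_injective : Function.Injective (emb A M) := fun m m' h => by
  simpa [evalAt_emb] using congr_arg (evalAt 1) h

variable (A M) in
/-- The quotient of the coinduced bimodule by the image of `emb`. -/
def Cok : Type u := Coind A M ⧸ LinearMap.range (emb A M)

instance : AddCommGroup (Cok A M) :=
  inferInstanceAs (AddCommGroup (Coind A M ⧸ LinearMap.range (emb A M)))

instance : Module (Env A) (Cok A M) :=
  inferInstanceAs (Module (Env A) (Coind A M ⧸ LinearMap.range (emb A M)))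

instance : Module ℂ (Cok A M) :=
  inferInstanceAs (Module ℂ (Coind A M ⧸ LinearMap.range (emb A M)))

instance : IsScalarTower ℂ (Env A) (Cok A M) :=
  inferInstanceAs (IsScalarTower ℂ (Env A) (Coind A M ⧸ LinearMap.range (emb A M)))

variable (A M) in
/-- The projection of the coinduced bimodule to `Cok`. -/
def prj : Coind A M →ₗ[Env A] Cok A M := (LinearMap.range (emb A M)).mkQ

theorem prj_surjective : Function.Surjective (prj A M) := Submodule.mkQ_surjective _

theorem prj_emb (m : M) : prj A M (emb A M m) = 0 :=
  (Submodule.Quotient.mk_eq_zero _).2 ⟨m, rfl⟩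

theorem exists_emb_eq {z : Coind A M} (h : prj A M z = 0) : ∃ m, emb A M m = z :=
  (Submodule.Quotient.mk_eq_zero _).1 h

/-- Evaluation at 1 is a ℂ-linear retraction of `emb`. Cochains are only ℂ-multilinear, so this
suffices, as does a ℂ-linear section of `prj` for lifting cochains from the quotient. -/
theorem exists_coch_emb_eq {n : ℕ} {F : List A → Coind A M} (hF : F ∈ coch A (Coind A M) n)
    (h : (fun t => prj A M (F t)) = 0) :
    ∃ G ∈ coch A M n, (fun t => emb A M (G t)) = F := by
  refine ⟨fun t => evalAt 1 (F t), comp_mem_coch _ hF, funext fun t => ?_⟩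
  obtain ⟨m, hm⟩ := exists_emb_eq (congr_fun h t)
  change emb A M (evalAt 1 (F t)) = F t
  rw [← hm, evalAt_emb, one_smul]

theorem exists_coch_prj_eq {n : ℕ} {F : List A → Cok A M} (hF : F ∈ coch A (Cok A M) n) :
    ∃ G ∈ coch A (Coind A M) n, (fun t => prj A M (G t)) = F := by
  let π : Coind A M →ₗ[ℂ] Cok A M := (prj A M).restrictScalars ℂ
  have hπ : Function.Surjective π := prj_surjective
  obtain ⟨s, hs⟩ := π.exists_rightInverse_of_surjective (LinearMap.range_eq_top.2 hπ)
  exact ⟨fun t => s (F t), comp_mem_coch s hF, funext fun t => LinearMap.congr_fun hs (F t)⟩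

theorem exists_pair_prj_eq (c : Cok A M × Cok A M) :
    ∃ b : Coind A M × Coind A M, (prj A M b.1, prj A M b.2) = c := by
  obtain ⟨b1, h1⟩ := prj_surjective c.1
  obtain ⟨b2, h2⟩ := prj_surjective c.2
  exact ⟨(b1, b2), Prod.ext h1 h2⟩

theorem exists_pair_emb_eq {c : Coind A M × Coind A M} (h : (prj A M c.1, prj A M c.2) = 0) :
    ∃ b : M × M, (emb A M b.1, emb A M b.2) = c := by
  obtain ⟨h1, h2⟩ := Prod.mk_eq_zero.1 h
  obtain ⟨b1, h1⟩ := exists_emb_eq h1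
  obtain ⟨b2, h2⟩ := exists_emb_eq h2
  exact ⟨(b1, b2), Prod.ext h1 h2⟩

theorem pair_emb_injective {c c' : M × M}
    (h : (emb A M c.1, emb A M c.2) = (emb A M c'.1, emb A M c'.2)) : c = c' :=
  Prod.ext (emb_injective (Prod.mk.inj h).1) (emb_injective (Prod.mk.inj h).2)

theorem fun_emb_injective {F G : List A → M}
    (h : (fun t => emb A M (F t)) = fun t => emb A M (G t)) : F = G :=
  funext fun t => emb_injective (congr_fun h t)

variable (M) in
/-- The comparison map is injective in cohomology in degree `n + 1` and surjective. -/
def IsComparison (x y : A) (T U : Finset (A × A)) (n : ℕ) : Prop :=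
  (∀ F ∈ coch A M (n + 1), hd M F = 0 → (∃ c, sd M x y T U n c = comp M x y T U (n + 1) F) →
    ∃ G ∈ coch A M n, hd M G = F) ∧
  ∀ c, sd M x y T U (n + 1) c = 0 → ∃ F ∈ coch A M (n + 1), hd M F = 0 ∧
    ∃ b, comp M x y T U (n + 1) F = c + sd M x y T U n b

theorem exists_sd_eq_coind (hR : IsResolving x y T U) {V : Type u} [AddCommGroup V] [Module ℂ V]
    (n : ℕ) (c : Coind A V × Coind A V) (hc : sd (Coind A V) x y T U (n + 1) c = 0) :
    ∃ b, sd (Coind A V) x y T U n b = c :=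
  exists_smallD_eq_coind hR.exactX hR.exactM n c hc

/-- Degree one comes from degree zero of the quotient of the coinduced bimodule: classes with values
in `M` are connecting images of invariants of `Cok`, and the invariants for both complexes agree by
`hd_single`. -/
theorem isComparison_zero (hR : IsResolving x y T U) : IsComparison M x y T U 0 := by
  refine ⟨fun F hF h0 ⟨κ, hκ⟩ => ?_, fun c hc => ?_⟩
  · obtain ⟨G, hG, hGF⟩ := exists_hd_eq_coind (comp_mem_coch ((emb A M).restrictScalars ℂ) hF)
      (by
        change hd _ (fun t => emb A M (F t)) = 0
        rw [cobd_comp, h0]; funext t; simp)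
    change hd _ G = fun t => emb A M (F t) at hGF
    have h1 := comp_hd (n := 0) hR.rel hG
    rw [hGF, comp_comp, ← hκ, ← smallD_map, comp_zero, smallD_zero, smallD_zero,
      Prod.mk.injEq] at h1
    refine ⟨single κ.1, single_mem_coch _, fun_emb_injective ?_⟩
    have h2 : hd (Coind A M) (single (G [] - emb A M κ.1)) = 0 :=
      hd_single hR (by rw [smul_sub, h1.1, sub_self]) (by rw [smul_sub, h1.2, sub_self])
    rw [← cobd_comp, ← hGF, ← sub_eq_zero, ← neg_eq_zero, neg_sub, ← map_sub, ← h2]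
    congr 1
    funext t
    cases t with
    | nil => rfl
    | cons a t => simp [single, hG a t]
  · have hcE : sd (Coind A M) x y T U 1 (emb A M c.1, emb A M c.2) = 0 := by
      rw [smallD_map, hc]; simp
    obtain ⟨e, he⟩ := exists_sd_eq_coind hR 0 _ hcE
    have he' : sd (Cok A M) x y T U 0 (prj A M e.1, prj A M e.2) = 0 := by
      rw [smallD_map, he]
      simp only [prj_emb]; rfl
    rw [smallD_zero, Prod.mk_eq_zero] at he'
    have h1 : hd (Cok A M) (fun t : List A => prj A M (single e.1 t)) = 0 := by
      rw [show (fun t : List A => prj A M (single e.1 t)) = single (prj A M e.1) from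
        funext fun t => by cases t <;> simp [single]]
      exact hd_single hR he'.1 he'.2
    rw [cobd_comp] at h1
    obtain ⟨G, hG, hGe⟩ := exists_coch_emb_eq
      (cobd_mem_coch (lft A) (rgt A) (single_mem_coch e.1)) h1
    refine ⟨G, hG, fun_emb_injective ?_, 0, pair_emb_injective (A := A) ?_⟩
    · rw [← cobd_comp, hGe, cobd_cobd]; funext t; simp
    · rw [← comp_comp, hGe, comp_hd hR.rel (single_mem_coch e.1), map_zero, add_zero, ← he,
        comp_zero, smallD_zero, smallD_zero]; rfl

/-- The diagram chase in the two long exact sequences of M → Coind → Cok. The middle term is acyclic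
for both complexes, so a class of `M` in degree n + 2 is a class of `Cok` in degree n + 1. -/
theorem isComparison_succ (hR : IsResolving x y T U) (n : ℕ)
    (ih : IsComparison (Cok A M) x y T U n) : IsComparison M x y T U (n + 1) := by
  have hsd := symPresented_rel hR.rel
  refine ⟨fun F hF h0 ⟨κ, hκ⟩ => ?_, fun c hc => ?_⟩
  · obtain ⟨G, hG, hGF⟩ := exists_hd_eq_coind (comp_mem_coch ((emb A M).restrictScalars ℂ) hF)
      (by
        change hd _ (fun t => emb A M (F t)) = 0
        rw [cobd_comp, h0]; funext t; simp)
    change hd _ G = fun t => emb A M (F t) at hGF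
    have h1 := comp_hd (n := n + 1) hR.rel hG
    rw [hGF, comp_comp, ← hκ, ← smallD_map, ← sub_eq_zero, ← map_sub, ← neg_eq_zero, ← map_neg,
      neg_sub] at h1
    -- The image of `G` differs from `κ` by a cocycle of the acyclic small complex. Modulo `M` that
    -- image is thus a coboundary, as the induction hypothesis requires.
    obtain ⟨b, hb⟩ := exists_sd_eq_coind hR n _ h1
    obtain ⟨H, hH, hHG⟩ := ih.1 (fun t => prj A M (G t))
      (comp_mem_coch ((prj A M).restrictScalars ℂ) hG)
      (by rw [cobd_comp, hGF]; funext t; simp only [prj_emb]; rfl)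
      ⟨(prj A M b.1, prj A M b.2), by
        rw [smallD_map, hb, comp_comp]
        simp only [Prod.fst_sub, Prod.snd_sub, map_sub, prj_emb, sub_zero]⟩
    obtain ⟨H', hH', rfl⟩ := exists_coch_prj_eq hH
    obtain ⟨G', hG', hGG⟩ := exists_coch_emb_eq
      (Submodule.sub_mem _ hG (cobd_mem_coch (lft A) (rgt A) hH')) (by
        rw [cobd_comp] at hHG
        funext t
        simp only [Pi.sub_apply, map_sub, Pi.zero_apply]
        rw [← congr_fun hHG t, sub_self])
    refine ⟨G', hG', fun_emb_injective ?_⟩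
    rw [← cobd_comp, hGG, map_sub, cobd_cobd, sub_zero, hGF]
  · have hcE : sd (Coind A M) x y T U (n + 2) (emb A M c.1, emb A M c.2) = 0 := by
      rw [smallD_map, hc]; simp
    obtain ⟨e, he⟩ := exists_sd_eq_coind hR (n + 1) _ hcE
    have he' : sd (Cok A M) x y T U (n + 1) (prj A M e.1, prj A M e.2) = 0 := by
      rw [smallD_map, he]
      simp only [prj_emb]; rfl
    obtain ⟨F, hF, hF0, b, hb⟩ := ih.2 _ he'
    obtain ⟨F', hF', rfl⟩ := exists_coch_prj_eq hF
    obtain ⟨b', rfl⟩ := exists_pair_prj_eq b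
    rw [cobd_comp] at hF0
    obtain ⟨G, hG, hGF⟩ := exists_coch_emb_eq (cobd_mem_coch (lft A) (rgt A) hF') hF0
    -- The image of the lift `F'`, the primitive `e` and the correction `b'` agree only modulo `M`;
    -- their discrepancy `m` is the final correction term.
    obtain ⟨m, hm⟩ := exists_pair_emb_eq
      (c := comp _ x y T U (n + 1) F' - e - sd _ x y T U n b') (by
        rw [comp_comp, smallD_map, Prod.ext_iff] at hb
        simp only [Prod.fst_add, Prod.snd_add] at hb
        simp only [Prod.fst_sub, Prod.snd_sub, map_sub, hb.1, hb.2]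
        refine Prod.ext ?_ ?_ <;> simp)
    refine ⟨G, hG, fun_emb_injective ?_, m, pair_emb_injective (A := A) ?_⟩
    · rw [← cobd_comp, hGF, cobd_cobd]; funext t; simp
    · rw [← comp_comp, hGF, comp_hd hR.rel hF']
      have h1 := smallD_map (diff x) (diff y) (symPresented T) (symPresented U) (emb A M) (n + 1) m
      rw [hm, map_sub, map_sub, smallD_smallD hsd, he, sub_zero] at h1
      rw [Prod.fst_add, Prod.snd_add, map_add, map_add, ← Prod.mk_add_mk, ← h1]
      abel

/-- The bimodule is quantified inside the induction because each step passes to `Cok A M`. -/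
theorem isComparison (hR : IsResolving x y T U) (n : ℕ) : ∀ (M : Type u) [AddCommGroup M]
    [Module ℂ M] [Module (Env A) M] [IsScalarTower ℂ (Env A) M], IsComparison M x y T U n := by
  induction n with
  | zero => exact fun M _ _ _ _ => isComparison_zero hR
  | succ n ih => exact fun M _ _ _ _ => isComparison_succ hR n (ih (Cok A M))

end Comparison

end WordCochain

/-! ### Exactness over a hypersurface quotient, and Koszul exactness upstairs. -/

namespace WordCochain

open TensorProduct

section Factorization

variable {B S : Type*} [CommRing B] [CommRing S] (π : B →+* S) {u v d e : B}

/-- Lift to B, where u p + v q becomes a multiple c of ρ = d u + e v. Subtracting c (d, e) gives a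
syzygy of (u, v) in B, hence a Koszul one. -/
theorem exactX_of_koszul (hπ : Function.Surjective π)
    (hker : ∀ b, π b = 0 → ∃ c, b = (d * u + e * v) * c)
    (hK : ∀ p q, u * p + v * q = 0 → ∃ t, p = -(v * t) ∧ q = u * t)
    (p q : S) (hpq : π u * p + π v * q = 0) :
    ∃ s t, p = π d * s - π v * t ∧ q = π e * s + π u * t := by
  obtain ⟨p, rfl⟩ := hπ p
  obtain ⟨q, rfl⟩ := hπ q
  obtain ⟨c, hc⟩ := hker (u * p + v * q) (by simpa using hpq)
  obtain ⟨t, h1, h2⟩ := hK (p - d * c) (q - e * c) (by linear_combination hc)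
  refine ⟨π c, π t, ?_, ?_⟩
  · rw [← map_mul, ← map_mul, ← map_sub]; congr 1; linear_combination h1
  · rw [← map_mul, ← map_mul, ← map_add]; congr 1; linear_combination h2

/-- Eisenbud's argument: if one matrix of a factorization of ρ maps a lifted vector to ρ times (c,
c'), applying the other matrix and cancelling the regular element ρ expresses the vector through (c,
c'). -/
theorem exactM_of_regular (hπ : Function.Surjective π)
    (hker : ∀ b, π b = 0 → ∃ c, b = (d * u + e * v) * c)
    (hr : ∀ b, (d * u + e * v) * b = 0 → b = 0)
    (p q : S) (h1 : π d * p - π v * q = 0) (h2 : π e * p + π u * q = 0) :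
    ∃ s t, p = π u * s + π v * t ∧ q = π d * t - π e * s := by
  obtain ⟨p, rfl⟩ := hπ p
  obtain ⟨q, rfl⟩ := hπ q
  obtain ⟨c, hc⟩ := hker (d * p - v * q) (by simpa using h1)
  obtain ⟨c', hc'⟩ := hker (e * p + u * q) (by simpa using h2)
  refine ⟨π c, π c', ?_, ?_⟩
  · rw [← map_mul, ← map_mul, ← map_add]; congr 1
    rw [← sub_eq_zero]
    exact hr _ (by linear_combination u * hc + v * hc')
  · rw [← map_mul, ← map_mul, ← map_sub]; congr 1
    rw [← sub_eq_zero]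
    exact hr _ (by linear_combination d * hc' - e * hc)

end Factorization

section Koszul

-- Putting X = c gives w q(c) = 0, so X - c divides q; then the monic X - c can be cancelled.
open Polynomial in
theorem koszul_polynomial {B : Type*} [CommRing B] (c w : B) (hw : ∀ b, w * b = 0 → b = 0)
    (p q : B[X]) (h : (C c - X) * p + C w * q = 0) :
    ∃ t, p = -(C w * t) ∧ q = (C c - X) * t := by
  have h1 := congr_arg (eval c) h
  simp only [eval_add, eval_mul, eval_sub, eval_C, eval_X, sub_self, zero_mul, zero_add,
    eval_zero] at h1
  obtain ⟨t, ht⟩ := dvd_iff_isRoot.2 (hw _ h1 : IsRoot q c)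
  refine ⟨-t, ?_, by rw [ht]; ring⟩
  have h2 : (X - C c) * (p - C w * t) = 0 := by
    rw [ht] at h; linear_combination -h
  have h3 := (monic_X_sub_C c).isRegular.left
  have h4 : p - C w * t = 0 := h3 (by simpa using h2)
  linear_combination h4

open Polynomial in
theorem eq_zero_of_C_sub_X_mul {B : Type*} [CommRing B] (c : B) (p : B[X])
    (h : (C c - X) * p = 0) : p = 0 := by
  have h3 := (monic_X_sub_C c).isRegular.left
  exact h3 (by simp only [mul_zero]; linear_combination -h)

theorem koszul_transport {B B' : Type*} [CommRing B] [CommRing B'] (f : B ≃+* B') {u v : B}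
    (h : ∀ p q, f u * p + f v * q = 0 → ∃ t, p = -(f v * t) ∧ q = f u * t)
    (p q : B) (hpq : u * p + v * q = 0) : ∃ t, p = -(v * t) ∧ q = u * t := by
  obtain ⟨t, h1, h2⟩ := h (f p) (f q) (by rw [← map_mul, ← map_mul, ← map_add, hpq, map_zero])
  refine ⟨f.symm t, f.injective ?_, f.injective ?_⟩
  · rw [h1]; simp
  · rw [h2]; simp

-- View the ring as polynomials in X 0 over polynomials in X 1. The second element is then a
-- constant, and it is regular because up to sign it is monic in X 1.
open MvPolynomial in
theorem koszul_mvPolynomial {B : Type*} [CommRing B] (c : Fin 2 → B)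
    (p q : MvPolynomial (Fin 2) B) (h : (C (c 0) - X 0) * p + (C (c 1) - X 1) * q = 0) :
    ∃ t, p = -((C (c 1) - X 1) * t) ∧ q = (C (c 0) - X 0) * t := by
  refine koszul_transport (finSuccEquiv B 1).toRingEquiv (fun p q h => ?_) p q h
  have e0 : (finSuccEquiv B 1).toRingEquiv (C (c 0) - X 0) =
      Polynomial.C (C (c 0)) - Polynomial.X := by
    change finSuccEquiv B 1 (C (c 0) - X 0) = _
    rw [map_sub, finSuccEquiv_X_zero, finSuccEquiv_apply]; simp
  have e1 : (finSuccEquiv B 1).toRingEquiv (C (c 1) - X 1) =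
      Polynomial.C (C (c 1) - X 0) := by
    change finSuccEquiv B 1 (C (c 1) - X 1) = _
    rw [map_sub, show (1 : Fin 2) = Fin.succ 0 from rfl, finSuccEquiv_X_succ,
      finSuccEquiv_apply]; simp
  rw [e0, e1] at h ⊢
  refine koszul_polynomial _ _ (fun b hb => ?_) p q h
  have h2 : finSuccEquiv B 0 ((C (c 1) - X 0) * b) = 0 := by rw [hb, map_zero]
  rw [map_mul, map_sub, finSuccEquiv_X_zero,
    show finSuccEquiv B 0 (C (c 1)) = Polynomial.C (C (c 1)) by
      rw [finSuccEquiv_apply]; simp] at h2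
  simpa using eq_zero_of_C_sub_X_mul _ _ h2

variable {A : Type*} [CommRing A] [Algebra ℂ A]

theorem koszul_tensor (c : Fin 2 → A) (p q : A ⊗[ℂ] MvPolynomial (Fin 2) ℂ)
    (h : (c 0 ⊗ₜ 1 - 1 ⊗ₜ MvPolynomial.X 0) * p + (c 1 ⊗ₜ 1 - 1 ⊗ₜ MvPolynomial.X 1) * q = 0) :
    ∃ t, p = -((c 1 ⊗ₜ 1 - 1 ⊗ₜ MvPolynomial.X 1) * t) ∧
      q = (c 0 ⊗ₜ 1 - 1 ⊗ₜ MvPolynomial.X 0) * t := by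
  refine koszul_transport (MvPolynomial.algebraTensorAlgEquiv ℂ A).toRingEquiv
    (fun p q h => ?_) p q h
  have e : ∀ i : Fin 2, (MvPolynomial.algebraTensorAlgEquiv ℂ A).toRingEquiv
      (c i ⊗ₜ 1 - 1 ⊗ₜ MvPolynomial.X i) = MvPolynomial.C (c i) - MvPolynomial.X i := by
    intro i
    change MvPolynomial.algebraTensorAlgEquiv ℂ A _ = _
    simp [MvPolynomial.algebraTensorAlgEquiv_tmul, MvPolynomial.smul_eq_C_mul]
  rw [e, e] at h ⊢
  exact koszul_mvPolynomial c p q h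

/-- Multiplication by R is injective on P and stays so after tensoring with `A`, which is flat over
ℂ. -/
theorem eq_zero_of_one_tmul_mul {P : Type*} [CommRing P] [IsDomain P] [Algebra ℂ P] {R : P}
    (hR : R ≠ 0) (z : A ⊗[ℂ] P) (h : ((1 : A) ⊗ₜ[ℂ] R) * z = 0) : z = 0 := by
  have h1 : Function.Injective (LinearMap.mulLeft ℂ R) := mul_right_injective₀ hR
  have h2 := Module.Flat.lTensor_preserves_injective_linearMap (M := A) _ h1
  refine h2 ?_
  rw [map_zero, ← h]
  clear h
  induction z with
  | zero => simp
  | tmul a b => simp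
  | add a b ha hb => rw [map_add, ha, hb, mul_add]

end Koszul

end WordCochain

/-! ### Functoriality, multiplication and derivations of the enveloping algebra. -/

namespace WordCochain

open TensorProduct

section EnvMap

variable {A B : Type*} [CommRing A] [Algebra ℂ A] [CommRing B] [Algebra ℂ B]

/-- Functoriality of the enveloping algebra. -/
def envMap (f : A →ₐ[ℂ] B) : Env A →ₐ[ℂ] Env B := Algebra.TensorProduct.map f f

theorem envMap_lft (f : A →ₐ[ℂ] B) (a : A) : envMap f (lft A a) = lft B (f a) := by
  change Algebra.TensorProduct.map f f (a ⊗ₜ 1) = f a ⊗ₜ[ℂ] (1 : B)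
  simp

theorem envMap_rgt (f : A →ₐ[ℂ] B) (a : A) : envMap f (rgt A a) = rgt B (f a) := by
  change Algebra.TensorProduct.map f f (1 ⊗ₜ a) = (1 : B) ⊗ₜ[ℂ] f a
  simp

theorem envMap_diff (f : A →ₐ[ℂ] B) (a : A) : envMap f (diff a) = diff (f a) := by
  rw [diff, map_sub, envMap_lft, envMap_rgt, diff]

theorem env_algHom_ext {C : Type*} [CommRing C] [Algebra ℂ C] {f g : Env A →ₐ[ℂ] C}
    (h1 : ∀ a, f (lft A a) = g (lft A a)) (h2 : ∀ a, f (rgt A a) = g (rgt A a)) : f = g :=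
  Algebra.TensorProduct.ext (A := A) (B := A) (AlgHom.ext h1) (AlgHom.ext h2)

theorem envMap_envSwap (f : A →ₐ[ℂ] B) (z : Env A) :
    envMap f (envSwap A z) = envSwap B (envMap f z) := by
  have : (envMap f).comp (envSwap A) = (envSwap B).comp (envMap f) :=
    env_algHom_ext (fun a => by simp [envSwap_lft, envMap_lft, envMap_rgt])
      (fun a => by simp [envSwap_rgt, envMap_lft, envMap_rgt])
  exact DFunLike.congr_fun this z

variable (A) in
/-- The multiplication of `A`, as a homomorphism from the enveloping algebra. -/
def envMul : Env A →ₐ[ℂ] A := Algebra.TensorProduct.lmul' ℂ (S := A)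

@[simp] theorem envMul_lft (a : A) : envMul A (lft A a) = a := by
  change Algebra.TensorProduct.lmul' ℂ (a ⊗ₜ[ℂ] (1 : A)) = a
  simp

@[simp] theorem envMul_rgt (a : A) : envMul A (rgt A a) = a := by
  change Algebra.TensorProduct.lmul' ℂ ((1 : A) ⊗ₜ[ℂ] a) = a
  simp

theorem envMul_envSwap (z : Env A) : envMul A (envSwap A z) = envMul A z := by
  have : (envMul A).comp (envSwap A) = envMul A :=
    env_algHom_ext (fun a => by simp [envSwap_lft]) (fun a => by simp [envSwap_rgt])
  exact DFunLike.congr_fun this z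

theorem envMul_envMap (f : A →ₐ[ℂ] B) (z : Env A) : envMul B (envMap f z) = f (envMul A z) := by
  have : (envMul B).comp (envMap f) = f.comp (envMul A) :=
    env_algHom_ext (fun a => by simp [envMap_lft]) (fun a => by simp [envMap_rgt])
  exact DFunLike.congr_fun this z

theorem envMul_diff (a : A) : envMul A (diff a) = 0 := by
  rw [diff, map_sub, envMul_lft, envMul_rgt, sub_self]

/-- The derivation `a ⊗ b ↦ D a * b` along the multiplication. -/
def envDer (D : Derivation ℂ A A) : Env A →ₗ[ℂ] A :=
  (LinearMap.mul' ℂ A) ∘ₗ (LinearMap.rTensor A (D : A →ₗ[ℂ] A))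

theorem envDer_lft (D : Derivation ℂ A A) (a : A) : envDer D (lft A a) = D a := by
  change D a * 1 = D a
  rw [mul_one]

theorem envDer_rgt (D : Derivation ℂ A A) (a : A) : envDer D (rgt A a) = 0 := by
  change D 1 * a = 0
  rw [Derivation.map_one_eq_zero, zero_mul]

theorem env_induction {p : Env A → Prop} (h0 : p 0) (ht : ∀ a b, p (lft A a * rgt A b))
    (ha : ∀ z w, p z → p w → p (z + w)) (z : Env A) : p z :=
  TensorProduct.induction_on (motive := p) z h0
    (fun a b => by have := ht a b; rwa [lft_mul_rgt] at this) ha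

theorem envDer_lft_mul_rgt (D : Derivation ℂ A A) (a b : A) :
    envDer D (lft A a * rgt A b) = D a * b := by
  rw [lft_mul_rgt]; rfl

/-- The Leibniz rule along the diagonal. It is used to identify difference quotients with
derivatives: one summand vanishes when a factor is killed by multiplication. -/
theorem envDer_mul (D : Derivation ℂ A A) (z w : Env A) :
    envDer D (z * w) = envMul A z * envDer D w + envMul A w * envDer D z := by
  induction z using env_induction with
  | h0 => rw [zero_mul, map_zero, map_zero]; ring
  | ha z z' hz hz' => rw [add_mul, map_add, map_add, map_add, hz, hz']; ring
  | ht a b =>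
    induction w using env_induction with
    | h0 => rw [mul_zero, map_zero, map_zero]; ring
    | ha w w' hw hw' => rw [mul_add, map_add, map_add, map_add, hw, hw']; ring
    | ht c d =>
      have e : lft A a * rgt A b * (lft A c * rgt A d) = lft A (a * c) * rgt A (b * d) := by
        rw [map_mul, map_mul]; ring
      rw [e, envDer_lft_mul_rgt, envDer_lft_mul_rgt, envDer_lft_mul_rgt, Derivation.leibniz,
        map_mul (envMul A), map_mul (envMul A), envMul_lft, envMul_lft, envMul_rgt, envMul_rgt]
      simp only [smul_eq_mul]; ring

/-- The homomorphism `a ⊗ a' ↦ f a ⊗ a'`. -/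
def envLeft (f : A →ₐ[ℂ] B) : Env A →ₐ[ℂ] B ⊗[ℂ] A :=
  Algebra.TensorProduct.map f (AlgHom.id ℂ A)

theorem envLeft_lft (f : A →ₐ[ℂ] B) (a : A) : envLeft f (lft A a) = f a ⊗ₜ 1 :=
  Algebra.TensorProduct.map_tmul f (AlgHom.id ℂ A) a 1

theorem envLeft_rgt (f : A →ₐ[ℂ] B) (a : A) : envLeft f (rgt A a) = 1 ⊗ₜ a := by
  refine (Algebra.TensorProduct.map_tmul f (AlgHom.id ℂ A) 1 a).trans ?_
  rw [map_one]; rfl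

/-- The homomorphism `b ⊗ a ↦ b ⊗ f a`. -/
def envRight (f : A →ₐ[ℂ] B) : B ⊗[ℂ] A →ₐ[ℂ] Env B :=
  Algebra.TensorProduct.map (AlgHom.id ℂ B) f

theorem envRight_envLeft (f : A →ₐ[ℂ] B) (z : Env A) : envRight f (envLeft f z) = envMap f z := by
  have : (envRight f).comp (envLeft f) = envMap f := by
    refine env_algHom_ext (fun a => ?_) (fun a => ?_)
    · rw [AlgHom.comp_apply, envLeft_lft, envMap_lft]
      refine (Algebra.TensorProduct.map_tmul (AlgHom.id ℂ B) f (f a) 1).trans ?_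
      rw [map_one]; rfl
    · rw [AlgHom.comp_apply, envLeft_rgt, envMap_rgt]
      exact Algebra.TensorProduct.map_tmul (AlgHom.id ℂ B) f 1 a
  exact DFunLike.congr_fun this z

theorem envRight_surjective (f : A →ₐ[ℂ] B) (hf : Function.Surjective f) :
    Function.Surjective (envRight f) :=
  LinearMap.lTensor_surjective B (g := f.toLinearMap) hf

theorem envRight_eq_zero (f : A →ₐ[ℂ] B) (hf : Function.Surjective f) (z : B ⊗[ℂ] A)
    (hz : envRight f z = 0) : z ∈
      (RingHom.ker f).map (Algebra.TensorProduct.includeRight : A →ₐ[ℂ] B ⊗[ℂ] A) := by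
  rw [← Algebra.TensorProduct.lTensor_ker (A := B) f hf]
  exact hz

end EnvMap

end WordCochain

/-! ### The small complex of a plane curve is resolving. -/

namespace PlaneCurve

open MvPolynomial WordCochain TensorProduct

/-- The left and right embeddings of ℂ[x, y] agree on the variables modulo this ideal, hence on
every polynomial. -/
theorem exists_diff_eq (f : MvPolynomial (Fin 2) ℂ) :
    ∃ t u : Env (MvPolynomial (Fin 2) ℂ), diff f = t * diff (X 0) + u * diff (X 1) := by
  let I : Ideal (Env (MvPolynomial (Fin 2) ℂ)) := Ideal.span {diff (X 0), diff (X 1)}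
  have h : (Ideal.Quotient.mkₐ ℂ I).comp (lft _) = (Ideal.Quotient.mkₐ ℂ I).comp (rgt _) := by
    refine MvPolynomial.algHom_ext fun i => Ideal.Quotient.eq.2 (Ideal.subset_span ?_)
    fin_cases i
    · exact Or.inl rfl
    · exact Or.inr rfl
  have h2 : diff f ∈ I := Ideal.Quotient.eq.1 (DFunLike.congr_fun h f)
  obtain ⟨t, u, htu⟩ := Ideal.mem_span_pair.1 h2
  exact ⟨t, u, htu.symm⟩

variable (R : MvPolynomial (Fin 2) ℂ)

/-- The projection to the coordinate ring. -/
abbrev proj : MvPolynomial (Fin 2) ℂ →ₐ[ℂ] CoordRing R := Ideal.Quotient.mkₐ ℂ (Ideal.span {R})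

theorem proj_self : proj R R = 0 :=
  Ideal.Quotient.eq_zero_iff_mem.2 (Ideal.subset_span rfl)

/-- Difference quotients are not unique, but on the diagonal they restrict to the partial
derivatives: apply a derivation to the left factor and then multiply. -/
theorem envMul_eq_pderiv {R : MvPolynomial (Fin 2) ℂ} {t u : Env (MvPolynomial (Fin 2) ℂ)}
    (h : diff R = t * diff (X 0) + u * diff (X 1)) :
    envMul _ t = pderiv 0 R ∧ envMul _ u = pderiv 1 R := by
  have key : ∀ i : Fin 2, pderiv i R = envMul _ t * pderiv i (X 0) +
      envMul _ u * pderiv i (X 1 : MvPolynomial (Fin 2) ℂ) := by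
    intro i
    have h1 := congr_arg (envDer (pderiv i)) h
    rw [map_add, envDer_mul, envDer_mul, envMul_diff, envMul_diff] at h1
    simp only [diff, map_sub, envDer_lft, envDer_rgt] at h1
    rw [sub_zero, sub_zero, sub_zero, zero_mul, zero_mul, add_zero, add_zero] at h1
    exact h1
  refine ⟨?_, ?_⟩
  · rw [key 0]; simp
  · rw [key 1]; simp

theorem exists_presented {A : Type*} [CommRing A] [Algebra ℂ A] (z : Env A) :
    ∃ T : Finset (A × A), presented T = z := by
  obtain ⟨T, hT⟩ := TensorProduct.exists_finset (R := ℂ) (M := A) (N := A) z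
  refine ⟨T, ?_⟩
  rw [hT, presented]
  exact Finset.sum_congr rfl fun p _ => lft_mul_rgt p.1 p.2

/-- The relation is that of the difference quotients of R, pushed to A ⊗ A. Exactness is checked for
their symmetrizations on A ⊗ ℂ[x, y], one factor being left unreduced so that 1 ⊗ R is regular. -/
theorem exists_isResolving (hR : R ≠ 0) : ∃ T U : Finset (CoordRing R × CoordRing R),
    IsResolving (proj R (X 0)) (proj R (X 1)) T U ∧
      envMul _ (symPresented T) = partialR R 0 ∧ envMul _ (symPresented U) = partialR R 1 := by
  obtain ⟨t, u, h⟩ := exists_diff_eq R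
  obtain ⟨T, hT⟩ := exists_presented (envMap (proj R) t)
  obtain ⟨U, hU⟩ := exists_presented (envMap (proj R) u)
  have hsym : ∀ (T : Finset (CoordRing R × CoordRing R)) (t : Env (MvPolynomial (Fin 2) ℂ)),
      presented T = envMap (proj R) t → symPresented T =
        envMap (proj R) (algebraMap ℂ _ (1 / 2) * (t + envSwap _ t)) := by
    intro T t hT
    rw [symPresented, map_mul, map_add, envMap_envSwap, ← hT, envSwap_presented, AlgHom.commutes]
  have hmul : ∀ t : Env (MvPolynomial (Fin 2) ℂ),
      envMul _ (algebraMap ℂ _ (1 / 2) * (t + envSwap _ t)) = envMul _ t := by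
    intro t
    rw [map_mul, map_add, envMul_envSwap, AlgHom.commutes, ← two_mul, ← mul_assoc,
      ← map_ofNat (algebraMap ℂ (MvPolynomial (Fin 2) ℂ)) 2, ← map_mul]
    norm_num
  have h' := congr_arg (envSwap _) h
  rw [map_add, map_mul, map_mul, envSwap_diff, envSwap_diff, envSwap_diff] at h'
  set t' := algebraMap ℂ _ (1 / 2) * (t + envSwap _ t) with ht'
  set u' := algebraMap ℂ _ (1 / 2) * (u + envSwap _ u) with hu'
  -- Symmetrized coefficients still represent `diff R`, because the exchange of factors negates all
  -- three differences.
  have hsum : diff R = t' * diff (X 0) + u' * diff (X 1) := by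
    have h2 : algebraMap ℂ (Env (MvPolynomial (Fin 2) ℂ)) (1 / 2) * 2 = 1 := by
      rw [← map_ofNat (algebraMap ℂ (Env (MvPolynomial (Fin 2) ℂ))) 2, ← map_mul]
      norm_num
    rw [ht', hu']
    linear_combination (-diff R) * h2 + algebraMap ℂ (Env (MvPolynomial (Fin 2) ℂ)) (1 / 2) *
      (h - h')
  have hz : diff (proj R R) = 0 := by rw [proj_self, diff, map_zero, map_zero, sub_zero]
  -- the intermediate algebra `A ⊗ ℂ[x, y]`
  set π₁ := envLeft (proj R)
  set π := envRight (proj R)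
  have hcomp : ∀ z, π (π₁ z) = envMap (proj R) z := envRight_envLeft (proj R)
  have hdiff : ∀ f, π₁ (diff f) = proj R f ⊗ₜ 1 - 1 ⊗ₜ f := fun f => by
    rw [diff, map_sub, envLeft_lft, envLeft_rgt]
  -- In R ⊗ 1 - 1 ⊗ R only the left term dies, so the factorized element generates the kernel of the
  -- projection to A ⊗ A.
  have hρ : π₁ t' * π₁ (diff (X 0)) + π₁ u' * π₁ (diff (X 1)) = -((1 : CoordRing R) ⊗ₜ[ℂ] R) := by
    rw [← map_mul, ← map_mul, ← map_add, ← hsum, hdiff, proj_self, zero_tmul, zero_sub]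
  have hsurj : Function.Surjective (proj R) := Ideal.Quotient.mk_surjective
  have hπ : Function.Surjective π := envRight_surjective _ hsurj
  have hker : ∀ b, (π : _ →+* Env (CoordRing R)) b = 0 →
      ∃ c, b = (π₁ t' * π₁ (diff (X 0)) + π₁ u' * π₁ (diff (X 1))) * c := by
    intro b hb
    have h2 := envRight_eq_zero (proj R) hsurj b hb
    rw [show RingHom.ker (proj R) = Ideal.span {R} from Ideal.Quotient.mkₐ_ker ℂ _,
      Ideal.map_span, Set.image_singleton] at h2
    obtain ⟨c, hc⟩ := Ideal.mem_span_singleton'.1 h2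
    refine ⟨-c, ?_⟩
    rw [hρ, ← hc]
    simp [mul_comm]
  have e0 : (π : _ →+* Env (CoordRing R)) (π₁ (diff (X 0))) = diff (proj R (X 0)) := by
    rw [RingHom.coe_coe, hcomp, envMap_diff]
  have e1 : (π : _ →+* Env (CoordRing R)) (π₁ (diff (X 1))) = diff (proj R (X 1)) := by
    rw [RingHom.coe_coe, hcomp, envMap_diff]
  have eT : (π : _ →+* Env (CoordRing R)) (π₁ t') = symPresented T := by
    rw [RingHom.coe_coe, hcomp, hsym T t hT]
  have eU : (π : _ →+* Env (CoordRing R)) (π₁ u') = symPresented U := by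
    rw [RingHom.coe_coe, hcomp, hsym U u hU]
  refine ⟨T, U, ⟨?_, ?_, ?_, ?_⟩, ?_, ?_⟩
  · rw [hT, hU, ← envMap_diff, ← envMap_diff, ← map_mul, ← map_mul, ← map_add, ← h, envMap_diff, hz]
  · intro a
    obtain ⟨f, rfl⟩ := hsurj a
    obtain ⟨p, q, hpq⟩ := exists_diff_eq f
    refine ⟨envMap (proj R) p, envMap (proj R) q, ?_⟩
    rw [← envMap_diff, hpq, map_add, map_mul, map_mul, envMap_diff, envMap_diff]
  · have := exactX_of_koszul (u := π₁ (diff (X 0))) (v := π₁ (diff (X 1))) (d := π₁ t')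
      (e := π₁ u') (π : _ →+* Env (CoordRing R)) hπ hker (by
      rw [hdiff, hdiff]
      exact koszul_tensor (fun i => proj R (X i)))
    rwa [e0, e1, eT, eU] at this
  · have := exactM_of_regular (u := π₁ (diff (X 0))) (v := π₁ (diff (X 1))) (d := π₁ t')
      (e := π₁ u') (π : _ →+* Env (CoordRing R)) hπ hker (by
      intro b hb
      rw [hρ, neg_mul, neg_eq_zero] at hb
      exact eq_zero_of_one_tmul_mul hR b hb)
    rwa [e0, e1, eT, eU] at this
  · rw [hsym T t hT, envMul_envMap, hmul, (envMul_eq_pderiv h).1]; rfl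
  · rw [hsym U u hU, envMul_envMap, hmul, (envMul_eq_pderiv h).2]; rfl

end PlaneCurve

/-! ## Sorting permutations and the Hodge idempotents -/

namespace Hochschild

open Finset

section Count

variable {n : ℕ}

theorem card_orderEmb_fin (n N : ℕ) : Nat.card (Fin n ↪o Fin N) = N.choose n := by
  rw [Nat.card_congr Set.powersetCard.ofFinEmbEquiv, Set.powersetCard.card, Nat.card_fin]

/-- The number of ascents of `σ` in positions smaller than `i`. -/
def ascentsBelow (σ : Equiv.Perm (Fin (n + 1))) (i : Fin (n + 1)) : ℕ :=
  #{j : Fin n | j.castSucc < i ∧ σ j.castSucc < σ j.succ}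

theorem ascentsBelow_zero (σ : Equiv.Perm (Fin (n + 1))) : ascentsBelow σ 0 = 0 := by
  simp [ascentsBelow]

theorem ascentsBelow_succ (σ : Equiv.Perm (Fin (n + 1))) (j : Fin n) :
    ascentsBelow σ j.succ =
      ascentsBelow σ j.castSucc + if σ j.castSucc < σ j.succ then 1 else 0 := by
  have h : univ.filter (fun k : Fin n => k.castSucc < j.succ ∧ σ k.castSucc < σ k.succ) =
      univ.filter (fun k : Fin n => k.castSucc < j.castSucc ∧ σ k.castSucc < σ k.succ) ∪
        if σ j.castSucc < σ j.succ then {j} else ∅ := by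
    ext k
    simp only [mem_filter, mem_univ, true_and, mem_union, Fin.castSucc_lt_succ_iff,
      Fin.castSucc_lt_castSucc_iff, le_iff_lt_or_eq]
    split_ifs with h
    · simp only [mem_singleton]
      constructor
      · rintro ⟨h1 | h1, h2⟩
        · exact Or.inl ⟨h1, h2⟩
        · exact Or.inr h1
      · rintro (⟨h1, h2⟩ | rfl)
        · exact ⟨Or.inl h1, h2⟩
        · exact ⟨Or.inr rfl, h⟩
    · simp only [notMem_empty, or_false]
      constructor
      · rintro ⟨h1 | rfl, h2⟩
        · exact ⟨h1, h2⟩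
        · exact absurd h2 h
      · rintro ⟨h1, h2⟩
        exact ⟨Or.inl h1, h2⟩
  rw [ascentsBelow, h, card_union_of_disjoint, ascentsBelow]
  · split_ifs <;> simp
  · split_ifs <;> simp

theorem ascentsBelow_last_add_descents (σ : Equiv.Perm (Fin (n + 1))) :
    ascentsBelow σ (Fin.last n) + descents σ = n := by
  have h : descents σ = #{j : Fin n | ¬ σ j.castSucc < σ j.succ} := by
    rw [descents, ← Fintype.card_subtype, ← Nat.card_eq_fintype_card]
    symm
    refine Nat.card_congr (Equiv.ofBijective
      (fun j => ⟨j.1.castSucc, by simp, ?_⟩) ⟨fun j k h => ?_, fun i => ?_⟩)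
    · exact lt_of_le_of_ne (not_lt.1 j.2)
        (fun e => by have := σ.injective e; simp [Fin.ext_iff] at this)
    · ext; simpa [Fin.ext_iff] using h
    · obtain ⟨i, hi, h⟩ := i
      exact ⟨⟨⟨i, by omega⟩, not_lt.2 h.le⟩, rfl⟩
  have h' : ascentsBelow σ (Fin.last n) = #{j : Fin n | σ j.castSucc < σ j.succ} := by
    simp [ascentsBelow, Fin.castSucc_lt_last]
  rw [h, h', card_filter_add_card_filter_not, card_univ, Fintype.card_fin]

/-- Stable sorting by σ means that f ∘ σ is weakly increasing at ascents of σ and strictly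
increasing at descents. Adding the number of earlier ascents makes the condition strict everywhere.
-/
theorem sort_eq_iff {m : ℕ} (σ : Equiv.Perm (Fin (n + 1))) (f : Fin (n + 1) → Fin m) :
    Tuple.sort f = σ ↔ StrictMono fun i => (f (σ i) : ℕ) + ascentsBelow σ i := by
  rw [eq_comm, Tuple.eq_sort_iff', Fin.strictMono_iff_lt_succ, Fin.strictMono_iff_lt_succ]
  refine forall_congr' fun j => ?_
  rw [ascentsBelow_succ]
  change toLex (f (σ j.castSucc), σ j.castSucc) < toLex (f (σ j.succ), σ j.succ) ↔ _
  rw [Prod.Lex.toLex_lt_toLex, Fin.lt_def, Fin.ext_iff]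
  dsimp only
  by_cases h : σ j.castSucc < σ j.succ
  · rw [if_pos h]; simp only [h, and_true]; omega
  · rw [if_neg h]; simp only [h, and_false, or_false]; omega

/-- After the shift of `sort_eq_iff` these maps are the strictly increasing maps into a chain longer
by the number of ascents. -/
theorem card_sort_eq {m : ℕ} (σ : Equiv.Perm (Fin (n + 1))) :
    Nat.card {f : Fin (n + 1) → Fin m // Tuple.sort f = σ} =
      (m + ascentsBelow σ (Fin.last n)).choose (n + 1) := by
  have hmono : Monotone (ascentsBelow σ) :=
    Fin.monotone_iff_le_succ.2 fun j => by rw [ascentsBelow_succ]; omega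
  rw [← card_orderEmb_fin]
  refine Nat.card_congr (Equiv.ofBijective
    (fun f => OrderEmbedding.ofStrictMono
      (fun i => ⟨(f.1 (σ i) : ℕ) + ascentsBelow σ i, ?_⟩) ?_) ⟨fun f g h => ?_, fun h => ?_⟩)
  · have := hmono (Fin.le_last i); have := (f.1 (σ i)).2; omega
  · exact fun i j hij => (sort_eq_iff σ f.1).1 f.2 hij
  · ext x
    have h1 : (f.1 (σ (σ⁻¹ x)) : ℕ) + ascentsBelow σ (σ⁻¹ x) =
        g.1 (σ (σ⁻¹ x)) + ascentsBelow σ (σ⁻¹ x) :=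
      congr_arg Fin.val (DFunLike.congr_fun h (σ⁻¹ x))
    rw [Equiv.Perm.coe_inv, σ.apply_symm_apply] at h1
    omega
  · have hg : Monotone fun i => (h i : ℤ) - ascentsBelow σ i := by
      refine Fin.monotone_iff_le_succ.2 fun j => ?_
      have h1 : (h j.castSucc : ℕ) < h j.succ := h.strictMono Fin.castSucc_lt_succ
      have h2 := ascentsBelow_succ σ j
      have h3 : ascentsBelow σ j.succ ≤ ascentsBelow σ j.castSucc + 1 := by
        rw [h2]; split_ifs <;> omega
      omega
    have h0 : ∀ i, ascentsBelow σ i ≤ h i := fun i => by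
      have := hg (Fin.zero_le i)
      simp only [ascentsBelow_zero] at this
      omega
    have h1 : ∀ i, (h i : ℕ) - ascentsBelow σ i < m := fun i => by
      have := hg (Fin.le_last i)
      have := (h (Fin.last n)).2
      have := h0 i
      simp only at *
      omega
    refine ⟨⟨fun x => ⟨h (σ⁻¹ x) - ascentsBelow σ (σ⁻¹ x), h1 _⟩, ?_⟩, ?_⟩
    · rw [sort_eq_iff]
      intro i j hij
      have := h0 i
      have := h0 j
      have h2 : (h i : ℕ) < h j := h.strictMono hij
      simp only [Equiv.Perm.coe_inv, Equiv.symm_apply_apply]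
      omega
    · ext i
      have := h0 i
      simp
      omega

end Count

open Polynomial in
/-- The coefficient polynomial of a permutation in the generating function of the idempotents,
without the sign. -/
def genPoly {n : ℕ} (σ : Equiv.Perm (Fin n)) : ℂ[X] :=
  C (n.factorial : ℂ)⁻¹ * ∏ i ∈ range n, (X - C (descents σ : ℂ) + C (i : ℂ))

theorem idempotentCoeff_eq (n k : ℕ) (σ : Equiv.Perm (Fin n)) :
    idempotentCoeff n k σ = ((Equiv.Perm.sign σ : ℤ) : ℂ) * (genPoly σ).coeff k := by
  rw [idempotentCoeff, genPoly, Polynomial.coeff_C_mul]; ring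

/-- The number of maps `Fin n → Fin m` sorted by `σ`. -/
def sortCount {n : ℕ} (m : ℕ) (σ : Equiv.Perm (Fin n)) : ℕ :=
  Nat.card {f : Fin n → Fin m // Tuple.sort f = σ}

/-- With n ascents and descents in total for n + 1 letters, the product is the falling factorial
behind the binomial coefficient of `card_sort_eq`. -/
theorem genPoly_eval {n : ℕ} (σ : Equiv.Perm (Fin n)) (m : ℕ) :
    (genPoly σ).eval (m : ℂ) = sortCount m σ := by
  cases n with
  | zero =>
    have : Nat.card {f : Fin 0 → Fin m // Tuple.sort f = σ} = 1 := by
      rw [Nat.card_eq_one_iff_unique]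
      exact ⟨inferInstance, ⟨⟨Fin.elim0, Subsingleton.elim _ _⟩⟩⟩
    rw [sortCount, this]
    simp [genPoly]
  | succ n =>
    have h := ascentsBelow_last_add_descents σ
    have h2 : ((n + 1).factorial : ℂ) ≠ 0 := by exact_mod_cast Nat.factorial_ne_zero _
    rw [sortCount, card_sort_eq, genPoly, Polynomial.eval_mul, Polynomial.eval_C,
      inv_mul_eq_iff_eq_mul₀ h2, ← Nat.cast_mul, ← Nat.descFactorial_eq_factorial_mul_choose,
      ← descPochhammer_eval_eq_descFactorial, descPochhammer_eval_eq_prod_range,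
      ← prod_range_reflect, Polynomial.eval_prod]
    refine prod_congr rfl fun i hi => ?_
    rw [mem_range] at hi
    simp only [Polynomial.eval_add, Polynomial.eval_sub, Polynomial.eval_X, Polynomial.eval_C]
    have h3 : ((n + 1 - 1 - i : ℕ) : ℂ) = n - i := by
      rw [Nat.add_sub_cancel, Nat.cast_sub (by omega)]
    have h4 : (ascentsBelow σ (Fin.last n) : ℂ) + descents σ = n := by exact_mod_cast h
    rw [h3]
    push_cast
    linear_combination -h4

theorem natDegree_genPoly_le {n : ℕ} (σ : Equiv.Perm (Fin n)) : (genPoly σ).natDegree ≤ n := by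
  refine (Polynomial.natDegree_C_mul_le _ _).trans ((Polynomial.natDegree_prod_le _ _).trans ?_)
  refine (sum_le_sum fun i _ => (?_ : _ ≤ 1)).trans (by simp)
  rw [sub_add, ← map_sub]
  exact (Polynomial.natDegree_X_sub_C_le _)

theorem sortCount_one {n : ℕ} (σ : Equiv.Perm (Fin n)) :
    sortCount 1 σ = if σ = 1 then 1 else 0 := by
  have h : ∀ f : Fin n → Fin 1, Tuple.sort f = 1 := fun f =>
    Tuple.sort_eq_refl_iff_monotone.2 fun i j _ => (Subsingleton.elim (f i) (f j)).le
  rw [sortCount]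
  simp only [h, eq_comm (a := (1 : Equiv.Perm (Fin n)))]
  split_ifs with e <;> simp [e]

/-- Sorting by two keys, the first one being the more significant. -/
theorem sort_lex {n a b : ℕ} (g : Fin n → Fin a) (f : Fin n → Fin b) :
    Tuple.sort (fun x => finProdFinEquiv (g ((Tuple.sort f)⁻¹ x), f x)) =
      Tuple.sort f * Tuple.sort g := by
  symm
  rw [Tuple.eq_sort_iff]
  have hf := Tuple.eq_sort_iff.1 (rfl : Tuple.sort f = Tuple.sort f)
  have hg := Tuple.eq_sort_iff.1 (rfl : Tuple.sort g = Tuple.sort g)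
  refine ⟨fun i j hij => ?_, fun i j hij h => ?_⟩
  · rw [Fin.le_def]
    simp only [Function.comp_apply, finProdFinEquiv_apply_val, Equiv.Perm.mul_apply,
      Equiv.Perm.coe_inv, Equiv.symm_apply_apply]
    rcases hij.eq_or_lt with rfl | hij
    · exact le_rfl
    have h1 : g (Tuple.sort g i) ≤ g (Tuple.sort g j) := hg.1 hij.le
    rcases h1.eq_or_lt with h1 | h1
    · have h2 : f (Tuple.sort f (Tuple.sort g i)) ≤ f (Tuple.sort f (Tuple.sort g j)) :=
        hf.1 (hg.2 i j hij h1).le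
      rw [h1]
      have : (f (Tuple.sort f (Tuple.sort g i)) : ℕ) ≤ f (Tuple.sort f (Tuple.sort g j)) := h2
      omega
    · have h2 : (g (Tuple.sort g i) : ℕ) + 1 ≤ g (Tuple.sort g j) := h1
      have h3 := Nat.mul_le_mul_left b h2
      have := (f (Tuple.sort f (Tuple.sort g i))).2
      rw [mul_add, mul_one] at h3
      omega
  · have h := finProdFinEquiv.injective h
    simp only [Equiv.Perm.mul_apply, Equiv.Perm.coe_inv, Equiv.symm_apply_apply, Prod.mk.injEq] at h
    exact hf.2 _ _ (hg.2 i j hij h.1) h.2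

/-- A key in a product of chains is a pair of keys, and by `sort_lex` sorting by it means sorting by
the less and the more significant key in succession. Thus Adams elements multiply as their indices
do. -/
theorem sum_sortCount_mul {n : ℕ} (a b : ℕ) (σ : Equiv.Perm (Fin n)) :
    ∑ τ : Equiv.Perm (Fin n), sortCount a τ * sortCount b (σ * τ⁻¹) = sortCount (a * b) σ := by
  have e : {h : Fin n → Fin (a * b) // Tuple.sort h = σ} ≃
      Σ τ : Equiv.Perm (Fin n), {g : Fin n → Fin a // Tuple.sort g = τ} ×
        {f : Fin n → Fin b // Tuple.sort f = σ * τ⁻¹} := by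
    symm
    refine Equiv.ofBijective (fun p => ⟨fun x => finProdFinEquiv
      (p.2.1.1 ((Tuple.sort p.2.2.1)⁻¹ x), p.2.2.1 x), ?_⟩) ⟨?_, ?_⟩
    · rw [sort_lex, p.2.1.2, p.2.2.2, inv_mul_cancel_right]
    · rintro ⟨τ, ⟨g, rfl⟩, ⟨f, hf⟩⟩ ⟨τ', ⟨g', rfl⟩, ⟨f', hf'⟩⟩ h
      have h := congr_arg Subtype.val h
      have h1 : ∀ x, g ((Tuple.sort f)⁻¹ x) = g' ((Tuple.sort f')⁻¹ x) ∧ f x = f' x := fun x => by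
        have := finProdFinEquiv.injective (congr_fun h x)
        simpa using this
      obtain rfl : f = f' := funext fun x => (h1 x).2
      obtain rfl : g = g' := funext fun x => by simpa using (h1 (Tuple.sort f x)).1
      rfl
    · rintro ⟨h, hh⟩
      set f : Fin n → Fin b := fun x => (finProdFinEquiv.symm (h x)).2 with hf
      set g : Fin n → Fin a := fun x => (finProdFinEquiv.symm (h (Tuple.sort f x))).1 with hg
      have hlex : (fun x => finProdFinEquiv (g ((Tuple.sort f)⁻¹ x), f x)) = h := by
        funext x
        simp only [hg, Equiv.Perm.coe_inv, Equiv.apply_symm_apply]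
        simp only [hf, Prod.mk.eta, Equiv.apply_symm_apply]
      have hs := sort_lex g f
      rw [hlex, hh] at hs
      exact ⟨⟨Tuple.sort g, ⟨g, rfl⟩, ⟨f, by rw [hs, mul_inv_cancel_right]⟩⟩, Subtype.ext hlex⟩
  rw [sortCount, Nat.card_congr e, Nat.card_sigma]
  exact sum_congr rfl fun τ _ => (Nat.card_prod _ _).symm

/-- For fixed a, `sum_sortCount_mul` holds for all natural b, hence as a polynomial identity in b.
Its coefficients say that the a-th Adams element acts by a^k on the k-th idempotent. -/
theorem sum_sortCount_mul_coeff {n : ℕ} (a k : ℕ) (σ : Equiv.Perm (Fin n)) :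
    ∑ τ : Equiv.Perm (Fin n), (sortCount a τ : ℂ) * (genPoly (σ * τ⁻¹)).coeff k =
      (a : ℂ) ^ k * (genPoly σ).coeff k := by
  have h : ∑ τ : Equiv.Perm (Fin n), Polynomial.C (sortCount a τ : ℂ) * genPoly (σ * τ⁻¹) =
      (genPoly σ).comp (Polynomial.C (a : ℂ) * Polynomial.X) := by
    refine Polynomial.eq_of_infinite_eval_eq _ _
      (Set.Infinite.mono ?_ (Set.infinite_range_of_injective (Nat.cast_injective (R := ℂ))))
    rintro _ ⟨m, rfl⟩
    change Polynomial.eval _ _ = Polynomial.eval _ _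
    simp only [Polynomial.eval_finsetSum, Polynomial.eval_mul, Polynomial.eval_C,
      Polynomial.eval_comp, Polynomial.eval_X, genPoly_eval]
    rw [← Nat.cast_mul, genPoly_eval, ← sum_sortCount_mul]
    push_cast
    rfl
  have h' := congr_arg (fun p => Polynomial.coeff p k) h
  simp only [Polynomial.finsetSum_coeff, Polynomial.coeff_C_mul,
    Polynomial.comp_C_mul_X_coeff] at h'
  rw [h', mul_comm]

/-- The sum of the coefficients is the value at 1, which counts constant maps; only the identity
sorts these. -/
theorem sum_coeff_genPoly {n N : ℕ} (hN : n < N) (σ : Equiv.Perm (Fin n)) :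
    ∑ k ∈ range N, (genPoly σ).coeff k = if σ = 1 then 1 else 0 := by
  have h := Polynomial.eval_eq_sum_range' (lt_of_le_of_lt (natDegree_genPoly_le σ) hN) 1
  have h2 := genPoly_eval σ 1
  rw [Nat.cast_one, h] at h2
  simp only [one_pow, mul_one] at h2
  rw [h2, sortCount_one]
  split_ifs <;> simp

end Hochschild

/-! ### Hodge components as eigenspaces of the second Adams operation. -/

namespace Hochschild

open Finset

section AdamsOperation

variable {A : Type*} [CommRing A] [Algebra ℂ A]

variable (A) in
/-- The second Adams operation on Hochschild cochains. -/
def adamsOp (n : ℕ) : Cochain A n →ₗ[ℂ] Cochain A n :=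
  ∑ σ : Equiv.Perm (Fin n), ((sortCount 2 σ : ℂ) * ((Equiv.Perm.sign σ : ℤ) : ℂ)) •
    (MultilinearMap.domDomCongrLinearEquiv ℂ ℂ A A σ⁻¹).toLinearMap

theorem adamsOp_apply {n : ℕ} (C : Cochain A n) (a : Fin n → A) :
    adamsOp A n C a = ∑ σ : Equiv.Perm (Fin n),
      ((sortCount 2 σ : ℂ) * ((Equiv.Perm.sign σ : ℤ) : ℂ)) • C (fun i => a (σ⁻¹ i)) := by
  simp [adamsOp]

theorem adamsOp_apply_eq_sum_sort {n : ℕ} (C : Cochain A n) (a : Fin n → A) :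
    adamsOp A n C a = ∑ f : Fin n → Fin 2,
      ((Equiv.Perm.sign (Tuple.sort f) : ℤ) : ℂ) • C (fun i => a ((Tuple.sort f)⁻¹ i)) := by
  rw [adamsOp_apply, ← sum_fiberwise univ (fun f : Fin n → Fin 2 => Tuple.sort f)]
  refine sum_congr rfl fun σ _ => ?_
  rw [sum_congr rfl (g := fun _ => ((Equiv.Perm.sign σ : ℤ) : ℂ) • C (fun i => a (σ⁻¹ i)))
    fun f hf => by rw [(mem_filter.1 hf).2], sum_const, mul_smul, sortCount,
    Nat.card_eq_fintype_card, Fintype.card_subtype, Nat.cast_smul_eq_nsmul]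

theorem adamsOp_hodgeProjector {n : ℕ} (k : ℕ) (C : Cochain A n) :
    adamsOp A n (hodgeProjector A n k C) = (2 : ℂ) ^ k • hodgeProjector A n k C := by
  ext a
  rw [adamsOp_apply, _root_.smul_apply, hodgeProjector_apply, smul_sum]
  simp only [hodgeProjector_apply, smul_sum]
  -- Reindex the inner sum so that the product permutation σ is fixed; the coefficients then form
  -- the convolution of `sum_sortCount_mul_coeff`.
  rw [sum_congr rfl fun τ _ => (Equiv.sum_comp (Equiv.mulRight τ⁻¹) _).symm, sum_comm]
  refine sum_congr rfl fun σ _ => ?_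
  have h : ∀ τ : Equiv.Perm (Fin n), ∀ i, τ⁻¹ ((σ * τ⁻¹)⁻¹ i) = σ⁻¹ i := fun τ i => by
    rw [mul_inv_rev, inv_inv, Equiv.Perm.mul_apply, Equiv.Perm.coe_inv τ,
      Equiv.symm_apply_apply]
  have h2 : ∀ τ : Equiv.Perm (Fin n), ((Equiv.Perm.sign τ : ℤ) : ℂ) *
      ((Equiv.Perm.sign (σ * τ⁻¹) : ℤ) : ℂ) = ((Equiv.Perm.sign σ : ℤ) : ℂ) := fun τ => by
    rw [← Int.cast_mul, ← Units.val_mul, ← map_mul, show τ * (σ * τ⁻¹) = τ * σ * τ⁻¹ by group,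
      map_mul, map_mul, map_inv, mul_comm (Equiv.Perm.sign τ), mul_inv_cancel_right]
  simp only [Equiv.coe_mulRight, smul_smul, idempotentCoeff_eq]
  rw [sum_congr rfl fun τ _ => by rw [funext fun i => congr_arg a (h τ i)], ← sum_smul]
  congr 1
  have h3 := sum_sortCount_mul_coeff 2 k σ
  rw [Nat.cast_ofNat] at h3
  rw [mul_left_comm, ← h3, mul_sum]
  refine sum_congr rfl fun τ _ => ?_
  linear_combination (sortCount 2 τ : ℂ) * (genPoly (σ * τ⁻¹)).coeff k * h2 τ

theorem sum_hodgeProjector {n N : ℕ} (hN : n < N) (C : Cochain A n) :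
    ∑ k ∈ range N, hodgeProjector A n k C = C := by
  ext a
  rw [_root_.sum_apply]
  simp only [hodgeProjector_apply]
  rw [sum_comm]
  simp only [idempotentCoeff_eq, ← sum_smul, ← mul_sum, sum_coeff_genPoly hN]
  rw [sum_eq_single 1 (fun σ _ h => by simp [h]) (by simp), if_pos rfl, inv_one]
  simp

/-- Eigenvectors of an operator to different powers of two are independent. -/
theorem eq_zero_of_sum_eq_zero {V : Type*} [AddCommGroup V] [Module ℂ V] (T : V →ₗ[ℂ] V)
    {c : ℕ → V} {s : Finset ℕ} (hc : ∀ k ∈ s, T (c k) = (2 : ℂ) ^ k • c k)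
    (h : ∑ k ∈ s, c k = 0) : ∀ k ∈ s, c k = 0 := by
  have hinj : Function.Injective fun k : ℕ => (2 : ℂ) ^ k := fun i j hij => by
    have : ((2 ^ i : ℕ) : ℂ) = ((2 ^ j : ℕ) : ℂ) := by push_cast; exact hij
    exact Nat.pow_right_injective le_rfl (Nat.cast_injective this)
  have hind := (Module.End.eigenspaces_iSupIndep (T : Module.End ℂ V)).comp hinj
  rw [iSupIndep_iff_finsetSum_eq_zero_imp_eq_zero] at hind
  exact hind s c (fun k hk => Module.End.mem_eigenspace_iff.2 (hc k hk)) h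

/-- The projections of C are eigenvectors with different eigenvalues and sum to C, which is an
eigenvector itself; by independence only the k-th survives. -/
theorem hodgeProjector_eq {n k : ℕ} {C : Cochain A n} (h : adamsOp A n C = (2 : ℂ) ^ k • C) :
    hodgeProjector A n k C = C := by
  classical
  -- The range must exceed n for the projectors to sum to the identity, and must contain k, which
  -- may be larger than n.
  have h1 := sum_hodgeProjector (N := max n k + 1) (by omega) C
  have h2 := eq_zero_of_sum_eq_zero (adamsOp A n)
    (c := fun j => hodgeProjector A n j C - if j = k then C else 0) (s := range (max n k + 1))
    (fun j _ => by
      rw [map_sub, smul_sub, adamsOp_hodgeProjector]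
      split_ifs with e
      · rw [e, h]
      · rw [map_zero, smul_zero])
    (by rw [sum_sub_distrib, h1, sum_ite_eq' , if_pos (mem_range.2 (by omega)), sub_self])
    k (mem_range.2 (by omega))
  simpa [sub_eq_zero] using h2

theorem mem_hodgeCochains {n k : ℕ} {C : Cochain A n} :
    C ∈ hodgeCochains A n k ↔ adamsOp A n C = (2 : ℂ) ^ k • C :=
  ⟨by rintro ⟨D, rfl⟩; exact adamsOp_hodgeProjector k D, fun h => ⟨C, hodgeProjector_eq h⟩⟩

end AdamsOperation

end Hochschild

/-! ### Sorting permutations of two-valued maps are shuffles. -/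

namespace WordCochain

open Finset

section SortShuffle

variable {A M S : Type*} [CommRing A] [CommRing S] [AddCommGroup M] [Module S M]

theorem cut_eq_sum (G : List A → List A → M) (l : List A) :
    cut M S G l = ∑ z ∈ range (l.length + 1), G (l.take z) (l.drop z) := by
  induction l generalizing G with
  | nil => simp
  | cons a t ih =>
    rw [cut_cons, ih, List.length_cons, sum_range_succ' _ (t.length + 1), add_comm]
    rfl

/-- A new first entry is placed after the strictly smaller values and, by stability, before the
equal ones, that is at position p; the other entries keep their order. -/
theorem sort_cons {n m : ℕ} (c : Fin m) (f : Fin n → Fin m) (p : Fin (n + 1))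
    (hp : (p : ℕ) = #{j | f j < c}) :
    Tuple.sort (Fin.cons c f : Fin (n + 1) → Fin m) =
      Equiv.Perm.decomposeFin.symm (0, Tuple.sort f) * p.cycleRange := by
  symm
  have hf := Tuple.eq_sort_iff.1 (rfl : Tuple.sort f = Tuple.sort f)
  have hcard : #{j | f j < c} = #{j | (f ∘ Tuple.sort f) j < c} :=
    (card_equiv (Tuple.sort f) (by simp)).symm
  have hlt : ∀ k : Fin n, (k : ℕ) < p ↔ f (Tuple.sort f k) < c := fun k => by
    rw [hp, hcard]
    exact Tuple.lt_card_lt_iff_apply_lt_of_monotone hf.1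
  have e0 : (Equiv.Perm.decomposeFin.symm (0, Tuple.sort f) * p.cycleRange) p = 0 := by
    rw [Equiv.Perm.mul_apply, Fin.cycleRange_self, Equiv.Perm.decomposeFin_symm_apply_zero]
  have e1 : ∀ k, (Equiv.Perm.decomposeFin.symm (0, Tuple.sort f) * p.cycleRange)
      (p.succAbove k) = (Tuple.sort f k).succ := fun k => by
    rw [Equiv.Perm.mul_apply, Fin.cycleRange_succAbove,
      Equiv.Perm.decomposeFin_symm_apply_succ, Equiv.swap_self, Equiv.refl_apply]
  set σ := Equiv.Perm.decomposeFin.symm (0, Tuple.sort f) * p.cycleRange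
  set g : Fin (n + 1) → Fin m := Fin.cons c f with hg
  have key : ∀ i j, i < j → g (σ i) ≤ g (σ j) ∧ (g (σ i) = g (σ j) → σ i < σ j) := by
    intro i j hij
    rcases Fin.eq_self_or_eq_succAbove p i with hi | ⟨k, rfl⟩ <;>
    rcases Fin.eq_self_or_eq_succAbove p j with hj | ⟨k', rfl⟩
    · exact absurd (hi.trans hj.symm) hij.ne
    · rw [hi] at hij ⊢
      rw [e0, e1]
      have h : ¬ f (Tuple.sort f k') < c := by
        rw [← hlt, not_lt]
        exact Fin.lt_succAbove_iff_le_castSucc _ _ |>.1 hij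
      exact ⟨not_lt.1 h, fun _ => Fin.succ_pos _⟩
    · rw [hj] at hij ⊢
      rw [e0, e1]
      have h : f (Tuple.sort f k) < c := by
        rw [← hlt]
        exact Fin.succAbove_lt_iff_castSucc_lt _ _ |>.1 hij
      exact ⟨h.le, fun h' => absurd h' h.ne⟩
    · rw [e1, e1]
      have hk : k < k' := Fin.succAbove_lt_succAbove_iff.1 hij
      exact ⟨hf.1 hk.le, fun h => Fin.succ_lt_succ_iff.2 (hf.2 _ _ hk h)⟩
  rw [Tuple.eq_sort_iff]
  refine ⟨fun i j hij => ?_, fun i j hij => (key i j hij).2⟩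
  rcases hij.eq_or_lt with rfl | hij
  · exact le_rfl
  · exact (key i j hij).1

variable (S) in
/-- The summand of the shuffle product indexed by `f`. -/
def sortTerm {n : ℕ} (F : List A → M) (a : Fin n → A) (f : Fin n → Fin 2) : M :=
  ((Equiv.Perm.sign (Tuple.sort f) : ℤ) : S) •
    F (List.ofFn fun i => a ((Tuple.sort f)⁻¹ i))

theorem sortTerm_cons {n : ℕ} (F : List A → M) (a : Fin (n + 1) → A) (c : Fin 2)
    (f : Fin n → Fin 2) (p : Fin (n + 1)) (hp : (p : ℕ) = #{j | f j < c}) :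
    sortTerm S F a (Fin.cons c f : Fin (n + 1) → Fin 2) =
      (-1 : S) ^ (p : ℕ) • sortTerm S (slice M S (a p) F) (fun i => a (p.succAbove i)) f := by
  have e0 : (Tuple.sort (Fin.cons c f : Fin (n + 1) → Fin 2))⁻¹ 0 = p := by
    rw [Equiv.Perm.inv_eq_iff_eq, sort_cons c f p hp, Equiv.Perm.mul_apply, Fin.cycleRange_self,
      Equiv.Perm.decomposeFin_symm_apply_zero]
  have e1 : ∀ i, (Tuple.sort (Fin.cons c f : Fin (n + 1) → Fin 2))⁻¹ (Fin.succ i) =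
      p.succAbove ((Tuple.sort f)⁻¹ i) := fun i => by
    rw [Equiv.Perm.inv_eq_iff_eq, sort_cons c f p hp, Equiv.Perm.mul_apply,
      Fin.cycleRange_succAbove, Equiv.Perm.decomposeFin_symm_apply_succ, Equiv.swap_self,
      Equiv.refl_apply, Equiv.Perm.coe_inv, Equiv.apply_symm_apply]
  have es : Equiv.Perm.sign (Tuple.sort (Fin.cons c f : Fin (n + 1) → Fin 2)) =
      (-1) ^ (p : ℕ) * Equiv.Perm.sign (Tuple.sort f) := by
    rw [sort_cons c f p hp, Equiv.Perm.sign_mul, Fin.sign_cycleRange,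
      Equiv.Perm.decomposeFin.symm_sign, if_pos rfl, one_mul, mul_comm]
  rw [sortTerm, sortTerm, es, List.ofFn_succ, e0, slice_apply, smul_smul]
  simp only [e1]
  push_cast
  rfl

theorem shuffle_take_drop_zero {n : ℕ} (F : List A → M) (a : Fin (n + 1) → A) :
    shuffle M S ((List.ofFn a).take 0) ((List.ofFn a).drop 0) F =
      shuffle M S ((List.ofFn fun i : Fin n => a (Fin.succAbove 0 i)).take 0)
        ((List.ofFn fun i : Fin n => a (Fin.succAbove 0 i)).drop 0) (slice M S (a 0) F) := by
  simp [List.ofFn_succ]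

theorem drop_ofFn_succAbove {n : ℕ} (a : Fin (n + 1) → A) (p : Fin (n + 1)) :
    (List.ofFn a).drop p = a p :: (List.ofFn fun i => a (p.succAbove i)).drop p := by
  refine List.ext_getElem (by simp; omega) fun i h1 h2 => ?_
  cases i with
  | zero => simp only [List.getElem_drop, List.getElem_ofFn, List.getElem_cons_zero]; rfl
  | succ i =>
    simp only [List.getElem_drop, List.getElem_ofFn, List.getElem_cons_succ]
    congr 1
    rw [Fin.succAbove_of_le_castSucc _ _ (by simp [Fin.le_def])]
    ext
    simp
    omega

theorem take_ofFn_succAbove {n : ℕ} (a : Fin (n + 1) → A) (p : Fin (n + 1)) :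
    (List.ofFn a).take p = (List.ofFn fun i => a (p.succAbove i)).take p := by
  refine List.ext_getElem (by simp; omega) fun i h1 h2 => ?_
  simp only [List.length_take, List.length_ofFn, lt_inf_iff] at h1
  simp only [List.getElem_take, List.getElem_ofFn]
  congr 1
  rw [Fin.succAbove_of_castSucc_lt _ _ (by simp [Fin.lt_def, h1.1])]
  rfl

theorem sum_fin_succ_two {n : ℕ} (g : (Fin (n + 1) → Fin 2) → M) :
    ∑ f, g f = ∑ f : Fin n → Fin 2, (g (Fin.cons 0 f) + g (Fin.cons 1 f)) := by
  rw [← Equiv.sum_comp (Fin.consEquiv fun _ => Fin 2), Fintype.sum_prod_type, Fin.sum_univ_two,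
    ← sum_add_distrib]
  rfl

theorem card_lt_one_cons {n : ℕ} (f : Fin n → Fin 2) (c : Fin 2) :
    #{j | (Fin.cons c f : Fin (n + 1) → Fin 2) j < 1} = #{j | f j < 1} + if c < 1 then 1 else 0 := by
  rw [Fin.card_filter_univ_succ]
  simp only [Fin.cons_zero, Fin.cons_succ, Function.comp_def]
  split_ifs <;> rfl

/-- A map f to two values encodes a shuffle: f i tells which of the two words supplies the i-th
letter, and z values 0 mean that the first word has length z. The recursion on f 0 is the recursion
of `shuffle`. -/
theorem shuffle_take_drop {n : ℕ} (z : ℕ) (hz : z ≤ n) (F : List A → M) (a : Fin n → A) :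
    shuffle M S ((List.ofFn a).take z) ((List.ofFn a).drop z) F =
      ∑ f : Fin n → Fin 2, if #{j | f j < 1} = z then sortTerm S F a f else 0 := by
  induction n generalizing z F with
  | zero =>
    obtain rfl : z = 0 := by omega
    rw [Fintype.sum_unique, sortTerm, Subsingleton.elim (Tuple.sort _) 1]
    simp
  | succ n ih =>
    rw [sum_fin_succ_two, sum_add_distrib]
    have h1 : ∀ z' : ℕ, z' ≤ n → ∑ f : Fin n → Fin 2,
        (if #{j | (Fin.cons 0 f : Fin (n + 1) → Fin 2) j < 1} = z' + 1 then
          sortTerm S F a (Fin.cons 0 f : Fin (n + 1) → Fin 2) else 0) =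
        shuffle M S ((List.ofFn fun i => a (Fin.succ i)).take z')
          ((List.ofFn fun i => a (Fin.succ i)).drop z') (slice M S (a 0) F) := by
      intro z' hz'
      rw [ih z' hz']
      refine sum_congr rfl fun f _ => ?_
      rw [card_lt_one_cons, if_pos Fin.zero_lt_one, sortTerm_cons F a 0 f 0 (by simp),
        Fin.val_zero, pow_zero, one_smul]
      simp only [add_left_inj, Fin.zero_succAbove]
    have h2 : ∀ p : Fin (n + 1), ∑ f : Fin n → Fin 2,
        (if #{j | (Fin.cons 1 f : Fin (n + 1) → Fin 2) j < 1} = p then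
          sortTerm S F a (Fin.cons 1 f : Fin (n + 1) → Fin 2) else 0) =
        (-1 : S) ^ (p : ℕ) • shuffle M S ((List.ofFn fun i => a (p.succAbove i)).take p)
          ((List.ofFn fun i => a (p.succAbove i)).drop p) (slice M S (a p) F) := by
      intro p
      rw [ih p (by omega), smul_sum]
      refine sum_congr rfl fun f _ => ?_
      rw [card_lt_one_cons, if_neg (lt_irrefl _), add_zero]
      split_ifs with h
      · exact sortTerm_cons F a 1 f p h.symm
      · rw [smul_zero]
    cases z with
    | zero =>
      have h3 : ∑ f : Fin n → Fin 2,
        (if #{j | (Fin.cons 0 f : Fin (n + 1) → Fin 2) j < 1} = 0 then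
          sortTerm S F a (Fin.cons 0 f : Fin (n + 1) → Fin 2) else 0) = 0 :=
        sum_eq_zero fun f _ => by rw [card_lt_one_cons, if_pos Fin.zero_lt_one, if_neg (by omega)]
      have h4 := h2 0
      rw [Fin.val_zero] at h4
      rw [h3, h4, zero_add, pow_zero, one_smul, shuffle_take_drop_zero]
    | succ z =>
      rw [h1 z (by omega)]
      rcases Nat.lt_or_ge z n with hzn | hzn
      · have h4 := h2 ⟨z + 1, by omega⟩
        dsimp only at h4
        rw [h4]
        have h5 := drop_ofFn_succAbove a ⟨z + 1, by omega⟩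
        have h6 := take_ofFn_succAbove a ⟨z + 1, by omega⟩
        dsimp only at h5 h6
        rw [← h6, h5, List.ofFn_succ, List.take_succ_cons, shuffle_cons_cons,
          List.length_take, List.length_ofFn, min_eq_left hzn.le, ← h5]
        simp
      · obtain rfl : z = n := by omega
        have h3 : ∑ f : Fin z → Fin 2,
          (if #{j | (Fin.cons 1 f : Fin (z + 1) → Fin 2) j < 1} = z + 1 then
            sortTerm S F a (Fin.cons 1 f : Fin (z + 1) → Fin 2) else 0) = 0 :=
          sum_eq_zero fun f _ => by
            rw [card_lt_one_cons, if_neg (lt_irrefl _), if_neg]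
            have := card_le_univ ({j | f j < 1} : Finset (Fin z))
            rw [Fintype.card_fin] at this
            omega
        rw [h3, add_zero, List.drop_eq_nil_of_le (by simp), List.drop_eq_nil_of_le (by simp),
          shuffle_nil_right, shuffle_nil_right, slice_apply, List.take_of_length_le (by simp),
          List.take_of_length_le (by simp), List.ofFn_succ]

theorem adams_ofFn {n : ℕ} (F : List A → M) (a : Fin n → A) :
    adams M S F (List.ofFn a) = ∑ f : Fin n → Fin 2, sortTerm S F a f := by
  rw [adams_eq, cut_eq_sum, List.length_ofFn, sum_congr rfl fun z hz =>
    shuffle_take_drop z (Nat.lt_succ_iff.1 (mem_range.1 hz)) F a, sum_comm]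
  refine sum_congr rfl fun f _ => ?_
  rw [sum_ite_eq, if_pos]
  have := card_le_univ ({j | f j < 1} : Finset (Fin n))
  rw [Fintype.card_fin] at this
  exact mem_range.2 (by omega)

end SortShuffle

end WordCochain

/-! ## Hochschild cochains as functions on words -/

namespace Hochschild

open WordCochain

section ToFun

variable {A : Type*} [CommRing A] [Algebra ℂ A]

/-- The function on words given by a Hochschild cochain. -/
def toWords (n : ℕ) : Cochain A n →ₗ[ℂ] (List A → A) where
  toFun C l := if h : l.length = n then C fun i => l.get (Fin.cast h.symm i) else 0
  map_add' C D := by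
    funext l
    by_cases h : l.length = n <;> simp [h]
  map_smul' c C := by
    funext l
    by_cases h : l.length = n <;> simp [h]

theorem toWords_apply {n : ℕ} (C : Cochain A n) (l : List A) : toWords n C l =
    if h : l.length = n then C fun i => l.get (Fin.cast h.symm i) else 0 := rfl

theorem toWords_ofFn {n : ℕ} (C : Cochain A n) (a : Fin n → A) :
    toWords n C (List.ofFn a) = C a := by
  rw [toWords_apply, dif_pos List.length_ofFn]
  congr 1
  funext i
  simp

theorem toWords_of_length_ne {n : ℕ} (C : Cochain A n) {l : List A} (h : l.length ≠ n) :
    toWords n C l = 0 := by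
  rw [toWords_apply, dif_neg h]

theorem toWords_injective (n : ℕ) : Function.Injective (toWords (A := A) n) := fun C D h => by
  ext a
  rw [← toWords_ofFn, h, toWords_ofFn]

/-- Functions on words that are supported in length `n` are determined by the values on the tuples
of length `n`. -/
theorem ext_ofFn {n : ℕ} {M : Type*} [Zero M] {F G : List A → M}
    (hF : ∀ l : List A, l.length ≠ n → F l = 0) (hG : ∀ l : List A, l.length ≠ n → G l = 0)
    (h : ∀ a : Fin n → A, F (List.ofFn a) = G (List.ofFn a)) : F = G := by
  funext l
  by_cases hl : l.length = n
  · subst hl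
    rw [← List.ofFn_get l]
    exact h _
  · rw [hF l hl, hG l hl]

theorem toWords_curryLeft {n : ℕ} (C : Cochain A (n + 1)) (a : A) (t : List A) :
    toWords (n + 1) C (a :: t) = toWords n (C.curryLeft a) t := by
  by_cases h : t.length = n
  · subst h
    obtain ⟨b, hb⟩ : ∃ b : Fin t.length → A, t = List.ofFn b := ⟨t.get, (List.ofFn_get t).symm⟩
    generalize t.length = n at *
    subst hb
    rw [toWords_ofFn, MultilinearMap.curryLeft_apply, ← toWords_ofFn, List.ofFn_cons]
  · rw [toWords_of_length_ne _ h, toWords_of_length_ne _ (by simpa using h)]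

theorem toWords_mem_coch {n : ℕ} (C : Cochain A n) : toWords n C ∈ coch A A n := by
  induction n with
  | zero => exact fun a t => toWords_of_length_ne C (by simp)
  | succ n ih =>
    refine mem_coch_succ.2 ⟨toWords_of_length_ne C (by simp), fun a b t => ?_, fun c a t => ?_,
      fun a => ?_⟩
    · simp only [toWords_curryLeft, map_add, Pi.add_apply]
    · simp only [toWords_curryLeft, map_smul, Pi.smul_apply]
    · simp only [toWords_curryLeft]
      exact ih _

theorem exists_toWords_eq {n : ℕ} {F : List A → A} (hF : F ∈ coch A A n) :
    ∃ C : Cochain A n, toWords n C = F := by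
  induction n generalizing F with
  | zero =>
    refine ⟨MultilinearMap.constOfIsEmpty ℂ _ (F []), ?_⟩
    funext l
    cases l with
    | nil => exact toWords_ofFn _ Fin.elim0
    | cons a t => rw [toWords_of_length_ne _ (by simp), mem_coch_zero.1 hF]
  | succ n ih =>
    choose D hD using fun a => ih ((mem_coch_succ.1 hF).2.2.2 a)
    let L : A →ₗ[ℂ] Cochain A n :=
      { toFun := D
        map_add' := fun a b => toWords_injective n <| by
          rw [map_add, hD, hD, hD]
          funext t
          exact (mem_coch_succ.1 hF).2.1 a b t
        map_smul' := fun c a => toWords_injective n <| by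
          rw [RingHom.id_apply, map_smul, hD, hD]
          funext t
          exact (mem_coch_succ.1 hF).2.2.1 c a t }
    refine ⟨LinearMap.uncurryLeft (M := fun _ : Fin (n + 1) => A) L, ?_⟩
    funext l
    cases l with
    | nil => rw [toWords_of_length_ne _ (by simp), (mem_coch_succ.1 hF).1]
    | cons a t =>
      rw [toWords_curryLeft, LinearMap.curry_uncurryLeft]
      exact congr_fun (hD a) t

variable (A) in
/-- `A` as a symmetric bimodule over itself. -/
instance envModule : Module (Env A) A := Module.compHom A (envMul A : Env A →+* A)

theorem env_smul_def (z : Env A) (a : A) : z • a = envMul A z * a := rfl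

instance envScalarTower : IsScalarTower ℂ (Env A) A :=
  ⟨fun c z a => by rw [env_smul_def, env_smul_def, map_smul, smul_mul_assoc]⟩

/-- The recursive coboundary on words is the usual alternating sum. In the induction the first
letter is curried, and `merge` supplies the face multiplying the first two letters and cancels the
spurious first face of the curried cochain. -/
theorem hd_toWords {n : ℕ} (C : Cochain A n) :
    hd A (toWords n C) = toWords (n + 1) (coboundary A n C) := by
  refine ext_ofFn (n := n + 1)
    (fun l hl => coch_apply_of_length_ne (cobd_mem_coch _ _ (toWords_mem_coch C)) hl)
    (fun l hl => toWords_of_length_ne _ hl) fun a => ?_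
  rw [toWords_ofFn]
  induction n with
  | zero =>
    rw [coboundary_apply, List.ofFn_succ, List.ofFn_zero, hd, cobd_cons, cobd_nil, merge_nil]
    have h : ∀ b : Fin 0 → A, toWords 0 C [] = C b := fun b => by
      rw [← List.ofFn_zero (f := b), toWords_ofFn]
    have e : Fin.init a = Fin.tail a := Subsingleton.elim _ _
    simp [env_smul_def, h (Fin.tail a), e, mul_comm]
  | succ n ih =>
    have h0 : (fun i : Fin (n + 1) => a i.succ) = Fin.tail a := rfl
    rw [List.ofFn_succ, hd, cobd_cons, h0]
    have h1 : slice A (Env A) (a 0) (toWords (n + 1) C) = toWords n (C.curryLeft (a 0)) := by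
      funext t; exact toWords_curryLeft C (a 0) t
    have h2 := ih (C.curryLeft (a 0)) (Fin.tail a)
    rw [hd] at h2
    rw [h1, h2, toWords_ofFn, coboundary_apply, coboundary_apply]
    have h3 : List.ofFn (Fin.tail a) = a 1 :: List.ofFn (Fin.tail (Fin.tail a)) := by
      rw [List.ofFn_succ]; rfl
    have h4 : ∀ (b : A) (t : Fin n → A), toWords (n + 1) C (b :: List.ofFn t) =
        C (Fin.cons b t) := fun b t => by
      rw [← toWords_ofFn, List.ofFn_cons]
    rw [h3, merge_cons, h4, h4, Fin.sum_univ_succ]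
    have h5 : Fin.contractNth (Fin.castSucc 0) (· * ·) a =
        (Fin.cons (a 0 * a 1) (Fin.tail (Fin.tail a)) : Fin (n + 1) → A) := by
      funext i
      refine Fin.cases ?_ (fun i => ?_) i
      · simp [Fin.contractNth]
      · simp [Fin.contractNth, Fin.tail]
    have h6 : ∀ j : Fin n, Fin.contractNth j.succ.castSucc (· * ·) a =
        (Fin.cons (a 0) (Fin.contractNth j.castSucc (· * ·) (Fin.tail a)) :
          Fin (n + 1) → A) := fun j => by
      funext i
      refine Fin.cases ?_ (fun i => ?_) i
      · simp [Fin.contractNth]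
      · simp [Fin.contractNth, Fin.tail]
    have h7 : Fin.init a = (Fin.cons (a 0) (Fin.init (Fin.tail a)) : Fin (n + 1) → A) := by
      funext i
      refine Fin.cases rfl (fun i => ?_) i
      rfl
    rw [h5, h7]
    simp only [h6, MultilinearMap.curryLeft_apply, env_smul_def]
    simp only [Fin.val_zero, Fin.val_succ, pow_succ, zero_add, pow_zero, mul_neg, mul_one,
      neg_smul, one_smul, neg_neg, Finset.sum_neg_distrib, RingHom.coe_coe, envMul_lft]
    have h8 : Fin.tail a (Fin.last n) = a (Fin.last (n + 1)) := rfl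
    have h9 : Fin.tail a 0 = a 1 := rfl
    rw [h8, h9]
    ring

theorem adams_toWords {n : ℕ} (C : Cochain A n) :
    adams A (Env A) (toWords n C) = toWords n (adamsOp A n C) := by
  funext l
  obtain ⟨m, a, rfl⟩ : ∃ (m : ℕ) (a : Fin m → A), l = List.ofFn a :=
    ⟨l.length, l.get, (List.ofFn_get l).symm⟩
  rw [adams_ofFn]
  by_cases h : m = n
  · subst h
    rw [toWords_ofFn, adamsOp_apply_eq_sum_sort]
    refine Finset.sum_congr rfl fun f _ => ?_
    rw [sortTerm, toWords_ofFn, env_smul_def, map_intCast]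
    rw [Int.cast_smul_eq_zsmul, zsmul_eq_mul]
  · rw [toWords_of_length_ne _ (by simpa using h)]
    refine Finset.sum_eq_zero fun f _ => ?_
    rw [sortTerm, toWords_of_length_ne _ (by simpa using h), smul_zero]

/-- On words this is `cobd_adams`; it applies because A is a symmetric bimodule over itself. -/
theorem coboundary_adamsOp {n : ℕ} (C : Cochain A n) :
    coboundary A n (adamsOp A n C) = adamsOp A (n + 1) (coboundary A n C) := by
  apply toWords_injective
  rw [← hd_toWords, ← adams_toWords, ← adams_toWords, ← hd_toWords]
  refine cobd_adams _ _ (fun a m => ?_) _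
  simp [env_smul_def]

end ToFun

end Hochschild

/-! ### Adams weights of the coordinates of the comparison map. -/

namespace WordCochain

open Hochschild

universe u

section Weights

variable {A : Type u} [CommRing A] [Algebra ℂ A]

/-- With coefficients in A the left and right actions coincide, so the two mirrored pairs carry the
same coefficient and form symmetrized pairs. -/
theorem pairIns_adams (x : A) (T : Finset (A × A)) (F : List A → A) :
    pairIns A x T (adams A (Env A) F) = (2 : Env A) • adams A (Env A) (pairIns A x T F) := by
  have key : ∀ F : List A → A, pairIns A x T F = ∑ p ∈ T, lft A p.2 •
      (ins A (Env A) [p.1, x] F + ins A (Env A) [x, p.1] F) := fun F => by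
    rw [pairIns_apply]
    refine Finset.sum_congr rfl fun p _ => ?_
    rw [smul_add]
    congr 1
    funext t
    simp [env_smul_def]
  rw [key, key, map_sum, Finset.smul_sum]
  refine Finset.sum_congr rfl fun p _ => ?_
  rw [ins_symm_pair_adams, map_smul, smul_comm]

variable (x y : A) (T U : Finset (A × A))

theorem omega_adams (F : List A → A) :
    omega A x y T U (adams A (Env A) F) = (2 : Env A) • adams A (Env A) (omega A x y T U F) := by
  rw [omega_apply, omega_apply, pairIns_adams, pairIns_adams, ← smul_add, ← map_add, map_smul,
    smul_comm]

theorem dpow_adams (k : ℕ) (F : List A → A) : dpow A x y T U k (adams A (Env A) F) =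
    (2 : Env A) ^ k • adams A (Env A) (dpow A x y T U k F) := by
  have key : ∀ F, (omega A x y T U ^ k) (adams A (Env A) F) =
      (2 : Env A) ^ k • adams A (Env A) ((omega A x y T U ^ k) F) := by
    induction k with
    | zero => intro F; simp
    | succ k ih =>
      intro F
      rw [pow_succ, Module.End.mul_apply, Module.End.mul_apply, omega_adams, map_smul, ih,
        smul_smul, pow_succ, mul_comm]
  rw [dpow_apply, dpow_apply, key, map_smul, smul_comm]

theorem adams_nil (F : List A → A) : adams A (Env A) F [] = F [] := by
  rw [adams_eq, cut_nil, shuffle_nil_left]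

theorem compA_adams (k : ℕ) (F : List A → A) : compA A x y T U k (adams A (Env A) F) =
    (2 : Env A) ^ k • compA A x y T U k F := by
  rw [compA_apply, dpow_adams, Pi.smul_apply, adams_nil, compA_apply]

theorem compX_adams (k : ℕ) (F : List A → A) : compX A x y T U k (adams A (Env A) F) =
    (2 : Env A) ^ (k + 1) • compX A x y T U k F := by
  rw [compX_apply, dpow_adams, map_smul, ins_singleton_adams, smul_smul, ← pow_succ, Pi.smul_apply,
    adams_nil, compX_apply]

theorem compY_adams (k : ℕ) (F : List A → A) : compY A x y T U k (adams A (Env A) F) =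
    (2 : Env A) ^ (k + 1) • compY A x y T U k F := by
  rw [compY_apply, dpow_adams, map_smul, ins_singleton_adams, smul_smul, ← pow_succ, Pi.smul_apply,
    adams_nil, compY_apply]

theorem compB_adams (k : ℕ) (F : List A → A) : compB A x y T U k (adams A (Env A) F) =
    (2 : Env A) ^ (k + 2) • compB A x y T U k F := by
  rw [compB_apply, dpow_adams, map_smul, ins_singleton_adams, smul_smul, ← pow_succ, map_smul,
    ins_singleton_adams, smul_smul, ← pow_succ, Pi.smul_apply, adams_nil, compB_apply]

end Weights

end WordCochain

/-! ### Passage of the Hodge components to the small complex. -/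

namespace Hochschild

open WordCochain

universe u

section Components

variable {A : Type u} [CommRing A] [Algebra ℂ A]

theorem hodgeProjector_mem {n k : ℕ} (C : Cochain A n) :
    hodgeProjector A n k C ∈ hodgeCochains A n k := ⟨C, rfl⟩

/-- For every j the difference of the two sides is a 2^j-eigenvector of the Adams operation, and the
differences sum to zero over all j. -/
theorem coboundary_hodgeProjector {n : ℕ} (k : ℕ) (C : Cochain A n) :
    coboundary A n (hodgeProjector A n k C) = hodgeProjector A (n + 1) k (coboundary A n C) := by
  have h := eq_zero_of_sum_eq_zero (adamsOp A (n + 1))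
    (c := fun j => coboundary A n (hodgeProjector A n j C) -
      hodgeProjector A (n + 1) j (coboundary A n C)) (s := Finset.range (max (n + 1) k + 1))
    (fun j _ => by
      rw [map_sub, smul_sub, adamsOp_hodgeProjector, ← coboundary_adamsOp,
        adamsOp_hodgeProjector, map_smul])
    (by rw [Finset.sum_sub_distrib, ← map_sum, sum_hodgeProjector (by omega),
      sum_hodgeProjector (by omega), sub_self]) k (Finset.mem_range.2 (by omega))
  exact sub_eq_zero.1 h

theorem hodgeProjector_mem_hodgeCocycles {n k : ℕ} {C : Cochain A n} (hC : C ∈ cocycles A n) :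
    hodgeProjector A n k C ∈ hodgeCocycles A n k := by
  refine ⟨LinearMap.mem_ker.2 ?_, hodgeProjector_mem C⟩
  rw [coboundary_hodgeProjector, LinearMap.mem_ker.1 hC, map_zero]

/-- A linear map that vanishes on all Hodge components but one factors through the projector. -/
theorem map_hodgeProjector {n k : ℕ} {W : Type*} [AddCommGroup W] [Module ℂ W]
    (L : Cochain A n →ₗ[ℂ] W) (hL : ∀ j, j ≠ k → ∀ C ∈ hodgeCochains A n j, L C = 0)
    (C : Cochain A n) : L (hodgeProjector A n k C) = L C := by
  conv_rhs => rw [← sum_hodgeProjector (N := max n k + 1) (by omega) C, map_sum]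
  rw [Finset.sum_eq_single k (fun j _ hj => hL j hj _ (hodgeProjector_mem C))
    (fun h => absurd (Finset.mem_range.2 (by omega)) h)]

/-- If a coordinate of weight j is nonzero on the i-th Hodge component, then i = j. -/
theorem eq_zero_of_weight {i j : ℕ} {a : A} (h : (2 : ℂ) ^ i • a = (2 : Env A) ^ j • a)
    (hij : i ≠ j) : a = 0 := by
  rw [env_smul_def, map_pow, map_ofNat, ← map_ofNat (algebraMap ℂ A), ← map_pow,
    ← Algebra.smul_def, ← sub_eq_zero, ← sub_smul] at h
  refine (smul_eq_zero.1 h).resolve_left (sub_ne_zero.2 fun e => hij ?_)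
  have e' : ((2 ^ i : ℕ) : ℂ) = ((2 ^ j : ℕ) : ℂ) := by push_cast; exact e
  exact Nat.pow_right_injective le_rfl (Nat.cast_injective e')

variable (x y : A) (T U : Finset (A × A))

/-- The comparison map to the small complex on Hochschild cochains. -/
def smallComp (n : ℕ) : Cochain A n →ₗ[ℂ] A × A :=
  (comp A x y T U n).restrictScalars ℂ ∘ₗ toWords n

theorem smallComp_apply (n : ℕ) (C : Cochain A n) :
    smallComp x y T U n C = comp A x y T U n (toWords n C) := rfl

variable {x y T U}

theorem comp_adams_of_mem {n j : ℕ} {C : Cochain A n} (hC : C ∈ hodgeCochains A n j) :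
    comp A x y T U n (adams A (Env A) (toWords n C)) = (2 : ℂ) ^ j • smallComp x y T U n C := by
  rw [adams_toWords, mem_hodgeCochains.1 hC, map_smul, smallComp_apply,
    LinearMap.map_smul_of_tower]

theorem smallComp_odd_eq_zero {m j : ℕ} {C : Cochain A (2 * m + 1)}
    (hC : C ∈ hodgeCochains A (2 * m + 1) j) (hj : j ≠ m + 1) :
    smallComp x y T U (2 * m + 1) C = 0 := by
  have h := comp_adams_of_mem (x := x) (y := y) (T := T) (U := U) hC
  rw [smallComp_apply, comp_odd, comp_odd, compX_adams, compY_adams] at h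
  rw [smallComp_apply, comp_odd]
  exact Prod.ext (eq_zero_of_weight (congr_arg Prod.fst h).symm hj)
    (eq_zero_of_weight (congr_arg Prod.snd h).symm hj)

theorem smallComp_even_fst_eq_zero {m j : ℕ} {C : Cochain A (2 * (m + 1))}
    (hC : C ∈ hodgeCochains A (2 * (m + 1)) j) (hj : j ≠ m + 1) :
    (smallComp x y T U (2 * (m + 1)) C).1 = 0 := by
  have h := comp_adams_of_mem (x := x) (y := y) (T := T) (U := U) hC
  rw [smallComp_apply, comp_even, comp_even, compA_adams] at h
  rw [smallComp_apply, comp_even]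
  exact eq_zero_of_weight (congr_arg Prod.fst h).symm hj

theorem smallComp_even_snd_eq_zero {m j : ℕ} {C : Cochain A (2 * (m + 1))}
    (hC : C ∈ hodgeCochains A (2 * (m + 1)) j) (hj : j ≠ m + 2) :
    (smallComp x y T U (2 * (m + 1)) C).2 = 0 := by
  have h := comp_adams_of_mem (x := x) (y := y) (T := T) (U := U) hC
  rw [smallComp_apply, comp_even, comp_even, compB_adams] at h
  rw [smallComp_apply, comp_even]
  exact eq_zero_of_weight (congr_arg Prod.snd h).symm hj

theorem diff_smul_self (a b : A) : diff a • b = 0 := by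
  rw [env_smul_def, envMul_diff, zero_mul]

theorem sd_zero (c : A × A) : sd A x y T U 0 c = 0 := by
  rw [sd, smallD_zero, diff_smul_self, diff_smul_self]; rfl

/-- With coefficients in A the elements `diff x` and `diff y` act by zero, and only the half of each
matrix containing the difference quotients remains. -/
theorem sd_odd (m : ℕ) (c : A × A) : sd A x y T U (2 * m + 1) c =
    (envMul A (symPresented T) * c.1 + envMul A (symPresented U) * c.2, 0) := by
  rw [sd, smallD_odd _ _ _ _ (by omega), diff_smul_self, diff_smul_self, sub_zero]; rfl

theorem sd_even (m : ℕ) (c : A × A) : sd A x y T U (2 * (m + 1)) c =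
    (-(envMul A (symPresented U) * c.2), envMul A (symPresented T) * c.2) := by
  rw [sd, smallD_even _ _ _ _ (by omega) (by omega), diff_smul_self, diff_smul_self, zero_add,
    zero_sub]; rfl

theorem smallComp_coboundary (hR : IsResolving x y T U) {n : ℕ} (C : Cochain A n) :
    smallComp x y T U (n + 1) (coboundary A n C) = sd A x y T U n (smallComp x y T U n C) := by
  rw [smallComp_apply, ← hd_toWords, comp_hd hR.rel (toWords_mem_coch C)]; rfl

theorem sd_smallComp (hR : IsResolving x y T U) {n : ℕ} {C : Cochain A n}
    (hC : C ∈ cocycles A n) :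
    sd A x y T U n (smallComp x y T U n C) = 0 := by
  rw [← smallComp_coboundary hR, LinearMap.mem_ker.1 hC, map_zero]

theorem exists_coboundary_eq (hR : IsResolving x y T U) {n : ℕ} {C : Cochain A (n + 1)}
    (hC : C ∈ cocycles A (n + 1)) (c : A × A) (hc : sd A x y T U n c = smallComp x y T U (n + 1) C) :
    ∃ D, coboundary A n D = C := by
  obtain ⟨G, hG, h⟩ := (isComparison hR n A).1 _ (toWords_mem_coch C)
    (by rw [hd_toWords, LinearMap.mem_ker.1 hC, map_zero]) ⟨c, hc⟩
  obtain ⟨D, rfl⟩ := exists_toWords_eq hG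
  rw [hd_toWords] at h
  exact ⟨D, toWords_injective _ h⟩

theorem exists_cocycle_smallComp_eq (hR : IsResolving x y T U) (n : ℕ) (c : A × A)
    (hc : sd A x y T U (n + 1) c = 0) :
    ∃ C ∈ cocycles A (n + 1), ∃ b, smallComp x y T U (n + 1) C = c + sd A x y T U n b := by
  obtain ⟨F, hF, h, b, hb⟩ := (isComparison hR n A).2 c hc
  obtain ⟨C, rfl⟩ := exists_toWords_eq hF
  refine ⟨C, LinearMap.mem_ker.2 (toWords_injective _ ?_), b, hb⟩
  rw [← hd_toWords, h, map_zero]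

/-- A primitive of a cochain in the j-th component may be projected to that component, as the
projectors commute with the coboundary. -/
theorem mem_hodgeCoboundaries_iff (hR : IsResolving x y T U) {n j : ℕ} {C : Cochain A (n + 1)}
    (hC : C ∈ hodgeCocycles A (n + 1) j) : C ∈ hodgeCoboundaries A (n + 1) j ↔
      ∃ c, sd A x y T U n c = smallComp x y T U (n + 1) C := by
  constructor
  · rintro ⟨D, -, rfl⟩
    exact ⟨_, (smallComp_coboundary hR D).symm⟩
  · rintro ⟨c, hc⟩
    obtain ⟨D, rfl⟩ := exists_coboundary_eq hR hC.1 c hc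
    refine ⟨hodgeProjector A n j D, hodgeProjector_mem D, ?_⟩
    rw [coboundary_hodgeProjector, hodgeProjector_eq (mem_hodgeCochains.1 hC.2)]

/-- The three exclusions are exactly the weights of the coordinates of `smallComp`, so a cocycle in
this component is sent to zero and is a coboundary. -/
theorem subsingleton_hodgeCohomology (hR : IsResolving x y T U) {n j : ℕ} (hn : 0 < n)
    (h0 : n ≠ 2 * j) (h1 : n + 1 ≠ 2 * j) (h2 : n + 2 ≠ 2 * j) : Subsingleton (HodgeCohomology A n j) := by
  refine Submodule.Quotient.subsingleton_iff.2 (Submodule.submoduleOf_eq_top.2 ?_)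
  intro C hC
  obtain ⟨m, rfl | rfl⟩ := Nat.even_or_odd' n
  · obtain ⟨m, rfl⟩ : ∃ k, m = k + 1 := ⟨m - 1, by omega⟩
    refine (mem_hodgeCoboundaries_iff (n := 2 * m + 1) hR hC).2 ⟨0, ?_⟩
    rw [map_zero]
    exact (Prod.ext (smallComp_even_fst_eq_zero hC.2 (by omega))
      (smallComp_even_snd_eq_zero hC.2 (by omega))).symm
  · refine (mem_hodgeCoboundaries_iff hR hC).2 ⟨0, ?_⟩
    rw [map_zero]
    exact (smallComp_odd_eq_zero hC.2 (by omega)).symm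

end Components

end Hochschild

/-! ### Annihilators of the gradient ideal lie in the positive part. -/

namespace PlaneCurve

open MvPolynomial

section PositivePart

variable {R : MvPolynomial (Fin 2) ℂ}

theorem mk_mem_positivePart {f : MvPolynomial (Fin 2) ℂ} (hf : constantCoeff f = 0) :
    Ideal.Quotient.mk (Ideal.span {R}) f ∈ positivePart R :=
  Ideal.mem_map_of_mem _ ((RingHom.mem_ker).2 hf)

/-- If `f ∂ᵢR` is divisible by `R` for all `i` and `f` does not vanish at the origin, then neither
does `R`, unless `R = 0`. -/
theorem eq_zero_of_dvd_mul_pderiv {f : MvPolynomial (Fin 2) ℂ} (hf : constantCoeff f ≠ 0)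
    (h : ∀ i, R ∣ f * pderiv i R) (h0 : constantCoeff R = 0) : R = 0 := by
  have key : ∀ N : ℕ, ∀ m : Fin 2 →₀ ℕ, m.degree = N → coeff m R = 0 := by
    intro N
    induction N using Nat.strong_induction_on with
    | _ N ih =>
      intro m hm
      by_cases hm0 : m = 0
      · rw [hm0]; exact h0
      obtain ⟨i, hi⟩ : ∃ i, m i ≠ 0 := by
        by_contra hcon
        push Not at hcon
        exact hm0 (Finsupp.ext hcon)
      obtain ⟨m', rfl⟩ : ∃ m', m = m' + Finsupp.single i 1 :=
        ⟨m - Finsupp.single i 1, (tsub_add_cancel_of_le (by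
          rw [Finsupp.single_le_iff]; omega)).symm⟩
      have hdeg : m'.degree + 1 = N := by
        rw [← hm, map_add, Finsupp.degree_single]
      obtain ⟨g, hg⟩ := h i
      -- Compare coefficients at `m'`, one degree below m = m' + eᵢ. On the side divisible by R only
      -- coefficients of R of degree < N enter, and they vanish by induction; in f ∂ᵢR the sole
      -- survivor is f(0) (m' i + 1) times the coefficient of R at m.
      have h1 := congr_arg (coeff m') hg
      rw [coeff_mul, coeff_mul] at h1
      rw [Finset.sum_eq_zero (s := Finset.HasAntidiagonal.antidiagonal m')
        (f := fun x => coeff x.1 R * coeff x.2 g) (fun p hp => by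
          have hp' := congr_arg Finsupp.degree (Finset.HasAntidiagonal.mem_antidiagonal.1 hp)
          rw [map_add] at hp'
          rw [ih _ (by omega) p.1 rfl, zero_mul])] at h1
      rw [Finset.sum_eq_single (0, m') (fun p hp hne => by
          have hp1 := Finset.HasAntidiagonal.mem_antidiagonal.1 hp
          have hp' := congr_arg Finsupp.degree hp1
          rw [map_add] at hp'
          have hp0 : p.1.degree ≠ 0 := fun e => by
            have e := (Finsupp.degree_eq_zero_iff _).1 e
            refine hne (Prod.ext e ?_)
            rwa [e, zero_add] at hp1
          rw [coeff_pderiv, ih (p.2.degree + 1) (by omega) _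
            (by rw [map_add, Finsupp.degree_single]), zero_mul, mul_zero])
        (fun hcon => absurd (Finset.HasAntidiagonal.mem_antidiagonal.2 (zero_add m')) hcon),
        coeff_pderiv] at h1
      rcases mul_eq_zero.1 h1 with h2 | h2
      · exact absurd h2 hf
      · refine (mul_eq_zero.1 h2).resolve_right ?_
        exact_mod_cast Nat.succ_ne_zero (m' i)
  exact MvPolynomial.ext _ _ fun m => by rw [key _ m rfl, coeff_zero]

/-- If a representative f does not vanish at the origin, then neither does R, by comparing orders at
the origin. A constant multiple of R can then be subtracted from f to remove its constant term. -/
theorem mem_positivePart_of_mul_partialR_eq_zero (hR : R ≠ 0) {a : CoordRing R}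
    (ha : ∀ i, a * partialR R i = 0) : a ∈ positivePart R := by
  obtain ⟨f, rfl⟩ := Ideal.Quotient.mk_surjective a
  by_cases hf : constantCoeff f = 0
  · exact mk_mem_positivePart hf
  have h0 : constantCoeff R ≠ 0 := fun h0 => hR <| eq_zero_of_dvd_mul_pderiv hf (fun i => by
    have := ha i
    rw [partialR, ← map_mul, Ideal.Quotient.eq_zero_iff_mem, Ideal.mem_span_singleton] at this
    exact this) h0
  have e : Ideal.Quotient.mk (Ideal.span {R}) f =
      Ideal.Quotient.mk (Ideal.span {R}) (f - C (constantCoeff f / constantCoeff R) * R) := by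
    rw [map_sub, map_mul, Ideal.Quotient.eq_zero_iff_mem.2 (Ideal.mem_span_singleton_self R),
      mul_zero, sub_zero]
  rw [e]
  refine mk_mem_positivePart ?_
  rw [map_sub, map_mul, constantCoeff_C, div_mul_cancel₀ _ h0, sub_self]

theorem mem_gradientAnnihilator (hR : R ≠ 0) {a : CoordRing R} :
    a ∈ gradientAnnihilator R ↔ partialR R 0 * a = 0 ∧ partialR R 1 * a = 0 := by
  constructor
  · rintro ⟨-, h⟩
    exact ⟨by rw [mul_comm, h], by rw [mul_comm, h]⟩
  · rintro ⟨h0, h1⟩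
    have h : ∀ i, a * partialR R i = 0 := by
      intro i
      fin_cases i
      · rw [mul_comm]; exact h0
      · rw [mul_comm]; exact h1
    exact ⟨mem_positivePart_of_mul_partialR_eq_zero hR h, h⟩

end PositivePart

/-! ### Vector fields in coordinates. -/

section VectorFields

variable (R : MvPolynomial (Fin 2) ℂ)

/-- The vector field with given components. -/
def fieldOf : CoordRing R × CoordRing R →ₗ[ℂ] VectorField R where
  toFun c := mkDerivation ℂ ![c.1, c.2]
  map_add' c d := derivation_ext fun i => by fin_cases i <;> simp
  map_smul' s c := derivation_ext fun i => by fin_cases i <;> simp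

theorem fieldOf_X_zero (c : CoordRing R × CoordRing R) : fieldOf R c (X 0) = c.1 := by
  simp [fieldOf]

theorem fieldOf_X_one (c : CoordRing R × CoordRing R) : fieldOf R c (X 1) = c.2 := by
  simp [fieldOf]

theorem fieldOf_components (v : VectorField R) : fieldOf R (v (X 0), v (X 1)) = v :=
  derivation_ext fun i => by
    fin_cases i
    · exact fieldOf_X_zero R _
    · exact fieldOf_X_one R _

theorem fieldOf_injective : Function.Injective (fieldOf R) := fun c d h =>
  Prod.ext (by rw [← fieldOf_X_zero, h, fieldOf_X_zero]) (by rw [← fieldOf_X_one, h, fieldOf_X_one])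

theorem fieldOf_apply (c : CoordRing R × CoordRing R) (f : MvPolynomial (Fin 2) ℂ) :
    fieldOf R c f = Ideal.Quotient.mk (Ideal.span {R}) (pderiv 0 f) * c.1 +
      Ideal.Quotient.mk (Ideal.span {R}) (pderiv 1 f) * c.2 := by
  have key : fieldOf R c =
      c.1 • (Algebra.linearMap (MvPolynomial (Fin 2) ℂ) (CoordRing R)).compDer
          (pderiv (R := ℂ) (0 : Fin 2)) +
        c.2 • (Algebra.linearMap (MvPolynomial (Fin 2) ℂ) (CoordRing R)).compDer
          (pderiv (R := ℂ) (1 : Fin 2)) := by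
    refine derivation_ext fun i => ?_
    fin_cases i <;> simp [fieldOf, pderiv_X]
  rw [key, mul_comm, mul_comm _ c.2]
  rfl

theorem fieldOf_mem_tangentFields {c : CoordRing R × CoordRing R} :
    fieldOf R c ∈ tangentFields R ↔ partialR R 0 * c.1 + partialR R 1 * c.2 = 0 := by
  change fieldOf R c R = 0 ↔ _
  rw [fieldOf_apply]; rfl

/-- The pairs on the right are the values of the even differential of the small complex; the sign is
absorbed into the multiplier -b. -/
theorem fieldOf_mem_dualGradientMultiples {c : CoordRing R × CoordRing R} :
    fieldOf R c ∈ dualGradientMultiples R ↔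
      ∃ b, (-(partialR R 1 * b), partialR R 0 * b) = c := by
  have e : ∀ b : CoordRing R,
      fieldOf R (-(partialR R 1 * b), partialR R 0 * b) = (-b) • dualGradient R := fun b =>
    derivation_ext fun i => by
      fin_cases i <;> simp [fieldOf, dualGradient] <;> ring
  constructor
  · intro h
    obtain ⟨a, ha⟩ := Submodule.mem_span_singleton.1 h
    refine ⟨-a, fieldOf_injective R ?_⟩
    rw [e, neg_neg, ha]
  · rintro ⟨b, rfl⟩
    rw [e]
    exact Submodule.mem_span_singleton.2 ⟨-b, rfl⟩

theorem mem_gradientIdeal {a : CoordRing R} :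
    a ∈ gradientIdeal R ↔ ∃ c : CoordRing R × CoordRing R,
      partialR R 0 * c.1 + partialR R 1 * c.2 = a := by
  have e : Set.range (partialR R) = {partialR R 0, partialR R 1} := by
    ext b
    simp [Fin.exists_fin_two, eq_comm]
  rw [gradientIdeal, e, Ideal.mem_span_pair]
  constructor
  · rintro ⟨p, q, h⟩
    exact ⟨(p, q), by rw [← h]; ring⟩
  · rintro ⟨c, h⟩
    exact ⟨c.1, c.2, by rw [← h]; ring⟩

end VectorFields

end PlaneCurve

section Subquotient

variable {V W : Type*} [AddCommGroup V] [Module ℂ V] [AddCommGroup W] [Module ℂ W]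

theorem nonempty_subquotient_equiv {Z B : Submodule ℂ V} (ψ : Z →ₗ[ℂ] W)
    (hψ : Function.Surjective ψ) (h : ∀ z : Z, ψ z = 0 ↔ (z : V) ∈ B) :
    Nonempty (Subquotient Z B ≃ₗ[ℂ] W) := by
  have e : B.submoduleOf Z = LinearMap.ker ψ := by
    ext z
    rw [LinearMap.mem_ker, h z]; rfl
  exact ⟨(Submodule.quotEquivOfEq _ _ e).trans (ψ.quotKerEquivOfSurjective hψ)⟩

end Subquotient

/-! ### Reading off the cohomology from the small complex. -/

namespace PlaneCurve

open MvPolynomial Hochschild WordCochain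

section Cohomology

variable {R : MvPolynomial (Fin 2) ℂ} {x y : CoordRing R} {T U : Finset (CoordRing R × CoordRing R)}

/-- The small differential out of degree zero vanishes on A, so nothing is divided out in degree
one. -/
theorem nonempty_cohomology_one (hres : IsResolving x y T U)
    (hT : envMul _ (symPresented T) = partialR R 0) (hU : envMul _ (symPresented U) = partialR R 1) :
    Nonempty (Cohomology (CoordRing R) 1 ≃ₗ[ℂ] tangentFields R) := by
  have hmem : ∀ C : cocycles (CoordRing R) 1,
      fieldOf R (smallComp x y T U 1 C) ∈ tangentFields R := fun C => by
    have h := sd_smallComp hres C.2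
    rw [sd_odd 0, hT, hU] at h
    exact (fieldOf_mem_tangentFields R).2 (congr_arg Prod.fst h)
  refine nonempty_subquotient_equiv (W := tangentFields R)
    (((fieldOf R ∘ₗ smallComp x y T U 1) ∘ₗ (cocycles (CoordRing R) 1).subtype).codRestrict
      (tangentFields R) hmem) (fun v => ?_) fun C => ?_
  · have hv : partialR R 0 * v.1 (X 0) + partialR R 1 * v.1 (X 1) = 0 := by
      refine (fieldOf_mem_tangentFields R (c := (v.1 (X 0), v.1 (X 1)))).1 ?_
      rw [fieldOf_components]
      exact v.2
    obtain ⟨C, hC, b, hb⟩ := exists_cocycle_smallComp_eq hres 0 (v.1 (X 0), v.1 (X 1))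
      (by rw [sd_odd 0, hT, hU, hv]; rfl)
    rw [sd_zero, add_zero] at hb
    refine ⟨⟨C, hC⟩, Subtype.ext ?_⟩
    change fieldOf R (smallComp x y T U 1 C) = v
    rw [hb, fieldOf_components]
  · rw [← Submodule.coe_eq_zero]
    change fieldOf R (smallComp x y T U 1 C) = 0 ↔ (C : Cochain (CoordRing R) 1) ∈
      LinearMap.range (coboundary (CoordRing R) 0)
    rw [map_eq_zero_iff _ (fieldOf_injective R)]
    constructor
    · intro h
      exact exists_coboundary_eq hres C.2 0 (by rw [h, map_zero])
    · rintro ⟨D, hD⟩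
      rw [← hD, smallComp_coboundary hres, sd_zero]

/-- This component sees the first coordinate in even degree, on which the outgoing differential is
zero; the incoming one has image DR there. -/
theorem nonempty_hodgeCohomology_even (hres : IsResolving x y T U)
    (hT : envMul _ (symPresented T) = partialR R 0) (hU : envMul _ (symPresented U) = partialR R 1)
    (m : ℕ) :
    Nonempty (HodgeCohomology (CoordRing R) (2 * (m + 1)) (m + 1) ≃ₗ[ℂ]
      (CoordRing R ⧸ gradientIdeal R)) := by
  let L : Cochain (CoordRing R) (2 * (m + 1)) →ₗ[ℂ] CoordRing R :=
    LinearMap.fst ℂ _ _ ∘ₗ smallComp x y T U (2 * (m + 1))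
  -- A cocycle with prescribed image need not lie in the component; projecting it does not change
  -- the coordinate of that weight.
  have hL : ∀ C, L (hodgeProjector (CoordRing R) (2 * (m + 1)) (m + 1) C) = L C :=
    map_hodgeProjector L fun j hj C hC => smallComp_even_fst_eq_zero hC hj
  refine nonempty_subquotient_equiv
    (((Ideal.Quotient.mkₐ ℂ (gradientIdeal R)).toLinearMap ∘ₗ L) ∘ₗ Submodule.subtype _)
    (fun w => ?_) fun C => ?_
  · obtain ⟨a, rfl⟩ := Ideal.Quotient.mk_surjective w
    obtain ⟨C, hC, b, hb⟩ := exists_cocycle_smallComp_eq hres (2 * m + 1) (a, 0)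
      (by rw [show 2 * m + 1 + 1 = 2 * (m + 1) by ring, sd_even, mul_zero, mul_zero, neg_zero]; rfl)
    refine ⟨⟨_, hodgeProjector_mem_hodgeCocycles (k := m + 1) hC⟩, ?_⟩
    change Ideal.Quotient.mk (gradientIdeal R) (L (hodgeProjector _ (2 * (m + 1)) (m + 1) C)) = _
    rw [hL, Ideal.Quotient.mk_eq_mk_iff_sub_mem, mem_gradientIdeal]
    refine ⟨b, ?_⟩
    rw [sd_odd, hT, hU] at hb
    have hb : L C = a + (partialR R 0 * b.1 + partialR R 1 * b.2) := congr_arg Prod.fst hb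
    rw [hb, add_sub_cancel_left]
  · change Ideal.Quotient.mk (gradientIdeal R) (smallComp x y T U (2 * (m + 1)) C).1 = 0 ↔ _
    have h2 := smallComp_even_snd_eq_zero (x := x) (y := y) (T := T) (U := U) C.2.2
      (show m + 1 ≠ m + 2 by omega)
    have h3 := mem_hodgeCoboundaries_iff (n := 2 * m + 1) hres C.2
    change _ ↔ (C : Cochain (CoordRing R) (2 * m + 1 + 1)) ∈ hodgeCoboundaries _ (2 * m + 1 + 1) _
    rw [h3, Ideal.Quotient.eq_zero_iff_mem, mem_gradientIdeal]
    refine exists_congr fun c => ?_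
    rw [sd_odd, hT, hU]
    exact ⟨fun h => Prod.ext h h2.symm, fun h => congr_arg Prod.fst h⟩

/-- This component sees the second coordinate, which receives no coboundaries; being a cocycle means
that it is annihilated by both partial derivatives. -/
theorem nonempty_hodgeCohomology_even_succ (hres : IsResolving x y T U)
    (hT : envMul _ (symPresented T) = partialR R 0) (hU : envMul _ (symPresented U) = partialR R 1)
    (hR : R ≠ 0) (m : ℕ) :
    Nonempty (HodgeCohomology (CoordRing R) (2 * (m + 1)) (m + 2) ≃ₗ[ℂ]
      gradientAnnihilator R) := by
  let L : Cochain (CoordRing R) (2 * (m + 1)) →ₗ[ℂ] CoordRing R :=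
    LinearMap.snd ℂ _ _ ∘ₗ smallComp x y T U (2 * (m + 1))
  have hL : ∀ C, L (hodgeProjector (CoordRing R) (2 * (m + 1)) (m + 2) C) = L C :=
    map_hodgeProjector L fun j hj C hC => smallComp_even_snd_eq_zero hC hj
  have hmem : ∀ C : hodgeCocycles (CoordRing R) (2 * (m + 1)) (m + 2),
      L C ∈ gradientAnnihilator R := fun C => by
    have h := sd_smallComp hres C.2.1
    rw [sd_even, hT, hU] at h
    exact (mem_gradientAnnihilator hR).2
      ⟨congr_arg Prod.snd h, neg_eq_zero.1 (congr_arg Prod.fst h)⟩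
  refine nonempty_subquotient_equiv (W := gradientAnnihilator R)
    ((L ∘ₗ Submodule.subtype _).codRestrict (gradientAnnihilator R) hmem)
    (fun a => ?_) fun C => ?_
  · have ha := (mem_gradientAnnihilator hR).1 a.2
    obtain ⟨C, hC, b, hb⟩ := exists_cocycle_smallComp_eq hres (2 * m + 1) (0, a)
      (by rw [show 2 * m + 1 + 1 = 2 * (m + 1) by ring, sd_even, hT, hU, ha.1, ha.2, neg_zero]; rfl)
    refine ⟨⟨_, hodgeProjector_mem_hodgeCocycles (k := m + 2) hC⟩, Subtype.ext ?_⟩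
    change L (hodgeProjector _ (2 * (m + 1)) (m + 2) C) = _
    rw [sd_odd] at hb
    have hb : L C = a + 0 := congr_arg Prod.snd hb
    rw [hL, hb, add_zero]
  · rw [← Submodule.coe_eq_zero]
    change (smallComp x y T U (2 * (m + 1)) C).2 = 0 ↔
      (C : Cochain (CoordRing R) (2 * m + 1 + 1)) ∈ hodgeCoboundaries _ (2 * m + 1 + 1) _
    have h1 := smallComp_even_fst_eq_zero (x := x) (y := y) (T := T) (U := U) C.2.2
      (show m + 2 ≠ m + 1 by omega)
    rw [mem_hodgeCoboundaries_iff (n := 2 * m + 1) hres C.2]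
    constructor
    · intro h
      exact ⟨0, by rw [map_zero]; exact (Prod.ext h1 h).symm⟩
    · rintro ⟨c, hc⟩
      rw [sd_odd] at hc
      exact (congr_arg Prod.snd hc).symm

/-- Both coordinates in odd degree have the same weight. The incoming differential from positive
even degree produces exactly the multiples of dR*, in contrast to degree one. -/
theorem nonempty_hodgeCohomology_odd (hres : IsResolving x y T U)
    (hT : envMul _ (symPresented T) = partialR R 0) (hU : envMul _ (symPresented U) = partialR R 1)
    (m : ℕ) :
    Nonempty (HodgeCohomology (CoordRing R) (2 * (m + 1) + 1) (m + 2) ≃ₗ[ℂ]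
      Subquotient (tangentFields R) (dualGradientMultiples R)) := by
  let L : Cochain (CoordRing R) (2 * (m + 1) + 1) →ₗ[ℂ] VectorField R :=
    fieldOf R ∘ₗ smallComp x y T U (2 * (m + 1) + 1)
  have hL : ∀ C, L (hodgeProjector (CoordRing R) (2 * (m + 1) + 1) (m + 2) C) = L C :=
    map_hodgeProjector L fun j hj C hC => by
      change fieldOf R _ = 0
      rw [smallComp_odd_eq_zero hC hj, map_zero]
  have hmem : ∀ C : hodgeCocycles (CoordRing R) (2 * (m + 1) + 1) (m + 2),
      L C ∈ tangentFields R := fun C => by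
    have h := sd_smallComp hres C.2.1
    rw [sd_odd, hT, hU] at h
    exact (fieldOf_mem_tangentFields R).2 (congr_arg Prod.fst h)
  refine nonempty_subquotient_equiv
    (Submodule.mkQ _ ∘ₗ (L ∘ₗ Submodule.subtype _).codRestrict (tangentFields R) hmem)
    (fun w => ?_) fun C => ?_
  · obtain ⟨v, rfl⟩ := Submodule.mkQ_surjective _ w
    have hv : partialR R 0 * v.1 (X 0) + partialR R 1 * v.1 (X 1) = 0 := by
      refine (fieldOf_mem_tangentFields R (c := (v.1 (X 0), v.1 (X 1)))).1 ?_
      rw [fieldOf_components]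
      exact v.2
    obtain ⟨C, hC, b, hb⟩ := exists_cocycle_smallComp_eq hres (2 * (m + 1))
      (v.1 (X 0), v.1 (X 1)) (by rw [sd_odd, hT, hU, hv]; rfl)
    refine ⟨⟨_, hodgeProjector_mem_hodgeCocycles (k := m + 2) hC⟩, ?_⟩
    rw [LinearMap.comp_apply, Submodule.mkQ_apply, Submodule.mkQ_apply, Submodule.Quotient.eq]
    change L (hodgeProjector _ (2 * (m + 1) + 1) (m + 2) C) - v.1 ∈ dualGradientMultiples R
    rw [hL]
    change fieldOf R (smallComp x y T U (2 * (m + 1) + 1) C) - v.1 ∈ dualGradientMultiples R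
    rw [hb, map_add, fieldOf_components, add_sub_cancel_left,
      fieldOf_mem_dualGradientMultiples, sd_even, hT, hU]
    exact ⟨b.2, rfl⟩
  · rw [LinearMap.comp_apply, Submodule.mkQ_apply, Submodule.Quotient.mk_eq_zero]
    change fieldOf R (smallComp x y T U (2 * (m + 1) + 1) C) ∈ dualGradientMultiples R ↔ _
    rw [fieldOf_mem_dualGradientMultiples, mem_hodgeCoboundaries_iff hres C.2]
    constructor
    · rintro ⟨b, hb⟩
      exact ⟨(0, b), by rw [sd_even, hT, hU, hb]⟩
    · rintro ⟨c, hc⟩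
      exact ⟨c.2, by rw [← hc, sd_even, hT, hU]⟩

end Cohomology

end PlaneCurve

end

theorem theorem4p9 (R : MvPolynomial (Fin 2) ℂ) (hR : R ≠ 0) :
    Nonempty (Hochschild.Cohomology (PlaneCurve.CoordRing R) 1 ≃ₗ[ℂ]
      PlaneCurve.tangentFields R) ∧
    (∀ k : ℕ, 0 < k →
      Nonempty (Hochschild.HodgeCohomology (PlaneCurve.CoordRing R) (2 * k) k ≃ₗ[ℂ]
        (PlaneCurve.CoordRing R ⧸ PlaneCurve.gradientIdeal R)) ∧
      Nonempty (Hochschild.HodgeCohomology (PlaneCurve.CoordRing R) (2 * k) (k + 1) ≃ₗ[ℂ]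
        PlaneCurve.gradientAnnihilator R) ∧
      Nonempty (Hochschild.HodgeCohomology (PlaneCurve.CoordRing R) (2 * k + 1) (k + 1) ≃ₗ[ℂ]
        Subquotient (PlaneCurve.tangentFields R) (PlaneCurve.dualGradientMultiples R))) ∧
    (∀ n j : ℕ, 0 < n → n ≠ 2 * j → n + 1 ≠ 2 * j → n + 2 ≠ 2 * j →
      Subsingleton (Hochschild.HodgeCohomology (PlaneCurve.CoordRing R) n j)) := by
  obtain ⟨T, U, hres, hT, hU⟩ := PlaneCurve.exists_isResolving R hR
  refine ⟨PlaneCurve.nonempty_cohomology_one hres hT hU, fun k hk => ?_,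
    fun n j hn h0 h1 h2 => Hochschild.subsingleton_hodgeCohomology hres hn h0 h1 h2⟩
  obtain ⟨m, rfl⟩ : ∃ m, k = m + 1 := ⟨k - 1, by omega⟩
  exact ⟨PlaneCurve.nonempty_hodgeCohomology_even hres hT hU m,
    PlaneCurve.nonempty_hodgeCohomology_even_succ hres hT hU hR m,
    PlaneCurve.nonempty_hodgeCohomology_odd hres hT hU m⟩
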